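/- Let $\mathbb H^2$ be the hyperbolic plane. A symmetric right-angled hexagon is a (closed, convex) geodesic hexagon $H\subset\mathbb H^2$ with six right angles and three pairwise non-consecutive edges of the same length $2L$; these are called the long edges of $H$, and the other three edges, whose common length is denoted $2l$, the short edges. Distances in $H$ are those of $\mathbb H^2$. For each short edge $s$, the points of $H$ at distance at most $L$ from $s$ form a component $C_s$ of the foliated region of $H$. It is foliated by the hypercyclic leaves $\{z\in H: d(z,s)=t\}$, $0\le t\le L$, and by the orthogonal geodesic leaves, which are the intersections of $C_s$ with the geodesics perpendicular to $s$ at the points $p\in s$. The rest of $H$ is the non-foliated central region. Let $k\ge 1$ and let $H$ be a symmetric right-angled hexagon with long edges of length $2L$. Then there is a symmetric right-angled hexagon $H_k$ with long edges of length $2kL$. For every such $H_k$, with short edges of length $2l_k$, and for labellings of the vertices of $H$ and $H_k$ in counterclockwise order that match long edges with long edges, the following holds. (1) There is a homeomorphism $h_k:H\to H_k$ that maps each long (short) edge of $H$ onto the corresponding long (short) edge of $H_k$, maps each component $C_s$ of the foliated region of $H$ onto the corresponding component for $H_k$, and is given on $C_s$ as follows: a point $z\in C_s$ at distance $d$ from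 $s$, on the geodesic leaf issuing from the point of $s$ at distance $a$ from the first endpoint of $s$, goes to the point at distance $kd$ from the corresponding short edge $s'$ of $H_k$, on the geodesic leaf issuing from the point of $s'$ at distance $a\,l_k/l$ from the first endpoint of $s'$. This $h_k$ maps each leaf of the hypercyclic foliation of $H$ onto a leaf of the hypercyclic foliation of $H_k$ and each leaf of the orthogonal geodesic foliation of $H$ onto a leaf of that of $H_k$; it is $k$-Lipschitz, and its Lipschitz constant $$\mathrm{Lip}(h_k)=\sup_{x\ne y\in H}\frac{d(h_k(x),h_k(y))}{d(x,y)}$$ is equal to $k$. (2) Every map $f:H\to H_k$ that maps each long edge of $H$ onto a long edge of $H_k$ satisfies $\mathrm{Lip}(f)\ge k$. In particular there is no such $k'$-Lipschitz map with $k'<k$, and $h_k$ is Lipschitz-extremal. -/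

import Mathlib

noncomputable section

/-! ### Lipschitz constants -/

/-- `Lip(f) = sup_{x ≠ y} d(f x, f y) / d(x, y)`, with values in `[0, ∞]`. -/
def lipConst {X Y : Type*} [MetricSpace X] [MetricSpace Y] (f : X → Y) : ENNReal :=
  ⨆ (x : X) (y : X) (_ : x ≠ y), edist (f x) (f y) / edist x y

/-! ### Angles, sides and segments in the hyperbolic plane -/

/-- The position of `q` in the Poincaré disk centred at `p`: the image of `q` under the conformal
isometry `z ↦ (z - p) / (z - p̄)` from the upper half-plane to the unit disk, which sends `p` to `0`
and the geodesic rays from `p` to Euclidean rays from `0`. -/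
def diskCoord (p q : UpperHalfPlane) : ℂ :=
  ((q : ℂ) - (p : ℂ)) / ((q : ℂ) - (starRingEnd ℂ) (p : ℂ))

/-- The unoriented angle at `p` between the geodesic rays from `p` through `q` and through `r`
(for `q ≠ p` and `r ≠ p`). -/
def hypAngle (p q r : UpperHalfPlane) : ℝ :=
  InnerProductGeometry.angle (diskCoord p q) (diskCoord p r)

/-- For `p ≠ q`: positive (zero, negative) when `z` is to the left of (on, to the right of) the
complete geodesic through `p` and `q`, directed from `p` to `q`. -/
def hypSide (p q z : UpperHalfPlane) : ℝ :=
  ((starRingEnd ℂ) (diskCoord p q) * diskCoord p z).im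

/-- The geodesic segment from `p` to `q`. -/
def hypSegment (p q : UpperHalfPlane) : Set UpperHalfPlane :=
  {z | dist p z + dist z q = dist p q}

/-! ### Symmetric right-angled hexagons -/

/-- `v 0, …, v 5` are, in counterclockwise order, the vertices of a strictly convex hexagon with
right angles whose three edges `[v 0, v 1]`, `[v 2, v 3]`, `[v 4, v 5]` (the "long" edges) have the
same length. Indices are modulo `6`. -/
structure IsSymmetricHexagon (v : Fin 6 → UpperHalfPlane) : Prop where
  convex : ∀ i j : Fin 6, j ≠ i → j ≠ i + 1 → 0 < hypSide (v i) (v (i + 1)) (v j)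
  right_angle : ∀ i : Fin 6, hypAngle (v i) (v (i - 1)) (v (i + 1)) = Real.pi / 2
  long_eq₁ : dist (v 2) (v 3) = dist (v 0) (v 1)
  long_eq₂ : dist (v 4) (v 5) = dist (v 0) (v 1)

/-- The closed region of the hyperbolic plane bounded by the convex hexagon, with the metric of the
hyperbolic plane. -/
def hexRegion (v : Fin 6 → UpperHalfPlane) : Set UpperHalfPlane :=
  {z | ∀ i : Fin 6, 0 ≤ hypSide (v i) (v (i + 1)) z}

/-- First vertex (counterclockwise) of the `i`-th long edge. -/
def longIdx : Fin 3 → Fin 6 := ![0, 2, 4]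

/-- First vertex (counterclockwise) of the `i`-th short edge. -/
def shortIdx : Fin 3 → Fin 6 := ![1, 3, 5]

/-- The `i`-th long edge. -/
def longEdge (v : Fin 6 → UpperHalfPlane) (i : Fin 3) : Set UpperHalfPlane :=
  hypSegment (v (longIdx i)) (v (longIdx i + 1))

/-- The `i`-th short edge. -/
def shortEdge (v : Fin 6 → UpperHalfPlane) (i : Fin 3) : Set UpperHalfPlane :=
  hypSegment (v (shortIdx i)) (v (shortIdx i + 1))

/-- The length `2 l` of the `i`-th short edge. -/
def shortLength (v : Fin 6 → UpperHalfPlane) (i : Fin 3) : ℝ :=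
  dist (v (shortIdx i)) (v (shortIdx i + 1))

/-- Half the length of the long edges, `L`. -/
def halfLong (v : Fin 6 → UpperHalfPlane) : ℝ := dist (v 0) (v 1) / 2

/-- The `i`-th long edge, as a subset of the hexagon. -/
def longSide (v : Fin 6 → UpperHalfPlane) (i : Fin 3) : Set (hexRegion v) :=
  {z | (z : UpperHalfPlane) ∈ longEdge v i}

/-- The `i`-th short edge, as a subset of the hexagon. -/
def shortSide (v : Fin 6 → UpperHalfPlane) (i : Fin 3) : Set (hexRegion v) :=
  {z | (z : UpperHalfPlane) ∈ shortEdge v i}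

/-- `w` is a symmetric right-angled hexagon whose long edges are `k` times as long as those
of `v`. -/
structure IsStretchedHexagon (k : ℝ) (v w : Fin 6 → UpperHalfPlane) : Prop where
  symmetric : IsSymmetricHexagon w
  long_eq : dist (w 0) (w 1) = k * dist (v 0) (v 1)

/-! ### The two partial foliations -/

/-- The component of the foliated region along the `i`-th short edge: the points of the hexagon at
distance at most `L` from that edge. -/
def foliatedPart (v : Fin 6 → UpperHalfPlane) (i : Fin 3) : Set (hexRegion v) :=
  {z | Metric.infDist (z : UpperHalfPlane) (shortEdge v i) ≤ halfLong v}

/-- The points of the hexagon at distance `t` from the `i`-th short edge. For `0 ≤ t ≤ L` this is a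
leaf of the hypercyclic foliation. -/
def hypercycleLeaf (v : Fin 6 → UpperHalfPlane) (i : Fin 3) (t : ℝ) : Set (hexRegion v) :=
  {z | Metric.infDist (z : UpperHalfPlane) (shortEdge v i) = t}

/-- The leaf of the orthogonal geodesic foliation issuing from the point `p` of the `i`-th short
edge: the points of the `i`-th foliated component on the geodesic that is perpendicular at `p` to
that edge. -/
def geodesicLeaf (v : Fin 6 → UpperHalfPlane) (i : Fin 3) (p : UpperHalfPlane) :
    Set (hexRegion v) :=
  {z | z ∈ foliatedPart v i ∧ ((z : UpperHalfPlane) = p ∨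
    ∀ q ∈ shortEdge v i, q ≠ p → hypAngle p (z : UpperHalfPlane) q = Real.pi / 2)}

/-- `p'` is the point of the `i`-th short edge of `w` that corresponds to the point `p` of the
`i`-th short edge of `v` under the affine map between these edges: if `p` is at distance `s` from
the first endpoint, then `p'` is at distance `s * l_k / l` from the first endpoint. -/
structure CorrespondingFoot (v w : Fin 6 → UpperHalfPlane) (i : Fin 3)
    (p p' : UpperHalfPlane) : Prop where
  mem : p ∈ shortEdge v i
  mem' : p' ∈ shortEdge w i
  dist_eq : dist (w (shortIdx i)) p' =
    shortLength w i / shortLength v i * dist (v (shortIdx i)) p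

/-- `h` is given on the foliated region of the hexagon by the stretch formula: a point at
distance `d` from a short edge, on the geodesic leaf issuing from the point `p` of that edge, goes
to the point at distance `k d` from the corresponding short edge, on the geodesic leaf issuing from
the point `p'` that corresponds to `p`. -/
structure IsLeafwiseStretch (k : ℝ) (v w : Fin 6 → UpperHalfPlane)
    (h : hexRegion v → hexRegion w) : Prop where
  dist_eq : ∀ i, ∀ z ∈ foliatedPart v i,
    Metric.infDist (h z : UpperHalfPlane) (shortEdge w i) =
      k * Metric.infDist (z : UpperHalfPlane) (shortEdge v i)
  foot : ∀ i, ∀ p p' : UpperHalfPlane, CorrespondingFoot v w i p p' →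
    ∀ z ∈ geodesicLeaf v i p, h z ∈ geodesicLeaf w i p'

/-- `h` maps every leaf of the hypercyclic foliation of the `i`-th foliated component onto a leaf
of the hypercyclic foliation of the `i`-th foliated component. -/
def PreservesHypercycles (v w : Fin 6 → UpperHalfPlane) (h : hexRegion v → hexRegion w) : Prop :=
  ∀ i, ∀ t ∈ Set.Icc 0 (halfLong v), ∃ t' ∈ Set.Icc 0 (halfLong w),
    h '' hypercycleLeaf v i t = hypercycleLeaf w i t'

/-- `h` maps every leaf of the orthogonal geodesic foliation of the `i`-th foliated component onto
a leaf of the orthogonal geodesic foliation of the `i`-th foliated component. -/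
def PreservesGeodesics (v w : Fin 6 → UpperHalfPlane) (h : hexRegion v → hexRegion w) : Prop :=
  ∀ i, ∀ p ∈ shortEdge v i, ∃ p' ∈ shortEdge w i,
    h '' geodesicLeaf v i p = geodesicLeaf w i p'

/-- Every long edge is mapped onto a long edge. -/
def SendsLongToLong (v w : Fin 6 → UpperHalfPlane) (f : hexRegion v → hexRegion w) : Prop :=
  ∀ i, ∃ j, f '' longSide v i = longSide w j

end

/-! Everything is computed in the hyperboloid model. The inward unit normals `N i` of the short
edges have pairwise products `-cosh 2L`, and the vertices are explicit combinations of them, so `L`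
determines the hexagon up to isometry (`IsSymmetricHexagon.isHexFrame`). Fermi coordinates `(a, d)`
along a short edge (position of the foot from the midpoint, signed distance) turn the metric into
`dd² + cosh² d da²`, the foliated region into `d ≤ L`, and its leaves into coordinate lines. Half
the short length, `l`, satisfies `sinh L * sinh l = 1/2`.

The hexagon is cut into three sectors, the sets of points nearest to a given short edge. On each one
the map is `(a, d) ↦ (r a, ψ a d)` with `r = l'/l`. For `d ≤ L` the height is `k d`. For `d ≥ L` put
`p = 1 - (cosh L / cosh d)²` and `x = l - |a|`; the sector is then `p ≤ sinh² L sinh² x`, and `ψ`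
rescales `p` by the factor, depending on `x` alone, that carries the top of one sector to the top of
the other. Two neighbouring sectors meet where `d` agrees and `a` changes sign, so the pieces glue
because `ψ` is even in `a` and respects tops (`IsSectorMap.exists_image`). The same construction
with `L` and `L'` exchanged is the inverse.

For the bound by `k`, the differential in orthonormal frames is triangular with horizontal entry
`A`, vertical entry `B` and shear `S`. Its norm is at most `k` when `A² ≤ k²`, `B² ≤ k²` and `k² S²
≤ (k² - A²)(k² - B²)` (`quadratic_le`). The bounds used increase with `p`, so the top of the sector
decides (`stretch_estimate`). There `B / k` is a quotient of values of `stretchRate`, and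
`stretchRate ^ 6 * tanh x / x` decreases in `L` at fixed `x / l` (`logRate_deriv_nonpos`, from
`hexagon_inequality`). The factor `tanh x / x` provides exactly the slack that pays for the shear
(`shear_le`).

The pointwise bound is integrated along geodesics, which stay in the convex hexagon
(`dist_le_mul_of_local`, `IsGlued.dist_le`). Conversely, a map taking a long edge onto a long edge
must reach two points at distance `2kL` from two points at distance at most `2L`, so no constant
below `k` is possible (`SendsLongToLong.le_lipConst`). -/

noncomputable section

/-! ### The hyperboloid model -/

/-- The Minkowski form of signature `(2, 1)` on `ℝ³`. -/
def mink (x y : Fin 3 → ℝ) : ℝ := x 1 * y 1 + x 2 * y 2 - x 0 * y 0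

/-- The determinant of three vectors of `ℝ³`. -/
def det3 (x y z : Fin 3 → ℝ) : ℝ :=
  x 0 * (y 1 * z 2 - y 2 * z 1) - x 1 * (y 0 * z 2 - y 2 * z 0) + x 2 * (y 0 * z 1 - y 1 * z 0)

/-- The isometry from the upper half-plane to the hyperboloid. -/
def toHyp (z : UpperHalfPlane) : Fin 3 → ℝ :=
  ![(1 + z.re ^ 2 + z.im ^ 2) / (2 * z.im), z.re / z.im, (z.re ^ 2 + z.im ^ 2 - 1) / (2 * z.im)]

lemma mink_comm (x y : Fin 3 → ℝ) : mink x y = mink y x := by simp only [mink]; ring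

lemma mink_add_left (x y z : Fin 3 → ℝ) : mink (x + y) z = mink x z + mink y z := by
  simp only [mink, Pi.add_apply]; ring

lemma mink_sub_left (x y z : Fin 3 → ℝ) : mink (x - y) z = mink x z - mink y z := by
  simp only [mink, Pi.sub_apply]; ring

lemma mink_smul_left (r : ℝ) (x z : Fin 3 → ℝ) : mink (r • x) z = r * mink x z := by
  simp only [mink, Pi.smul_apply, smul_eq_mul]; ring

lemma mink_add_right (x y z : Fin 3 → ℝ) : mink x (y + z) = mink x y + mink x z := by
  simp only [mink, Pi.add_apply]; ring

lemma mink_sub_right (x y z : Fin 3 → ℝ) : mink x (y - z) = mink x y - mink x z := by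
  simp only [mink, Pi.sub_apply]; ring

lemma mink_smul_right (r : ℝ) (x z : Fin 3 → ℝ) : mink x (r • z) = r * mink x z := by
  simp only [mink, Pi.smul_apply, smul_eq_mul]; ring

lemma mink_neg_left (x z : Fin 3 → ℝ) : mink (-x) z = -mink x z := by
  simp only [mink, Pi.neg_apply]; ring

lemma mink_neg_right (x z : Fin 3 → ℝ) : mink x (-z) = -mink x z := by
  simp only [mink, Pi.neg_apply]; ring

/-- A linear form that vanishes on `p` and `q` is proportional to `det3 p q`. -/
lemma det3_mul_mink {n p q : Fin 3 → ℝ} (hp : mink n p = 0) (hq : mink n q = 0)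
    (x r : Fin 3 → ℝ) : det3 p q x * mink n r = det3 p q r * mink n x := by
  simp only [mink, det3] at *
  linear_combination
    (q 0 * (x 1 * r 2 - x 2 * r 1) - q 1 * (x 0 * r 2 - x 2 * r 0) +
      q 2 * (x 0 * r 1 - x 1 * r 0)) * hp -
    (p 0 * (x 1 * r 2 - x 2 * r 1) - p 1 * (x 0 * r 2 - x 2 * r 0) +
      p 2 * (x 0 * r 1 - x 1 * r 0)) * hq

/-- Expansion of the Minkowski form in an orthonormal frame. -/
lemma mink_eq_of_frame {e f g : Fin 3 → ℝ} (hee : mink e e = -1) (hff : mink f f = 1)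
    (hgg : mink g g = 1) (hef : mink e f = 0) (heg : mink e g = 0) (hfg : mink f g = 0)
    (x y : Fin 3 → ℝ) :
    mink x y = -(mink e x * mink e y) + mink f x * mink f y + mink g x * mink g y := by
  -- `P` has the frame as rows and `Q` is its Minkowski adjoint. Orthonormality is `P * Q = 1`; the
  -- expansion is the other product `Q * P = 1`.
  let P : Matrix (Fin 3) (Fin 3) ℝ := !![e 0, e 1, e 2; f 0, f 1, f 2; g 0, g 1, g 2]
  let Q : Matrix (Fin 3) (Fin 3) ℝ := !![e 0, -f 0, -g 0; -e 1, f 1, g 1; -e 2, f 2, g 2]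
  have h : P * Q = 1 := by
    simp only [mink] at *
    ext i j
    fin_cases i <;> fin_cases j <;>
      simp [P, Q, Matrix.mul_apply, Fin.sum_univ_three] <;> linarith
  have h' : Q * P = 1 := mul_eq_one_comm.mp h
  have H : ∀ i j, (Q * P) i j = (1 : Matrix (Fin 3) (Fin 3) ℝ) i j := fun i j => by rw [h']
  have h00 := H 0 0
  have h01 := H 0 1
  have h02 := H 0 2
  have h11 := H 1 1
  have h12 := H 1 2
  have h22 := H 2 2
  simp [P, Q, Matrix.mul_apply, Fin.sum_univ_three] at h00 h01 h02 h11 h12 h22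
  simp only [mink]
  linear_combination (x 0 * y 0) * h00 - (x 0 * y 1 + x 1 * y 0) * h01 -
    (x 0 * y 2 + x 2 * y 0) * h02 - (x 1 * y 1) * h11 - (x 1 * y 2 + x 2 * y 1) * h12 -
    (x 2 * y 2) * h22

lemma cosh_dist_eq_neg_mink (z w : UpperHalfPlane) :
    Real.cosh (dist z w) = -mink (toHyp z) (toHyp w) := by
  have hz := z.im_pos
  have hw := w.im_pos
  rw [UpperHalfPlane.cosh_dist, Complex.dist_eq, ← Complex.normSq_eq_norm_sq,
    Complex.normSq_apply]
  simp [mink, toHyp]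
  field_simp
  ring

lemma mink_toHyp_self (z : UpperHalfPlane) : mink (toHyp z) (toHyp z) = -1 := by
  have := cosh_dist_eq_neg_mink z z
  simp at this
  linarith

lemma toHyp_zero_pos (z : UpperHalfPlane) : 0 < toHyp z 0 := by
  have hz := z.im_pos
  simp only [toHyp, Matrix.cons_val_zero]
  positivity

lemma toHyp_injective : Function.Injective toHyp := by
  intro z w h
  have := cosh_dist_eq_neg_mink z w
  rw [h, mink_toHyp_self, neg_neg] at this
  rw [← dist_eq_zero]
  by_contra hd
  exact (Real.one_lt_cosh.mpr hd).ne' this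

/-- In the light-cone coordinate `x 0 - x 2`, the height of the preimage is `1 / (x 0 - x 2)`; it is
positive on the upper sheet. -/
lemma exists_toHyp_eq {x : Fin 3 → ℝ} (hx : mink x x = -1) (h0 : 0 < x 0) :
    ∃ z, toHyp z = x := by
  simp only [mink] at hx
  have hpos : 0 < x 0 - x 2 := by nlinarith [sq_nonneg (x 1), sq_nonneg (x 0 + x 2)]
  refine ⟨⟨⟨x 1 / (x 0 - x 2), 1 / (x 0 - x 2)⟩, by simpa using hpos⟩, ?_⟩
  have hne := hpos.ne'
  have h2 : x 1 ^ 2 = (x 0 - x 2) * (x 0 + x 2) - 1 := by linarith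
  ext i
  fin_cases i <;> simp [toHyp, UpperHalfPlane.re, UpperHalfPlane.im]
  · field_simp
    rw [h2]; ring
  · field_simp
  · field_simp
    rw [h2]; ring

/-- Two timelike vectors in the future cone have negative product. -/
lemma mink_neg_of_timelike {x y : Fin 3 → ℝ} (hx : mink x x = -1) (hx0 : 0 < x 0)
    (hy : mink y y = -1) (hy0 : 0 < y 0) : mink x y < 0 := by
  obtain ⟨z, rfl⟩ := exists_toHyp_eq hx hx0
  obtain ⟨w, rfl⟩ := exists_toHyp_eq hy hy0
  have := cosh_dist_eq_neg_mink z w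
  linarith [Real.cosh_pos (dist z w)]

lemma zero_pos_of_mink_neg {x : Fin 3 → ℝ} (hx : mink x x = -1) {z : UpperHalfPlane}
    (h : mink x (toHyp z) < 0) : 0 < x 0 := by
  have hne : x 0 ≠ 0 := by
    intro h0
    simp only [mink, h0] at hx
    nlinarith [sq_nonneg (x 1), sq_nonneg (x 2)]
  by_contra hn
  have hlt : x 0 < 0 := lt_of_le_of_ne (not_lt.mp hn) hne
  have := mink_neg_of_timelike (x := -x) (y := toHyp z)
    (by rw [mink_neg_left, mink_neg_right, neg_neg, hx]) (by simpa using hlt)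
    (mink_toHyp_self z) (toHyp_zero_pos z)
  rw [mink_neg_left] at this
  linarith

/-! ### Sides and right angles in the hyperboloid model. -/

/-- The denominator of `diskCoord`. -/
def diskDenom (p q : UpperHalfPlane) : ℝ := (q.re - p.re) ^ 2 + (q.im + p.im) ^ 2

lemma diskDenom_pos (p q : UpperHalfPlane) : 0 < diskDenom p q := by
  have hp := p.im_pos
  have hq := q.im_pos
  unfold diskDenom
  positivity

lemma diskCoord_re (p q : UpperHalfPlane) :
    (diskCoord p q).re = ((q.re - p.re) ^ 2 + q.im ^ 2 - p.im ^ 2) / diskDenom p q := by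
  simp only [diskCoord, Complex.div_re, Complex.normSq_apply, Complex.sub_re, Complex.sub_im,
    Complex.conj_re, Complex.conj_im, UpperHalfPlane.coe_re, UpperHalfPlane.coe_im, ← add_div,
    diskDenom]
  congr 1 <;> ring

lemma diskCoord_im (p q : UpperHalfPlane) :
    (diskCoord p q).im = -(2 * p.im * (q.re - p.re)) / diskDenom p q := by
  simp only [diskCoord, Complex.div_im, Complex.normSq_apply, Complex.sub_re, Complex.sub_im,
    Complex.conj_re, Complex.conj_im, UpperHalfPlane.coe_re, UpperHalfPlane.coe_im, ← sub_div,
    diskDenom]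
  congr 1 <;> ring

/-- The side of a geodesic is the sign of a linear form on the hyperboloid; this makes half-planes,
and hence the hexagon, linear objects. -/
lemma hypSide_eq_mul_det3 (p q z : UpperHalfPlane) :
    ∃ r > 0, hypSide p q z = r * det3 (toHyp p) (toHyp q) (toHyp z) := by
  have hp := p.im_pos
  have hq := q.im_pos
  have hz := z.im_pos
  have h1 := diskDenom_pos p q
  have h2 := diskDenom_pos p z
  refine ⟨4 * p.im ^ 2 * q.im * z.im / (diskDenom p q * diskDenom p z), by positivity, ?_⟩
  simp only [hypSide, Complex.mul_im, Complex.conj_re, Complex.conj_im, diskCoord_re,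
    diskCoord_im, det3, toHyp, Matrix.cons_val]
  generalize diskDenom p q = n1 at *
  generalize diskDenom p z = n2 at *
  field_simp
  ring

/-- The hyperbolic law of cosines: the inner product of the disk positions is a positive multiple of
the defect in Pythagoras' theorem. -/
lemma hypAngle_eq_iff (p q r : UpperHalfPlane) :
    hypAngle p q r = Real.pi / 2 ↔
      Real.cosh (dist q r) = Real.cosh (dist p q) * Real.cosh (dist p r) := by
  have hp := p.im_pos
  have hq := q.im_pos
  have hr := r.im_pos
  have h1 := diskDenom_pos p q
  have h2 := diskDenom_pos p r
  rw [hypAngle, ← InnerProductGeometry.inner_eq_zero_iff_angle_eq_pi_div_two]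
  rw [cosh_dist_eq_neg_mink, cosh_dist_eq_neg_mink, cosh_dist_eq_neg_mink]
  have key : inner ℝ (diskCoord p q) (diskCoord p r) =
      4 * p.im ^ 2 * q.im * r.im / (diskDenom p q * diskDenom p r) *
        (-mink (toHyp p) (toHyp q) * -mink (toHyp p) (toHyp r) + mink (toHyp q) (toHyp r)) := by
    rw [Complex.inner]
    simp only [Complex.mul_re, Complex.conj_re, Complex.conj_im, diskCoord_re,
      diskCoord_im, mink, toHyp, Matrix.cons_val]
    generalize diskDenom p q = n1 at *
    generalize diskDenom p r = n2 at *
    field_simp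
    ring
  have h4 : 4 * p.im ^ 2 * q.im * r.im / (diskDenom p q * diskDenom p r) ≠ 0 := by positivity
  rw [key, mul_eq_zero, or_iff_right h4]
  constructor <;> intro h <;> linarith

/-- Any two points are joined by a geodesic whose points are nonnegative combinations of the
endpoints. -/
lemma exists_geodesic (z w : UpperHalfPlane) :
    ∃ γ : ℝ → UpperHalfPlane, γ 0 = z ∧ γ (dist z w) = w ∧
      ∀ s ∈ Set.Icc 0 (dist z w), (∃ α β : ℝ, 0 ≤ α ∧ 0 ≤ β ∧
        toHyp (γ s) = α • toHyp z + β • toHyp w) ∧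
      ∀ t ∈ Set.Icc 0 (dist z w), dist (γ s) (γ t) = |s - t| := by
  set D := dist z w with hD
  have hc : mink (toHyp z) (toHyp w) = -Real.cosh D := by
    rw [hD, cosh_dist_eq_neg_mink, neg_neg]
  rcases eq_or_ne z w with rfl | hne
  · refine ⟨fun _ => z, rfl, rfl, ?_⟩
    have hD0 : D = 0 := by rw [hD, dist_self]
    intro s hs
    refine ⟨⟨1, 0, by simp, by simp, by simp⟩, ?_⟩
    intro t ht
    rw [hD0] at hs ht
    have : s = 0 := le_antisymm hs.2 hs.1
    have : t = 0 := le_antisymm ht.2 ht.1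
    simp [*]
  have hDpos : 0 < D := dist_pos.mpr hne
  have hS : 0 < Real.sinh D := Real.sinh_pos_iff.mpr hDpos
  -- The unit-speed interpolation in the plane spanned by the endpoints.
  let X : ℝ → Fin 3 → ℝ := fun s =>
    (Real.sinh (D - s) / Real.sinh D) • toHyp z + (Real.sinh s / Real.sinh D) • toHyp w
  have hX : ∀ s t, mink (X s) (X t) = -Real.cosh (s - t) := by
    intro s t
    simp only [X, mink_add_left, mink_add_right, mink_smul_left, mink_smul_right,
      mink_toHyp_self, hc, mink_comm (toHyp w) (toHyp z)]
    field_simp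
    rw [Real.sinh_sub, Real.sinh_sub, Real.cosh_sub]
    have h1 := Real.cosh_sq D
    have hn : Real.sinh D ^ 2 = Real.cosh D ^ 2 - 1 := by linarith
    linear_combination (-(Real.sinh s * Real.sinh t)) * hn
  have hex : ∀ s ∈ Set.Icc 0 D, ∃ y, toHyp y = X s := by
    intro s hs
    apply exists_toHyp_eq
    · simpa using hX s s
    · have h1 : 0 ≤ Real.sinh (D - s) := Real.sinh_nonneg_iff.mpr (by linarith [hs.2])
      have h2 : 0 ≤ Real.sinh s := Real.sinh_nonneg_iff.mpr hs.1
      have hz := toHyp_zero_pos z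
      have hw := toHyp_zero_pos w
      simp only [X, Pi.add_apply, Pi.smul_apply, smul_eq_mul]
      rcases hs.1.eq_or_lt with h | h
      · rw [← h]; simp [hS.ne', hz]
      · have h3 : 0 < Real.sinh s := Real.sinh_pos_iff.mpr h
        positivity
  have hex' : ∀ s, ∃ y, s ∈ Set.Icc 0 D → toHyp y = X s := by
    intro s
    by_cases hs : s ∈ Set.Icc 0 D
    · obtain ⟨y, hy⟩ := hex s hs
      exact ⟨y, fun _ => hy⟩
    · exact ⟨z, fun h => absurd h hs⟩
  choose γ hγ using hex'
  refine ⟨γ, ?_, ?_, ?_⟩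
  · apply toHyp_injective
    rw [hγ 0 ⟨le_rfl, hDpos.le⟩]
    simp [X, hS.ne']
  · apply toHyp_injective
    rw [hγ D ⟨hDpos.le, le_rfl⟩]
    simp [X, hS.ne']
  · intro s hs
    refine ⟨⟨Real.sinh (D - s) / Real.sinh D, Real.sinh s / Real.sinh D, ?_, ?_, hγ s hs⟩, ?_⟩
    · exact div_nonneg (Real.sinh_nonneg_iff.mpr (by linarith [hs.2])) hS.le
    · exact div_nonneg (Real.sinh_nonneg_iff.mpr hs.1) hS.le
    · intro t ht
      have := cosh_dist_eq_neg_mink (γ s) (γ t)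
      rw [hγ s hs, hγ t ht, hX, neg_neg] at this
      rw [← Real.cosh_abs (s - t)] at this
      exact Real.cosh_strictMonoOn.injOn (Set.mem_Ici.mpr dist_nonneg)
        (Set.mem_Ici.mpr (abs_nonneg _)) this

/-! ### Normals of the short edges -/

/-- Half the length of the short edges of a symmetric right-angled hexagon whose long edges have
length `2 L`. -/
def halfShort (L : ℝ) : ℝ := Real.arsinh (1 / (2 * Real.sinh L))

lemma sinh_halfShort (L : ℝ) : Real.sinh (halfShort L) = 1 / (2 * Real.sinh L) :=
  Real.sinh_arsinh _

lemma halfShort_pos {L : ℝ} (hL : 0 < L) : 0 < halfShort L := by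
  rw [halfShort, Real.arsinh_pos_iff]
  have := Real.sinh_pos_iff.mpr hL
  positivity

lemma sinh_mul_sinh_halfShort {L : ℝ} (hL : 0 < L) :
    Real.sinh L * Real.sinh (halfShort L) = 1 / 2 := by
  have := Real.sinh_pos_iff.mpr hL
  rw [sinh_halfShort]
  field_simp

/-- `N` are the inward unit normals of the short edges of the hexagon `v`, whose long edges have
length `2 L`. -/
structure IsHexFrame (L : ℝ) (N : Fin 3 → Fin 3 → ℝ) (v : Fin 6 → UpperHalfPlane) : Prop where
  pos : 0 < L
  self : ∀ i, mink (N i) (N i) = 1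
  next : ∀ i, mink (N i) (N (i + 1)) = -Real.cosh (2 * L)
  first : ∀ i, toHyp (v (shortIdx i)) =
    (-(1 / Real.sinh (2 * L))) • (N (i + 2) + Real.cosh (2 * L) • N i)
  second : ∀ i, toHyp (v (shortIdx i + 1)) =
    (-(1 / Real.sinh (2 * L))) • (N (i + 1) + Real.cosh (2 * L) • N i)

lemma eq_of_mink_eq {x y : Fin 3 → ℝ} (h : ∀ z, mink x z = mink y z) : x = y := by
  ext i
  fin_cases i
  · have := h ![1, 0, 0]
    simp [mink] at this
    exact this
  · have := h ![0, 1, 0]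
    simp [mink] at this
    exact this
  · have := h ![0, 0, 1]
    simp [mink] at this
    exact this

/-- The inward unit normal of the edge `[p, q]` is determined by either of the two neighbouring
edges `[q, r]` and `[t, p]`, which are orthogonal to it. -/
lemma normal_eq_normal {p q r t : Fin 3 → ℝ} {c s : ℝ} (hs : 0 < s) (hcs : c ^ 2 = s ^ 2 + 1)
    (hpp : mink p p = -1) (hqq : mink q q = -1) (hrr : mink r r = -1) (htt : mink t t = -1)
    (hqr : mink q r = -c) (hpt : mink p t = -c) (hpr : mink p r = c * mink p q)
    (hqt : mink q t = c * mink p q) (hpq : mink p q < -1)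
    (hr : 0 < det3 p q r) (ht : 0 < det3 p q t) : r - c • q = t - c • p := by
  set g := -mink p q with hg
  have hpq' : mink p q = -g := by rw [hg, neg_neg]
  have hg1 : 1 < g := by linarith
  set w := Real.sqrt (g ^ 2 - 1) with hw
  have hwpos : 0 < w := Real.sqrt_pos.mpr (by nlinarith)
  have hw2 : w ^ 2 = g ^ 2 - 1 := Real.sq_sqrt (by nlinarith)
  have hqp := mink_comm q p
  have hrq := mink_comm r q
  have hrp := mink_comm r p
  have htp := mink_comm t p
  have htq := mink_comm t q
  -- `n` and `n'` are the unit tangents of the two neighbouring edges at `q` and at `p`; both are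
  -- orthogonal to `p` and `q`. With `u`, the unit tangent of the edge at `p`, they can be compared
  -- in the frame `(p, u, n)`, which leaves only the sign `n' = ± n`.
  let n := s⁻¹ • (r - c • q)
  let n' := s⁻¹ • (t - c • p)
  let u := w⁻¹ • (q - g • p)
  have hnn : mink n n = 1 := by
    simp only [n, mink_smul_left, mink_smul_right, mink_sub_left, mink_sub_right, *]
    field_simp
    linarith
  have hn'n' : mink n' n' = 1 := by
    simp only [n', mink_smul_left, mink_smul_right, mink_sub_left, mink_sub_right, *]
    field_simp
    linarith
  have huu : mink u u = 1 := by
    simp only [u, mink_smul_left, mink_smul_right, mink_sub_left, mink_sub_right, hpp, hqq, hqp,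
      hpq']
    field_simp
    linarith
  have hpu : mink p u = 0 := by
    simp only [u, mink_smul_right, mink_sub_right, hpp, hpq']
    ring
  have hpn : mink p n = 0 := by
    simp only [n, mink_smul_right, mink_sub_right, hpr, hpq']
    ring
  have hqn : mink q n = 0 := by
    simp only [n, mink_smul_right, mink_sub_right, hqr, hqq]
    ring
  have hpn' : mink p n' = 0 := by
    simp only [n', mink_smul_right, mink_sub_right, hpt, hpp]
    ring
  have hqn' : mink q n' = 0 := by
    simp only [n', mink_smul_right, mink_sub_right, hqt, hqp, hpq']
    ring
  have hun : mink u n = 0 := by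
    simp only [u, mink_smul_left, mink_sub_left, hpn, hqn]
    ring
  have hun' : mink u n' = 0 := by
    simp only [u, mink_smul_left, mink_sub_left, hpn', hqn']
    ring
  have hexp : ∀ y, mink n' y = mink n n' * mink n y := by
    intro y
    rw [mink_eq_of_frame hpp huu hnn hpu hpn hun n' y, hpn', hun']
    ring
  have hsq : mink n n' ^ 2 = 1 := by
    have := hexp n'
    rw [hn'n'] at this
    linarith
  have hnr : 0 < mink n r := by
    have : mink n r = s := by
      simp only [n, mink_smul_left, mink_sub_left, hrr, hqr]
      field_simp
      linarith
    rw [this]; exact hs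
  -- Convexity selects the sign: `r` and `t` lie on the same side of the line through `p` and `q`.
  have hnt : 0 < mink n t := by
    have h := det3_mul_mink (n := n) (p := p) (q := q) (by rw [mink_comm, hpn])
      (by rw [mink_comm, hqn]) t r
    by_contra hcon
    have h1 : det3 p q r * mink n t ≤ 0 := mul_nonpos_of_nonneg_of_nonpos hr.le (not_lt.mp hcon)
    have h2 : 0 < det3 p q t * mink n r := mul_pos ht hnr
    linarith
  have hpos : 0 < mink n n' := by
    have : mink n n' = s⁻¹ * mink n t := by
      simp only [n', mink_smul_right, mink_sub_right]
      rw [mink_comm n p, hpn]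
      ring
    rw [this]
    positivity
  have hone : mink n n' = 1 := by nlinarith
  have hnn' : n' = n := eq_of_mink_eq fun y => by rw [hexp y, hone, one_mul]
  have h3 : s⁻¹ • (t - c • p) = s⁻¹ • (r - c • q) := hnn'
  exact (smul_right_injective _ (inv_ne_zero hs.ne') h3).symm

lemma det3_toHyp_pos_iff (p q z : UpperHalfPlane) :
    0 < hypSide p q z ↔ 0 < det3 (toHyp p) (toHyp q) (toHyp z) := by
  obtain ⟨r, hr, h⟩ := hypSide_eq_mul_det3 p q z
  rw [h, mul_pos_iff_of_pos_left hr]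

lemma det3_toHyp_nonneg_iff (p q z : UpperHalfPlane) :
    0 ≤ hypSide p q z ↔ 0 ≤ det3 (toHyp p) (toHyp q) (toHyp z) := by
  obtain ⟨r, hr, h⟩ := hypSide_eq_mul_det3 p q z
  rw [h, mul_nonneg_iff_of_pos_left hr]

lemma mink_toHyp_lt_neg_one {p q : UpperHalfPlane} (h : p ≠ q) :
    mink (toHyp p) (toHyp q) < -1 := by
  have h1 := cosh_dist_eq_neg_mink p q
  have h2 := Real.one_lt_cosh.mpr (dist_ne_zero.mpr h)
  linarith

lemma hypSide_self (p z : UpperHalfPlane) : hypSide p p z = 0 := by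
  simp [hypSide, diskCoord]

lemma IsSymmetricHexagon.ne_succ {v : Fin 6 → UpperHalfPlane} (hv : IsSymmetricHexagon v)
    (i : Fin 6) : v i ≠ v (i + 1) := by
  intro h
  have := hv.convex i (i + 2) (by fin_cases i <;> decide) (by fin_cases i <;> decide)
  rw [← h, hypSide_self] at this
  exact this.false

lemma IsSymmetricHexagon.halfLong_pos {v : Fin 6 → UpperHalfPlane} (hv : IsSymmetricHexagon v) :
    0 < halfLong v := by
  have := dist_pos.mpr (hv.ne_succ 0)
  simp only [halfLong]
  simp only [zero_add] at this
  linarith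

/-- The normals of the short edges. -/
def shortNormal (v : Fin 6 → UpperHalfPlane) (i : Fin 3) : Fin 3 → ℝ :=
  (Real.sinh (2 * halfLong v))⁻¹ •
    (toHyp (v (shortIdx i + 2)) - Real.cosh (2 * halfLong v) • toHyp (v (shortIdx i + 1)))

/-- The normal of a short edge is the tangent of either adjacent long edge at the common vertex.
Equating the two expressions around the hexagon (`e0`, `e1`, `e2`) writes two consecutive normals in
terms of the endpoints of the long edge between them; this gives their product and can be solved for
those endpoints. -/
lemma IsSymmetricHexagon.isHexFrame {v : Fin 6 → UpperHalfPlane} (hv : IsSymmetricHexagon v) :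
    IsHexFrame (halfLong v) (shortNormal v) v := by
  have hpos := hv.halfLong_pos
  set L := halfLong v with hL
  set c := Real.cosh (2 * L) with hc
  set s := Real.sinh (2 * L) with hs
  have hspos : 0 < s := Real.sinh_pos_iff.mpr (by linarith)
  have hcs : c ^ 2 = s ^ 2 + 1 := Real.cosh_sq _
  have hd : dist (v 0) (v 1) = 2 * L := by rw [hL, halfLong]; ring
  have hself : ∀ j, mink (toHyp (v j)) (toHyp (v j)) = -1 := fun j => mink_toHyp_self _
  have h01 : mink (toHyp (v 0)) (toHyp (v 1)) = -c := by
    rw [hc, ← hd, cosh_dist_eq_neg_mink, neg_neg]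
  have h23 : mink (toHyp (v 2)) (toHyp (v 3)) = -c := by
    rw [hc, ← hd, ← hv.long_eq₁, cosh_dist_eq_neg_mink, neg_neg]
  have h45 : mink (toHyp (v 4)) (toHyp (v 5)) = -c := by
    rw [hc, ← hd, ← hv.long_eq₂, cosh_dist_eq_neg_mink, neg_neg]
  have hang : ∀ i, mink (toHyp (v (i - 1))) (toHyp (v (i + 1))) =
      -(mink (toHyp (v i)) (toHyp (v (i - 1))) * mink (toHyp (v i)) (toHyp (v (i + 1)))) := by
    intro i
    have := (hypAngle_eq_iff _ _ _).mp (hv.right_angle i)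
    simp only [cosh_dist_eq_neg_mink] at this
    linarith
  have hdet : ∀ i j : Fin 6, j ≠ i → j ≠ i + 1 →
      0 < det3 (toHyp (v i)) (toHyp (v (i + 1))) (toHyp (v j)) := fun i j h1 h2 =>
    (det3_toHyp_pos_iff _ _ _).mp (hv.convex i j h1 h2)
  have hlt : ∀ i, mink (toHyp (v i)) (toHyp (v (i + 1))) < -1 := fun i =>
    mink_toHyp_lt_neg_one (hv.ne_succ i)
  have e0 : toHyp (v 3) - c • toHyp (v 2) = toHyp (v 0) - c • toHyp (v 1) := by
    have a1 := hang 1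
    have a2 := hang 2
    simp only [show (1 : Fin 6) - 1 = 0 from rfl, show (1 : Fin 6) + 1 = 2 from rfl,
      show (2 : Fin 6) - 1 = 1 from rfl, show (2 : Fin 6) + 1 = 3 from rfl] at a1 a2
    refine normal_eq_normal (p := toHyp (v 1)) hspos hcs (hself 1) (hself 2) (hself 3) (hself 0)
      h23 (by rw [mink_comm, h01]) ?_ ?_ (hlt 1) (hdet 1 3 (by decide) (by decide))
      (hdet 1 0 (by decide) (by decide))
    · rw [a2, h23, mink_comm (toHyp (v 2))]; ring
    · rw [mink_comm, a1, mink_comm (toHyp (v 1)) (toHyp (v 0)), h01]; ring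
  have e1 : toHyp (v 5) - c • toHyp (v 4) = toHyp (v 2) - c • toHyp (v 3) := by
    have a1 := hang 3
    have a2 := hang 4
    simp only [show (3 : Fin 6) - 1 = 2 from rfl, show (3 : Fin 6) + 1 = 4 from rfl,
      show (4 : Fin 6) - 1 = 3 from rfl, show (4 : Fin 6) + 1 = 5 from rfl] at a1 a2
    refine normal_eq_normal (p := toHyp (v 3)) hspos hcs (hself 3) (hself 4) (hself 5) (hself 2)
      h45 (by rw [mink_comm, h23]) ?_ ?_ (hlt 3) (hdet 3 5 (by decide) (by decide))
      (hdet 3 2 (by decide) (by decide))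
    · rw [a2, h45, mink_comm (toHyp (v 4))]; ring
    · rw [mink_comm, a1, mink_comm (toHyp (v 3)) (toHyp (v 2)), h23]; ring
  have e2 : toHyp (v 1) - c • toHyp (v 0) = toHyp (v 4) - c • toHyp (v 5) := by
    have a1 := hang 5
    have a2 := hang 0
    simp only [show (5 : Fin 6) - 1 = 4 from rfl, show (5 : Fin 6) + 1 = 0 from rfl,
      show (0 : Fin 6) - 1 = 5 from rfl, show (0 : Fin 6) + 1 = 1 from rfl] at a1 a2
    refine normal_eq_normal (p := toHyp (v 5)) hspos hcs (hself 5) (hself 0) (hself 1) (hself 4)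
      h01 (by rw [mink_comm, h45]) ?_ ?_ (hlt 5) (hdet 5 1 (by decide) (by decide))
      (hdet 5 4 (by decide) (by decide))
    · rw [a2, h01, mink_comm (toHyp (v 0))]; ring
    · rw [mink_comm, a1, mink_comm (toHyp (v 5)) (toHyp (v 4)), h45]; ring
  have n0 : shortNormal v 0 = s⁻¹ • (toHyp (v 3) - c • toHyp (v 2)) := rfl
  have n1 : shortNormal v 1 = s⁻¹ • (toHyp (v 5) - c • toHyp (v 4)) := rfl
  have n2 : shortNormal v 2 = s⁻¹ • (toHyp (v 1) - c • toHyp (v 0)) := rfl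
  have h32 := mink_comm (toHyp (v 3)) (toHyp (v 2))
  have h54 := mink_comm (toHyp (v 5)) (toHyp (v 4))
  have h10 := mink_comm (toHyp (v 1)) (toHyp (v 0))
  -- Inverts the passage from the endpoints of a long edge to the normals at its ends: `(p - c q) +
  -- c (q - c p) = -s² p`.
  have solve : ∀ p q : Fin 3 → ℝ,
      (-(1 / s)) • (s⁻¹ • (p - c • q) + c • (s⁻¹ • (q - c • p))) = p := by
    intro p q
    ext i
    simp only [Pi.smul_apply, Pi.add_apply, Pi.sub_apply, smul_eq_mul]
    field_simp
    linear_combination p i * hcs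
  refine ⟨hpos, ?_, ?_, ?_, ?_⟩
  · intro i
    fin_cases i
    · change mink (shortNormal v 0) (shortNormal v 0) = 1
      simp only [n0, mink_smul_left, mink_smul_right, mink_sub_left, mink_sub_right, hself, h32,
        h23]
      field_simp
      linarith
    · change mink (shortNormal v 1) (shortNormal v 1) = 1
      simp only [n1, mink_smul_left, mink_smul_right, mink_sub_left, mink_sub_right, hself, h54,
        h45]
      field_simp
      linarith
    · change mink (shortNormal v 2) (shortNormal v 2) = 1
      simp only [n2, mink_smul_left, mink_smul_right, mink_sub_left, mink_sub_right, hself, h10,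
        h01]
      field_simp
      linarith
  · intro i
    fin_cases i
    · change mink (shortNormal v 0) (shortNormal v 1) = -c
      rw [n0, n1, e1]
      simp only [mink_smul_left, mink_smul_right, mink_sub_left, mink_sub_right, hself, h32,
        h23]
      field_simp
      linear_combination (-c) * hcs
    · change mink (shortNormal v 1) (shortNormal v 2) = -c
      rw [n1, n2, e2]
      simp only [mink_smul_left, mink_smul_right, mink_sub_left, mink_sub_right, hself, h54,
        h45]
      field_simp
      linear_combination (-c) * hcs
    · change mink (shortNormal v 2) (shortNormal v 0) = -c
      rw [n2, n0, e0]
      simp only [mink_smul_left, mink_smul_right, mink_sub_left, mink_sub_right, hself, h10,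
        h01]
      field_simp
      linear_combination (-c) * hcs
  · intro i
    fin_cases i
    · change toHyp (v 1) = (-(1 / s)) • (shortNormal v 2 + c • shortNormal v 0)
      rw [n0, n2, e0, solve]
    · change toHyp (v 3) = (-(1 / s)) • (shortNormal v 0 + c • shortNormal v 1)
      rw [n0, n1, e1, solve]
    · change toHyp (v 5) = (-(1 / s)) • (shortNormal v 1 + c • shortNormal v 2)
      rw [n1, n2, e2, solve]
  · intro i
    fin_cases i
    · change toHyp (v 2) = (-(1 / s)) • (shortNormal v 1 + c • shortNormal v 0)
      rw [n0, n1, e1, solve]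
    · change toHyp (v 4) = (-(1 / s)) • (shortNormal v 2 + c • shortNormal v 1)
      rw [n1, n2, e2, solve]
    · change toHyp (v 0) = (-(1 / s)) • (shortNormal v 0 + c • shortNormal v 2)
      rw [n0, n2, e0, solve]

/-! ### Fermi coordinates -/

/-- `(a i, d i)` are, for each `i`, Fermi coordinates with respect to the `i`-th short edge of the
hexagon `v`: `d i` is the signed distance to the line of that edge, and `a i` is the signed
distance from the foot of the perpendicular to the midpoint of that edge. -/
structure IsHexChart (L : ℝ) (v : Fin 6 → UpperHalfPlane)
    (a d : Fin 3 → UpperHalfPlane → ℝ) : Prop where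
  pos : 0 < L
  cosh_dist : ∀ i z w, Real.cosh (dist z w) =
    Real.cosh (d i z) * Real.cosh (d i w) * Real.cosh (a i z - a i w) -
      Real.sinh (d i z) * Real.sinh (d i w)
  surj : ∀ i α δ, ∃ z, a i z = α ∧ d i z = δ
  sinh_next : ∀ i z, Real.sinh (d (i + 1) z) =
    Real.sinh (2 * L) * Real.cosh (d i z) * Real.cosh (halfShort L - a i z) -
      Real.cosh (2 * L) * Real.sinh (d i z)
  sinh_prev : ∀ i z, Real.sinh (d (i + 2) z) =
    Real.sinh (2 * L) * Real.cosh (d i z) * Real.cosh (halfShort L + a i z) -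
      Real.cosh (2 * L) * Real.sinh (d i z)
  side : ∀ i z, Real.cosh (d (i + 1) z) * Real.sinh (halfShort L + a (i + 1) z) =
    Real.cosh (d i z) * Real.sinh (halfShort L - a i z)
  first : ∀ i, a i (v (shortIdx i)) = -halfShort L ∧ d i (v (shortIdx i)) = 0
  second : ∀ i, a i (v (shortIdx i + 1)) = halfShort L ∧ d i (v (shortIdx i + 1)) = 0
  long_first : ∀ i, a i (v (longIdx i)) = -halfShort L ∧ d i (v (longIdx i)) = 2 * L

section Frame

variable {L : ℝ} {N : Fin 3 → Fin 3 → ℝ} {v : Fin 6 → UpperHalfPlane}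

lemma IsHexFrame.next_next (h : IsHexFrame L N v) (i : Fin 3) :
    mink (N i) (N (i + 2)) = -Real.cosh (2 * L) := by
  have := h.next (i + 2)
  rw [mink_comm, show i + 2 + 1 = i by fin_cases i <;> rfl] at this
  exact this

lemma IsHexFrame.next_prev (h : IsHexFrame L N v) (i : Fin 3) :
    mink (N (i + 1)) (N (i + 2)) = -Real.cosh (2 * L) := by
  have := h.next (i + 1)
  rwa [show i + 1 + 1 = i + 2 by fin_cases i <;> rfl] at this

/-- The signed distance to the `i`-th short edge. -/
def fermiDist (N : Fin 3 → Fin 3 → ℝ) (i : Fin 3) (z : UpperHalfPlane) : ℝ :=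
  Real.arsinh (mink (N i) (toHyp z))

/-- The position of the foot of the perpendicular to the `i`-th short edge. -/
def fermiFoot (L : ℝ) (N : Fin 3 → Fin 3 → ℝ) (i : Fin 3) (z : UpperHalfPlane) : ℝ :=
  Real.arsinh (mink ((2 * Real.cosh L)⁻¹ • (N (i + 2) - N (i + 1))) (toHyp z) /
    Real.cosh (fermiDist N i z))

/-- The midpoint of the `i`-th short edge. -/
def midVector (L : ℝ) (N : Fin 3 → Fin 3 → ℝ) (i : Fin 3) : Fin 3 → ℝ :=
  (-(Real.sinh (2 * L) * Real.cosh (halfShort L))⁻¹) •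
    ((1 / 2 : ℝ) • (N (i + 1) + N (i + 2)) + Real.cosh (2 * L) • N i)

/-- The unit tangent vector of the `i`-th short edge at its midpoint. -/
def tangentVector (L : ℝ) (N : Fin 3 → Fin 3 → ℝ) (i : Fin 3) : Fin 3 → ℝ :=
  (2 * Real.cosh L)⁻¹ • (N (i + 2) - N (i + 1))

/-- The timelike norm is where `sinh L * sinh l = 1/2` enters; the remaining relations follow from
the products of the normals alone. -/
lemma IsHexFrame.frame (h : IsHexFrame L N v) (i : Fin 3) :
    mink (midVector L N i) (midVector L N i) = -1 ∧
    mink (tangentVector L N i) (tangentVector L N i) = 1 ∧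
    mink (midVector L N i) (tangentVector L N i) = 0 ∧
    mink (midVector L N i) (N i) = 0 ∧
    mink (tangentVector L N i) (N i) = 0 := by
  have hS := Real.sinh_pos_iff.mpr h.pos
  have hC := Real.cosh_pos L
  have hC2 := Real.cosh_sq L
  have hl := Real.cosh_sq (halfShort L)
  have hlp := Real.cosh_pos (halfShort L)
  rw [sinh_halfShort] at hl
  have hl' : 4 * Real.sinh L ^ 2 * Real.cosh (halfShort L) ^ 2 = 1 + 4 * Real.sinh L ^ 2 := by
    rw [hl]; field_simp; ring
  have h01 := h.next i
  have h02 := h.next_next i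
  have h12 := h.next_prev i
  have h10 := mink_comm (N (i + 1)) (N i)
  have h20 := mink_comm (N (i + 2)) (N i)
  have h21 := mink_comm (N (i + 2)) (N (i + 1))
  have hs := h.self
  refine ⟨?_, ?_, ?_, ?_, ?_⟩ <;>
  simp only [midVector, tangentVector, mink_smul_left, mink_smul_right, mink_add_left,
    mink_add_right, mink_sub_left, mink_sub_right, h10, h20, h21, h01, h02, h12, hs,
    Real.sinh_two_mul, Real.cosh_two_mul]
  · field_simp
    simp only [hC2]
    linear_combination (4 * (Real.sinh L ^ 2 + 1)) * hl'
  · field_simp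
    simp only [hC2]
    ring
  · ring
  · ring
  · ring

lemma IsHexFrame.midVector_eq (h : IsHexFrame L N v) (i : Fin 3) :
    midVector L N i = (2 * Real.cosh (halfShort L))⁻¹ •
      (toHyp (v (shortIdx i)) + toHyp (v (shortIdx i + 1))) := by
  have hS := Real.sinh_pos_iff.mpr (mul_pos two_pos h.pos)
  have hlp := Real.cosh_pos (halfShort L)
  rw [h.first, h.second, midVector]
  ext j
  simp only [Pi.smul_apply, Pi.add_apply, smul_eq_mul]
  field_simp
  ring

lemma mink_toHyp_neg (z w : UpperHalfPlane) : mink (toHyp z) (toHyp w) < 0 :=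
  mink_neg_of_timelike (mink_toHyp_self z) (toHyp_zero_pos z) (mink_toHyp_self w)
    (toHyp_zero_pos w)

lemma IsHexFrame.mink_midVector_neg (h : IsHexFrame L N v) (i : Fin 3) (z : UpperHalfPlane) :
    mink (midVector L N i) (toHyp z) < 0 := by
  rw [h.midVector_eq, mink_smul_left, mink_add_left]
  have h1 := mink_toHyp_neg (v (shortIdx i)) z
  have h2 := mink_toHyp_neg (v (shortIdx i + 1)) z
  have h3 := Real.cosh_pos (halfShort L)
  exact mul_neg_of_pos_of_neg (by positivity) (by linarith)

lemma mink_normal (N : Fin 3 → Fin 3 → ℝ) (i : Fin 3) (z : UpperHalfPlane) :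
    mink (N i) (toHyp z) = Real.sinh (fermiDist N i z) := (Real.sinh_arsinh _).symm

lemma mink_tangent (L : ℝ) (N : Fin 3 → Fin 3 → ℝ) (i : Fin 3) (z : UpperHalfPlane) :
    mink (tangentVector L N i) (toHyp z) =
      Real.cosh (fermiDist N i z) * Real.sinh (fermiFoot L N i z) := by
  rw [fermiFoot, Real.sinh_arsinh, tangentVector]
  have := Real.cosh_pos (fermiDist N i z)
  field_simp

lemma IsHexFrame.mink_eq (h : IsHexFrame L N v) (i : Fin 3) (x y : Fin 3 → ℝ) :
    mink x y = -(mink (midVector L N i) x * mink (midVector L N i) y) +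
      mink (tangentVector L N i) x * mink (tangentVector L N i) y +
      mink (N i) x * mink (N i) y := by
  obtain ⟨h1, h2, h3, h4, h5⟩ := h.frame i
  exact mink_eq_of_frame h1 h2 (h.self i) h3 h4 h5 x y

/-- The other two frame coordinates determine the square of this one; the sign is that of two future
timelike vectors. -/
lemma IsHexFrame.mink_mid (h : IsHexFrame L N v) (i : Fin 3) (z : UpperHalfPlane) :
    mink (midVector L N i) (toHyp z) =
      -(Real.cosh (fermiDist N i z) * Real.cosh (fermiFoot L N i z)) := by
  have h1 := h.mink_eq i (toHyp z) (toHyp z)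
  rw [mink_toHyp_self, mink_tangent, mink_normal N i] at h1
  have h2 := h.mink_midVector_neg i z
  have h3 : 0 < Real.cosh (fermiDist N i z) * Real.cosh (fermiFoot L N i z) := by positivity
  have h4 : mink (midVector L N i) (toHyp z) ^ 2 =
      (Real.cosh (fermiDist N i z) * Real.cosh (fermiFoot L N i z)) ^ 2 := by
    rw [mul_pow, Real.cosh_sq (fermiFoot L N i z)]
    linear_combination h1 - Real.cosh_sq (fermiDist N i z)
  rcases sq_eq_sq_iff_eq_or_eq_neg.mp h4 with h5 | h5
  · linarith
  · exact h5

lemma fermi_coords_eq (i : Fin 3) {z : UpperHalfPlane} {α δ : ℝ}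
    (h1 : mink (N i) (toHyp z) = Real.sinh δ)
    (h2 : mink (tangentVector L N i) (toHyp z) = Real.cosh δ * Real.sinh α) :
    fermiFoot L N i z = α ∧ fermiDist N i z = δ := by
  have hd : fermiDist N i z = δ := by rw [fermiDist, h1, Real.arsinh_sinh]
  refine ⟨?_, hd⟩
  rw [mink_tangent, hd] at h2
  exact Real.sinh_injective (mul_left_cancel₀ (Real.cosh_pos δ).ne' h2)

/-- Every quantity is linear in the three products `mink (N j) (toHyp z)`. The sum and the
difference of the two neighbouring ones give the `cosh a` and `sinh a` components in the chart of
edge `i`, and so the passage between charts. In `side`, both members are the `sinh` of the signed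
distance to the long edge joining the short edges `i` and `i + 1`. -/
theorem IsHexFrame.isHexChart (h : IsHexFrame L N v) :
    IsHexChart L v (fermiFoot L N) (fermiDist N) := by
  have hS := Real.sinh_pos_iff.mpr h.pos
  have hS2 := Real.sinh_pos_iff.mpr (mul_pos two_pos h.pos)
  have hC := Real.cosh_pos L
  have hC2 := Real.cosh_sq L
  have hl := Real.cosh_sq (halfShort L)
  have hlp := Real.cosh_pos (halfShort L)
  have hsl := sinh_halfShort L
  have hsum : ∀ i z, mink (N (i + 1)) (toHyp z) + mink (N (i + 2)) (toHyp z) =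
      2 * (Real.sinh (2 * L) * Real.cosh (halfShort L) *
        (Real.cosh (fermiDist N i z) * Real.cosh (fermiFoot L N i z)) -
        Real.cosh (2 * L) * Real.sinh (fermiDist N i z)) := by
    intro i z
    have h1 := h.mink_mid i z
    rw [midVector, mink_smul_left, mink_add_left, mink_smul_left, mink_smul_left, mink_add_left,
      mink_normal N i z] at h1
    field_simp at h1
    linarith
  have hdiff : ∀ i z, mink (N (i + 2)) (toHyp z) - mink (N (i + 1)) (toHyp z) =
      2 * Real.cosh L * (Real.cosh (fermiDist N i z) * Real.sinh (fermiFoot L N i z)) := by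
    intro i z
    have h1 := mink_tangent L N i z
    rw [tangentVector, mink_smul_left, mink_sub_left] at h1
    field_simp at h1
    linarith
  have hn : ∀ i z, Real.sinh (fermiDist N (i + 1) z) =
    Real.sinh (2 * L) * Real.cosh (fermiDist N i z) *
      Real.cosh (halfShort L - fermiFoot L N i z) -
      Real.cosh (2 * L) * Real.sinh (fermiDist N i z) := by
    intro i z
    have h1 := hsum i z
    have h2 := hdiff i z
    rw [← mink_normal, Real.cosh_sub, hsl]
    have h3 : Real.sinh (2 * L) * (1 / (2 * Real.sinh L)) = Real.cosh L := by
      rw [Real.sinh_two_mul]; field_simp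
    linear_combination (1 / 2) * h1 - (1 / 2) * h2 +
      Real.cosh (fermiDist N i z) * Real.sinh (fermiFoot L N i z) * h3
  have hp : ∀ i z, Real.sinh (fermiDist N (i + 2) z) =
    Real.sinh (2 * L) * Real.cosh (fermiDist N i z) *
      Real.cosh (halfShort L + fermiFoot L N i z) -
      Real.cosh (2 * L) * Real.sinh (fermiDist N i z) := by
    intro i z
    have h1 := hsum i z
    have h2 := hdiff i z
    rw [← mink_normal, Real.cosh_add, hsl]
    have h3 : Real.sinh (2 * L) * (1 / (2 * Real.sinh L)) = Real.cosh L := by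
      rw [Real.sinh_two_mul]; field_simp
    linear_combination (1 / 2) * h1 + (1 / 2) * h2 -
      Real.cosh (fermiDist N i z) * Real.sinh (fermiFoot L N i z) * h3
  refine ⟨h.pos, ?_, ?_, hn, hp, ?_, ?_, ?_, ?_⟩
  · intro i z w
    rw [cosh_dist_eq_neg_mink, h.mink_eq i, h.mink_mid, h.mink_mid, mink_tangent, mink_tangent,
      mink_normal, mink_normal, Real.cosh_sub]
    ring
  · intro i α δ
    obtain ⟨h1, h2, h3, h4, h5⟩ := h.frame i
    have h3' := (mink_comm (tangentVector L N i) (midVector L N i)).trans h3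
    have h4' := (mink_comm (N i) (midVector L N i)).trans h4
    have h5' := (mink_comm (N i) (tangentVector L N i)).trans h5
    have h6 := h.self i
    let x : Fin 3 → ℝ := (Real.cosh δ * Real.cosh α) • midVector L N i +
      (Real.cosh δ * Real.sinh α) • tangentVector L N i + Real.sinh δ • N i
    have hx : mink x x = -1 := by
      simp only [x, mink_add_left, mink_add_right, mink_smul_left, mink_smul_right, h1, h2, h3,
        h4, h5, h6, h3', h4', h5']
      have e1 := Real.cosh_sq δ
      have e2 := Real.cosh_sq α
      linear_combination (-Real.cosh δ ^ 2) * e2 - e1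
    have hx0 : 0 < x 0 := by
      obtain ⟨m, hm⟩ : ∃ m, toHyp m = midVector L N i := by
        apply exists_toHyp_eq h1
        have e1 := toHyp_zero_pos (v (shortIdx i))
        have e2 := toHyp_zero_pos (v (shortIdx i + 1))
        rw [h.midVector_eq]
        simp only [Pi.smul_apply, Pi.add_apply, smul_eq_mul]
        positivity
      apply zero_pos_of_mink_neg hx (z := m)
      rw [hm]
      simp only [x, mink_add_left, mink_smul_left, h1, h3', h4']
      have : 0 < Real.cosh δ * Real.cosh α := by positivity
      linarith
    obtain ⟨z, hz⟩ := exists_toHyp_eq hx hx0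
    refine ⟨z, fermi_coords_eq i ?_ ?_⟩
    · rw [hz]
      simp only [x, mink_add_right, mink_smul_right, h4', h5', h6]
      ring
    · rw [hz]
      simp only [x, mink_add_right, mink_smul_right, h3', h2, h5]
      ring
  · intro i z
    have e1 := hsum i z
    have e2 := hdiff i z
    have e3 := hsum (i + 1) z
    have e4 := hdiff (i + 1) z
    rw [show i + 1 + 1 = i + 2 by fin_cases i <;> rfl,
      show i + 1 + 2 = i by fin_cases i <;> rfl] at e3 e4
    rw [Real.sinh_add, Real.sinh_sub, hsl]
    rw [← mink_normal] at e1 e3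
    generalize mink (N i) (toHyp z) = y0 at *
    generalize mink (N (i + 1)) (toHyp z) = y1 at *
    generalize mink (N (i + 2)) (toHyp z) = y2 at *
    have hl' : 4 * Real.sinh L ^ 2 * Real.cosh (halfShort L) ^ 2 = 1 + 4 * Real.sinh L ^ 2 := by
      rw [hl, hsl]; field_simp; ring
    rw [Real.sinh_two_mul, Real.cosh_two_mul] at e1 e3
    -- With all four products expressed through `y0`, `y1`, `y2`, the identity becomes linear in
    -- them.
    have f1 : Real.cosh (fermiDist N i z) * Real.cosh (fermiFoot L N i z) =
        ((y1 + y2) / 2 + (Real.cosh L ^ 2 + Real.sinh L ^ 2) * y0) /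
          (2 * Real.sinh L * Real.cosh L * Real.cosh (halfShort L)) := by
      field_simp; linarith
    have f2 : Real.cosh (fermiDist N i z) * Real.sinh (fermiFoot L N i z) =
        (y2 - y1) / (2 * Real.cosh L) := by
      field_simp; linarith
    have f3 : Real.cosh (fermiDist N (i + 1) z) * Real.cosh (fermiFoot L N (i + 1) z) =
        ((y2 + y0) / 2 + (Real.cosh L ^ 2 + Real.sinh L ^ 2) * y1) /
          (2 * Real.sinh L * Real.cosh L * Real.cosh (halfShort L)) := by
      field_simp; linarith
    have f4 : Real.cosh (fermiDist N (i + 1) z) * Real.sinh (fermiFoot L N (i + 1) z) =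
        (y0 - y2) / (2 * Real.cosh L) := by
      field_simp; linarith
    have g : 1 / (2 * Real.sinh L) *
        (((y2 + y0) / 2 + (Real.cosh L ^ 2 + Real.sinh L ^ 2) * y1) /
          (2 * Real.sinh L * Real.cosh L * Real.cosh (halfShort L))) +
        Real.cosh (halfShort L) * ((y0 - y2) / (2 * Real.cosh L)) =
        1 / (2 * Real.sinh L) * (((y1 + y2) / 2 + (Real.cosh L ^ 2 + Real.sinh L ^ 2) * y0) /
          (2 * Real.sinh L * Real.cosh L * Real.cosh (halfShort L))) -
        Real.cosh (halfShort L) * ((y2 - y1) / (2 * Real.cosh L)) := by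
      field_simp
      rw [hC2]
      linear_combination (y0 - y1) * hl'
    linear_combination g + (1 / (2 * Real.sinh L)) * f3 + Real.cosh (halfShort L) * f4 -
      (1 / (2 * Real.sinh L)) * f1 + Real.cosh (halfShort L) * f2
  all_goals intro i
  · have h01 := h.next i
    have h02 := h.next_next i
    have h12 := h.next_prev i
    have h10 := mink_comm (N (i + 1)) (N i)
    have h20 := mink_comm (N (i + 2)) (N i)
    have h21 := mink_comm (N (i + 2)) (N (i + 1))
    have hs := h.self
    apply fermi_coords_eq i <;> rw [h.first i]
    · simp only [mink_smul_right, mink_add_right, h02, hs, Real.sinh_zero]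
      ring
    · simp only [tangentVector, mink_smul_left, mink_sub_left, mink_smul_right, mink_add_right,
        h10, h20, h12, h01, h02, hs, Real.cosh_zero, Real.sinh_neg, hsl]
      rw [Real.sinh_two_mul, Real.cosh_two_mul]
      field_simp
      linear_combination hC2
  · have h01 := h.next i
    have h02 := h.next_next i
    have h12 := h.next_prev i
    have h10 := mink_comm (N (i + 1)) (N i)
    have h20 := mink_comm (N (i + 2)) (N i)
    have h21 := mink_comm (N (i + 2)) (N (i + 1))
    have hs := h.self
    apply fermi_coords_eq i <;> rw [h.second i]
    · simp only [mink_smul_right, mink_add_right, h01, hs, Real.sinh_zero]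
      ring
    · simp only [tangentVector, mink_smul_left, mink_sub_left, mink_smul_right, mink_add_right,
        h10, h20, h21, h12, h01, h02, hs, Real.cosh_zero, hsl]
      rw [Real.sinh_two_mul, Real.cosh_two_mul]
      field_simp
      linear_combination (-1 : ℝ) * hC2
  · have h01 := h.next i
    have h02 := h.next_next i
    have h12 := h.next_prev i
    have h10 := mink_comm (N (i + 1)) (N i)
    have h20 := mink_comm (N (i + 2)) (N i)
    have h21 := mink_comm (N (i + 2)) (N (i + 1))
    have hs := h.self
    have hlong : toHyp (v (longIdx i)) =
        (-(1 / Real.sinh (2 * L))) • (N i + Real.cosh (2 * L) • N (i + 2)) := by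
      have e := h.second (i + 2)
      rw [show i + 2 + 1 = i by fin_cases i <;> rfl,
        show shortIdx (i + 2) + 1 = longIdx i by fin_cases i <;> rfl] at e
      exact e
    have hc2 := Real.cosh_sq (2 * L)
    apply fermi_coords_eq i <;> rw [hlong]
    · simp only [mink_smul_right, mink_add_right, h02, hs]
      field_simp
      linarith
    · simp only [tangentVector, mink_smul_left, mink_sub_left, mink_smul_right, mink_add_right,
        h10, h20, h12, h01, h02, hs, Real.sinh_neg, hsl]
      rw [Real.sinh_two_mul, Real.cosh_two_mul]
      field_simp
      linear_combination hC2

end Frame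

/-! ### The region of a hexagon in Fermi coordinates -/

lemma nonneg_hypSide_iff {p q r : UpperHalfPlane} {n : Fin 3 → ℝ} (hp : mink n (toHyp p) = 0)
    (hq : mink n (toHyp q) = 0) (hr : 0 < mink n (toHyp r)) (hs : 0 < hypSide p q r)
    (z : UpperHalfPlane) : 0 ≤ hypSide p q z ↔ 0 ≤ mink n (toHyp z) := by
  rw [det3_toHyp_nonneg_iff]
  have h := det3_mul_mink hp hq (toHyp z) (toHyp r)
  have hd := (det3_toHyp_pos_iff p q r).mp hs
  constructor
  · intro hz
    have : 0 ≤ det3 (toHyp p) (toHyp q) (toHyp r) * mink n (toHyp z) := by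
      rw [← h]; positivity
    exact (mul_nonneg_iff_of_pos_left hd).mp this
  · intro hz
    have : 0 ≤ det3 (toHyp p) (toHyp q) (toHyp z) * mink n (toHyp r) := by
      rw [h]; positivity
    exact (mul_nonneg_iff_of_pos_right hr).mp this

lemma forall_fin_six_iff (P : Fin 6 → Prop) :
    (∀ j, P j) ↔ ∀ i : Fin 3, P (shortIdx i) ∧ P (longIdx i) := by
  constructor
  · intro h i
    exact ⟨h _, h _⟩
  · intro h j
    fin_cases j
    · exact (h 0).2
    · exact (h 0).1
    · exact (h 1).2
    · exact (h 1).1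
    · exact (h 2).2
    · exact (h 2).1

lemma mul_sinh_nonneg_iff {c x : ℝ} (hc : 0 < c) : 0 ≤ c * Real.sinh x ↔ 0 ≤ x := by
  rw [mul_nonneg_iff_of_pos_left hc, Real.sinh_nonneg_iff]

lemma longIdx_add_one (i : Fin 3) : longIdx i + 1 = shortIdx i := by fin_cases i <;> rfl

/-- Each of the six sides is a sign condition on one Fermi coordinate. The long edges only give `-l
≤ a i`; the upper bounds come from the same conditions read in the neighbouring chart. -/
theorem IsHexFrame.mem_hexRegion_iff {L : ℝ} {N : Fin 3 → Fin 3 → ℝ}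
    {v : Fin 6 → UpperHalfPlane} (h : IsHexFrame L N v) (hv : IsSymmetricHexagon v)
    (z : UpperHalfPlane) : z ∈ hexRegion v ↔
      ∀ i, 0 ≤ fermiDist N i z ∧ |fermiFoot L N i z| ≤ halfShort L := by
  have hc := h.isHexChart
  have hl := halfShort_pos h.pos
  have hshort : ∀ i, 0 ≤ hypSide (v (shortIdx i)) (v (shortIdx i + 1)) z ↔
      0 ≤ fermiDist N i z := by
    intro i
    rw [nonneg_hypSide_iff (n := N i) (r := v (longIdx i)), mink_normal, Real.sinh_nonneg_iff]
    · rw [mink_normal, (hc.first i).2, Real.sinh_zero]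
    · rw [mink_normal, (hc.second i).2, Real.sinh_zero]
    · rw [mink_normal, (hc.long_first i).2, Real.sinh_pos_iff]
      linarith [h.pos]
    · apply hv.convex <;> fin_cases i <;> decide
  have hlong : ∀ i, 0 ≤ hypSide (v (longIdx i)) (v (longIdx i + 1)) z ↔
      0 ≤ halfShort L + fermiFoot L N i z := by
    intro i
    -- This vector is the inward unit normal of the line `a = -l` carrying the long edge.
    have key : ∀ w, mink (Real.cosh (halfShort L) • tangentVector L N i -
        Real.sinh (halfShort L) • midVector L N i) (toHyp w) =
        Real.cosh (fermiDist N i w) * Real.sinh (halfShort L + fermiFoot L N i w) := by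
      intro w
      rw [mink_sub_left, mink_smul_left, mink_smul_left, mink_tangent, h.mink_mid,
        Real.sinh_add]
      ring
    rw [longIdx_add_one, nonneg_hypSide_iff (r := v (shortIdx i + 1))
      (n := Real.cosh (halfShort L) • tangentVector L N i -
        Real.sinh (halfShort L) • midVector L N i), key, mul_sinh_nonneg_iff (Real.cosh_pos _)]
    · rw [key, (hc.long_first i).1, add_neg_cancel, Real.sinh_zero, mul_zero]
    · rw [key, (hc.first i).1, add_neg_cancel, Real.sinh_zero, mul_zero]
    · rw [key, (hc.second i).1]
      have := Real.sinh_pos_iff.mpr (add_pos hl hl)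
      have := Real.cosh_pos (fermiDist N i (v (shortIdx i + 1)))
      positivity
    · rw [← longIdx_add_one]
      apply hv.convex <;> fin_cases i <;> decide
  rw [hexRegion, Set.mem_ofPred_eq, forall_fin_six_iff]
  simp only [hshort, hlong]
  constructor
  · intro H i
    refine ⟨(H i).1, abs_le.mpr ⟨by linarith [(H i).2], ?_⟩⟩
    have h1 := (mul_sinh_nonneg_iff (Real.cosh_pos (fermiDist N (i + 1) z))).mpr (H (i + 1)).2
    rw [hc.side, mul_sinh_nonneg_iff (Real.cosh_pos _)] at h1
    linarith
  · intro H i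
    exact ⟨(H i).1, by linarith [(abs_le.mp (H i).2).1]⟩

/-- Points of the geodesic are nonnegative combinations of its endpoints, and the side conditions
are linear, so the hexagon is convex. -/
lemma hexRegion_geodesic {v : Fin 6 → UpperHalfPlane} {z w : UpperHalfPlane}
    (hz : z ∈ hexRegion v) (hw : w ∈ hexRegion v) :
    ∃ γ : ℝ → UpperHalfPlane, γ 0 = z ∧ γ (dist z w) = w ∧
      ∀ s ∈ Set.Icc 0 (dist z w), γ s ∈ hexRegion v ∧
        ∀ t ∈ Set.Icc 0 (dist z w), dist (γ s) (γ t) = |s - t| := by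
  obtain ⟨γ, h0, h1, h⟩ := exists_geodesic z w
  refine ⟨γ, h0, h1, fun s hs => ⟨?_, (h s hs).2⟩⟩
  obtain ⟨α, β, hα, hβ, hγ⟩ := (h s hs).1
  intro i
  rw [det3_toHyp_nonneg_iff, hγ]
  have h2 := (det3_toHyp_nonneg_iff _ _ _).mp (hz i)
  have h3 := (det3_toHyp_nonneg_iff _ _ _).mp (hw i)
  have h4 : ∀ p q x y : Fin 3 → ℝ, det3 p q (α • x + β • y) =
      α * det3 p q x + β * det3 p q y := by
    intro p q x y
    simp only [det3, Pi.add_apply, Pi.smul_apply, smul_eq_mul]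
    ring
  rw [h4]
  positivity

/-! ### Existence of symmetric hexagons -/

lemma det3_comb (N₀ N₁ N₂ x y z : Fin 3 → ℝ) (t : ℝ) :
    det3 (t • (x 0 • N₀ + x 1 • N₁ + x 2 • N₂)) (t • (y 0 • N₀ + y 1 • N₁ + y 2 • N₂))
      (t • (z 0 • N₀ + z 1 • N₁ + z 2 • N₂)) = t ^ 3 * (det3 x y z * det3 N₀ N₁ N₂) := by
  simp only [det3, Pi.add_apply, Pi.smul_apply, smul_eq_mul]
  ring

/-- Coefficients of the vertices of a symmetric hexagon with respect to the normals of its short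
edges, up to a common factor. -/
def vertexCoeff (c : ℝ) : Fin 6 → Fin 3 → ℝ :=
  ![![1, 0, c], ![c, 0, 1], ![c, 1, 0], ![1, c, 0], ![0, c, 1], ![0, 1, c]]

lemma det3_vertexCoeff_pos {c : ℝ} (hc : 1 < c) {i j : Fin 6} (h1 : j ≠ i) (h2 : j ≠ i + 1) :
    0 < det3 (vertexCoeff c i) (vertexCoeff c (i + 1)) (vertexCoeff c j) := by
  have e1 : 0 < c * c - 1 := by nlinarith
  have e2 : 0 < c * (c * c - 1) := by positivity
  have e3 : 0 < c * c + c := by positivity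
  fin_cases i <;> fin_cases j <;> first
    | exact absurd rfl h1
    | exact absurd rfl h2
    | (simp [vertexCoeff, det3]; linarith)

/-- The Minkowski products of the vertices of a symmetric hexagon, up to a common factor. -/
def vertexGram (c : ℝ) (i j : Fin 6) : ℝ :=
  vertexCoeff c i 0 * vertexCoeff c j 0 + vertexCoeff c i 1 * vertexCoeff c j 1 +
    vertexCoeff c i 2 * vertexCoeff c j 2 - c * (
    vertexCoeff c i 0 * (vertexCoeff c j 1 + vertexCoeff c j 2) +
    vertexCoeff c i 1 * (vertexCoeff c j 0 + vertexCoeff c j 2) +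
    vertexCoeff c i 2 * (vertexCoeff c j 0 + vertexCoeff c j 1))

lemma vertexGram_right_angle (c : ℝ) (i : Fin 6) :
    -(vertexGram c (i - 1) (i + 1) * (c ^ 2 - 1)) =
      vertexGram c i (i - 1) * vertexGram c i (i + 1) := by
  fin_cases i <;> simp [vertexCoeff, vertexGram] <;> ring

/-- Three unit normals with spatial parts at `120` degrees and equal time coordinates can be given
any product `-c` with `c > 1`. The vertices are then forced by the frame formulas, and the hexagon
axioms become identities and inequalities in `c`. -/
lemma exists_isSymmetricHexagon {L : ℝ} (hL : 0 < L) :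
    ∃ w : Fin 6 → UpperHalfPlane, IsSymmetricHexagon w ∧ dist (w 0) (w 1) = 2 * L := by
  have hL2 : 0 < 2 * L := by linarith
  set c := Real.cosh (2 * L) with hc
  set s := Real.sinh (2 * L) with hs
  have hspos : 0 < s := Real.sinh_pos_iff.mpr hL2
  have hcs : c ^ 2 = s ^ 2 + 1 := Real.cosh_sq _
  have hc1 : 1 < c := Real.one_lt_cosh.mpr hL2.ne'
  -- Solution of `r² - n² = 1` and `r² / 2 + n² = c`.
  set n := Real.sqrt ((2 * c - 1) / 3) with hn
  set r := Real.sqrt (2 * (1 + c) / 3) with hr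
  have hnpos : 0 < n := Real.sqrt_pos.mpr (by linarith)
  have hrpos : 0 < r := Real.sqrt_pos.mpr (by linarith)
  have hn2 : n ^ 2 = (2 * c - 1) / 3 := Real.sq_sqrt (by linarith)
  have hr2 : r ^ 2 = 2 * (1 + c) / 3 := Real.sq_sqrt (by linarith)
  have h3 : Real.sqrt 3 ^ 2 = 3 := Real.sq_sqrt (by norm_num)
  have h3pos : 0 < Real.sqrt 3 := Real.sqrt_pos.mpr (by norm_num)
  -- The negative time coordinate belongs to inward normals; the factor `-(1 / s)` then puts the
  -- vertices on the upper sheet.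
  obtain ⟨N₀, hN₀⟩ : ∃ N : Fin 3 → ℝ, N = ![-n, r, 0] := ⟨_, rfl⟩
  obtain ⟨N₁, hN₁⟩ : ∃ N : Fin 3 → ℝ, N = ![-n, -r / 2, r * Real.sqrt 3 / 2] := ⟨_, rfl⟩
  obtain ⟨N₂, hN₂⟩ : ∃ N : Fin 3 → ℝ, N = ![-n, -r / 2, -(r * Real.sqrt 3 / 2)] := ⟨_, rfl⟩
  have g00 : mink N₀ N₀ = 1 := by simp [mink, hN₀]; linarith
  have g11 : mink N₁ N₁ = 1 := by simp [mink, hN₁]; nlinarith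
  have g22 : mink N₂ N₂ = 1 := by simp [mink, hN₂]; nlinarith
  have g01 : mink N₀ N₁ = -c := by simp [mink, hN₀, hN₁]; nlinarith
  have g02 : mink N₀ N₂ = -c := by simp [mink, hN₀, hN₂]; nlinarith
  have g12 : mink N₁ N₂ = -c := by simp [mink, hN₁, hN₂]; nlinarith
  have g10 := (mink_comm N₁ N₀).trans g01
  have g20 := (mink_comm N₂ N₀).trans g02
  have g21 := (mink_comm N₂ N₁).trans g12
  have hdet : det3 N₀ N₁ N₂ < 0 := by
    have : det3 N₀ N₁ N₂ = -(3 / 2 * n * r ^ 2 * Real.sqrt 3) := by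
      simp [det3, hN₀, hN₁, hN₂]; ring
    rw [this]
    have : 0 < 3 / 2 * n * r ^ 2 * Real.sqrt 3 := by positivity
    linarith
  have hz0 : N₀ 0 = -n ∧ N₁ 0 = -n ∧ N₂ 0 = -n := by simp [hN₀, hN₁, hN₂]
  let V : Fin 6 → Fin 3 → ℝ := fun j => (-(1 / s)) •
    (vertexCoeff c j 0 • N₀ + vertexCoeff c j 1 • N₁ + vertexCoeff c j 2 • N₂)
  have hV : ∀ i j, mink (V i) (V j) = 1 / s ^ 2 * vertexGram c i j := by
    intro i j
    simp only [V, vertexGram, mink_smul_left, mink_smul_right, mink_add_left, mink_add_right, g00, g11, g22,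
      g01, g02, g12, g10, g20, g21]
    field_simp
    ring
  have hex : ∀ j, ∃ z, toHyp z = V j := by
    intro j
    apply exists_toHyp_eq
    · rw [hV]
      field_simp
      fin_cases j <;> simp [vertexCoeff, vertexGram] <;> linarith
    · simp only [V, Pi.smul_apply, Pi.add_apply, smul_eq_mul, hz0.1, hz0.2.1, hz0.2.2]
      have : 0 < 1 / s * ((1 + c) * n) := by positivity
      fin_cases j <;> simp [vertexCoeff] at * <;> linarith
  choose w hw using hex
  have hlen : ∀ i j, Real.cosh (dist (w i) (w j)) = -mink (V i) (V j) := by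
    intro i j
    rw [cosh_dist_eq_neg_mink, hw, hw]
  have hlong : ∀ i : Fin 3, dist (w (longIdx i)) (w (longIdx i + 1)) = 2 * L := by
    intro i
    apply Real.cosh_strictMonoOn.injOn (Set.mem_Ici.mpr dist_nonneg) (Set.mem_Ici.mpr hL2.le)
    rw [hlen, hV, ← hc]
    field_simp
    fin_cases i <;> simp [vertexCoeff, vertexGram, longIdx] <;> linear_combination c * hcs
  refine ⟨w, ⟨?_, ?_, ?_, ?_⟩, hlong 0⟩
  · intro i j h1 h2
    rw [det3_toHyp_pos_iff, hw, hw, hw]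
    simp only [V]
    rw [det3_comb]
    have hneg : (-(1 / s)) ^ 3 < 0 := by
      have : 0 < (1 / s) ^ 3 := by positivity
      rw [neg_pow]
      linarith
    exact mul_pos_of_neg_of_neg hneg
      (mul_neg_of_pos_of_neg (det3_vertexCoeff_pos hc1 h1 h2) hdet)
  · intro i
    rw [hypAngle_eq_iff, hlen, hlen, hlen, hV, hV, hV]
    have := vertexGram_right_angle c i
    field_simp
    linear_combination this + vertexGram c (i - 1) (i + 1) * hcs
  · rw [show dist (w 2) (w 3) = 2 * L from hlong 1, show dist (w 0) (w 1) = 2 * L from hlong 0]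
  · rw [show dist (w 4) (w 5) = 2 * L from hlong 2, show dist (w 0) (w 1) = 2 * L from hlong 0]

/-- Fermi coordinates of a hexagon together with the description of its region. -/
structure IsHexModel (L : ℝ) (v : Fin 6 → UpperHalfPlane)
    (a d : Fin 3 → UpperHalfPlane → ℝ) : Prop extends IsHexChart L v a d where
  mem_hexRegion : ∀ z, z ∈ hexRegion v ↔ ∀ i, 0 ≤ d i z ∧ |a i z| ≤ halfShort L

theorem IsSymmetricHexagon.exists_isHexModel {v : Fin 6 → UpperHalfPlane}
    (hv : IsSymmetricHexagon v) : ∃ a d, IsHexModel (halfLong v) v a d :=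
  ⟨_, _, hv.isHexFrame.isHexChart, hv.isHexFrame.mem_hexRegion_iff hv⟩

lemma fin3_one_one (i : Fin 3) : i + 1 + 1 = i + 2 := by fin_cases i <;> rfl
lemma fin3_one_two (i : Fin 3) : i + 1 + 2 = i := by fin_cases i <;> rfl
lemma fin3_two_one (i : Fin 3) : i + 2 + 1 = i := by fin_cases i <;> rfl
lemma fin3_two_two (i : Fin 3) : i + 2 + 2 = i + 1 := by fin_cases i <;> rfl

lemma fin3_cases (i j : Fin 3) : j = i ∨ j = i + 1 ∨ j = i + 2 := by
  fin_cases i <;> fin_cases j <;> decide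

lemma cosh_le_imp_abs_le {x y : ℝ} (hy : 0 ≤ y) (h : Real.cosh x ≤ Real.cosh y) : |x| ≤ y := by
  rw [Real.cosh_le_cosh, abs_of_nonneg hy] at h
  exact h

lemma eq_abs_of_cosh_eq {x y : ℝ} (hy : 0 ≤ y) (h : Real.cosh y = Real.cosh x) : y = |x| := by
  apply le_antisymm
  · rw [← abs_of_nonneg hy]
    exact Real.cosh_le_cosh.mp h.le
  · exact cosh_le_imp_abs_le hy h.ge

/-- The point `(a, d)` in Fermi coordinates is not farther from the given short edge than from
the others. -/
def BelowTop (L a d : ℝ) : Prop :=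
  Real.cosh L * Real.sinh d ≤ Real.sinh L * Real.cosh d * Real.cosh (halfShort L - |a|)

/-- The point `(a, d)` in Fermi coordinates is equally far from the given short edge and from
another one. -/
def OnTop (L a d : ℝ) : Prop :=
  Real.cosh L * Real.sinh d = Real.sinh L * Real.cosh d * Real.cosh (halfShort L - |a|)

/-! ### Edges, perpendiculars and sectors in Fermi coordinates. -/

namespace IsHexChart

variable {L : ℝ} {v : Fin 6 → UpperHalfPlane} {a d : Fin 3 → UpperHalfPlane → ℝ}

lemma cosh_dist' (M : IsHexChart L v a d) (i : Fin 3) (z w : UpperHalfPlane) :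
    Real.cosh (dist z w) = Real.cosh (d i z - d i w) +
      Real.cosh (d i z) * Real.cosh (d i w) * (Real.cosh (a i z - a i w) - 1) := by
  rw [M.cosh_dist i, Real.cosh_sub (d i z)]
  ring

lemma abs_sub_dist_le (M : IsHexChart L v a d) (i : Fin 3) (z w : UpperHalfPlane) :
    |d i z - d i w| ≤ dist z w := by
  apply cosh_le_imp_abs_le dist_nonneg
  rw [M.cosh_dist' i]
  have h1 := Real.one_le_cosh (a i z - a i w)
  have h2 := Real.cosh_pos (d i z)
  have h3 := Real.cosh_pos (d i w)
  nlinarith [mul_nonneg (mul_pos h2 h3).le (sub_nonneg.mpr h1)]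

lemma abs_sub_foot_le (M : IsHexChart L v a d) (i : Fin 3) (z w : UpperHalfPlane) :
    |a i z - a i w| ≤ dist z w := by
  apply cosh_le_imp_abs_le dist_nonneg
  rw [M.cosh_dist' i]
  have h1 := Real.one_le_cosh (a i z - a i w)
  have h2 := Real.one_le_cosh (d i z)
  have h3 := Real.one_le_cosh (d i w)
  have h4 := Real.one_le_cosh (d i z - d i w)
  nlinarith [mul_nonneg (sub_nonneg.mpr (one_le_mul_of_one_le_of_one_le h2 h3))
    (sub_nonneg.mpr h1)]

lemma ext_coords (M : IsHexChart L v a d) (i : Fin 3) {z w : UpperHalfPlane}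
    (h1 : a i z = a i w) (h2 : d i z = d i w) : z = w := by
  have h := M.cosh_dist' i z w
  rw [h1, h2, sub_self, sub_self, Real.cosh_zero, sub_self, mul_zero, add_zero] at h
  have := eq_abs_of_cosh_eq (x := 0) dist_nonneg (by rw [h, Real.cosh_zero])
  simpa using this

lemma dist_of_foot_eq (M : IsHexChart L v a d) (i : Fin 3) {z w : UpperHalfPlane}
    (h : a i z = a i w) : dist z w = |d i z - d i w| := by
  apply eq_abs_of_cosh_eq dist_nonneg
  rw [M.cosh_dist' i, h, sub_self, Real.cosh_zero, sub_self, mul_zero, add_zero]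

lemma dist_of_dist_eq_zero (M : IsHexChart L v a d) (i : Fin 3) {z w : UpperHalfPlane}
    (h : d i z = 0) (h' : d i w = 0) : dist z w = |a i z - a i w| := by
  apply eq_abs_of_cosh_eq dist_nonneg
  rw [M.cosh_dist' i, h, h', sub_self, Real.cosh_zero]
  ring

lemma cosh_dist_of_dist_eq_zero (M : IsHexChart L v a d) (i : Fin 3) {z w : UpperHalfPlane}
    (h' : d i w = 0) : Real.cosh (dist z w) = Real.cosh (d i z) * Real.cosh (a i z - a i w) := by
  rw [M.cosh_dist i, h', Real.cosh_zero, Real.sinh_zero]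
  ring

/-- The foot is a `1`-Lipschitz function, so equality in the triangle inequality forces both
distances to equal differences of feet. Pythagoras then leaves no room for a nonzero `d`. -/
lemma mem_shortEdge_iff (M : IsHexChart L v a d) (i : Fin 3) (z : UpperHalfPlane) :
    z ∈ shortEdge v i ↔ d i z = 0 ∧ |a i z| ≤ halfShort L := by
  have hl := halfShort_pos M.pos
  obtain ⟨f1, f2⟩ := M.first i
  obtain ⟨s1, s2⟩ := M.second i
  have hlen : dist (v (shortIdx i)) (v (shortIdx i + 1)) = 2 * halfShort L := by
    rw [M.dist_of_dist_eq_zero i f2 s2, f1, s1, abs_of_neg (by linarith)]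
    ring
  rw [shortEdge, hypSegment, Set.mem_ofPred_eq, hlen]
  constructor
  · intro h
    have h1 := M.abs_sub_foot_le i (v (shortIdx i)) z
    have h2 := M.abs_sub_foot_le i z (v (shortIdx i + 1))
    rw [f1] at h1
    rw [s1] at h2
    have h3 := neg_le_abs (-halfShort L - a i z)
    have h4 := neg_le_abs (a i z - halfShort L)
    have h5 : dist z (v (shortIdx i + 1)) = halfShort L - a i z := by linarith
    have h6 : dist (v (shortIdx i)) z = halfShort L + a i z := by linarith
    have h7 : -halfShort L ≤ a i z := by
      have := dist_nonneg (x := v (shortIdx i)) (y := z); linarith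
    have h8 : a i z ≤ halfShort L := by
      have := dist_nonneg (x := z) (y := v (shortIdx i + 1)); linarith
    refine ⟨?_, abs_le.mpr ⟨h7, h8⟩⟩
    have h9 := M.cosh_dist_of_dist_eq_zero i (z := z) s2
    rw [h5, s1, ← Real.cosh_neg (a i z - halfShort L), neg_sub] at h9
    have h10 := Real.cosh_pos (halfShort L - a i z)
    have h11 : Real.cosh (d i z) = 1 := by
      have : 1 * Real.cosh (halfShort L - a i z) =
        Real.cosh (d i z) * Real.cosh (halfShort L - a i z) := by rw [one_mul, ← h9]
      exact (mul_right_cancel₀ h10.ne' this).symm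
    by_contra hne
    exact (Real.one_lt_cosh.mpr hne).ne' h11
  · rintro ⟨h1, h2⟩
    have h3 := abs_le.mp h2
    rw [M.dist_of_dist_eq_zero i f2 h1, M.dist_of_dist_eq_zero i h1 s2, f1, s1,
      abs_of_nonpos (by linarith), abs_of_nonpos (by linarith)]
    ring

lemma dist_long (M : IsHexChart L v a d) (i : Fin 3) :
    dist (v (longIdx i)) (v (longIdx i + 1)) = 2 * L := by
  rw [longIdx_add_one, M.dist_of_foot_eq i ((M.long_first i).1.trans (M.first i).1.symm),
    (M.long_first i).2, (M.first i).2, sub_zero, abs_of_pos (by linarith [M.pos])]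

lemma halfLong_eq (M : IsHexChart L v a d) : halfLong v = L := by
  have : dist (v 0) (v 1) = 2 * L := M.dist_long 0
  rw [halfLong, this]
  ring

lemma shortLength_eq (M : IsHexChart L v a d) (i : Fin 3) :
    shortLength v i = 2 * halfShort L := by
  have hl := halfShort_pos M.pos
  rw [shortLength, M.dist_of_dist_eq_zero i (M.first i).2 (M.second i).2, (M.first i).1,
    (M.second i).1, abs_of_neg (by linarith)]
  ring

/-- As for the short edges, with the distance `d` in the role of the `1`-Lipschitz function and the
foot as the coordinate that must not move. -/
lemma mem_longEdge_iff (M : IsHexChart L v a d) (i : Fin 3) (z : UpperHalfPlane) :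
    z ∈ longEdge v i ↔ a i z = -halfShort L ∧ 0 ≤ d i z ∧ d i z ≤ 2 * L := by
  have hL := M.pos
  obtain ⟨f1, f2⟩ := M.first i
  obtain ⟨s1, s2⟩ := M.long_first i
  rw [longEdge, hypSegment, Set.mem_ofPred_eq, M.dist_long, longIdx_add_one]
  constructor
  · intro h
    have h1 := M.abs_sub_dist_le i (v (longIdx i)) z
    have h2 := M.abs_sub_dist_le i z (v (shortIdx i))
    rw [s2] at h1
    rw [f2, sub_zero] at h2
    have h3 := le_abs_self (2 * L - d i z)
    have h4 := le_abs_self (d i z)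
    have h5 : dist z (v (shortIdx i)) = d i z := by linarith
    have h6 : dist (v (longIdx i)) z = 2 * L - d i z := by linarith
    have h7 : 0 ≤ d i z := h5 ▸ dist_nonneg
    have h8 : 0 ≤ 2 * L - d i z := h6 ▸ dist_nonneg
    refine ⟨?_, h7, by linarith⟩
    have h9 := M.cosh_dist_of_dist_eq_zero i (z := z) f2
    rw [h5, f1] at h9
    have h10 := Real.cosh_pos (d i z)
    have h11 : Real.cosh (a i z - -halfShort L) = 1 := by
      have : Real.cosh (d i z) * 1 = Real.cosh (d i z) * Real.cosh (a i z - -halfShort L) := by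
        rw [mul_one, ← h9]
      exact (mul_left_cancel₀ h10.ne' this).symm
    by_contra hne
    exact (Real.one_lt_cosh.mpr (sub_ne_zero.mpr hne)).ne' h11
  · rintro ⟨h1, h2, h3⟩
    rw [M.dist_of_foot_eq i (s1.trans h1.symm), M.dist_of_foot_eq i (h1.trans f1.symm), s2, f2,
      abs_of_nonneg (by linarith), abs_of_nonneg (by linarith)]
    ring

lemma infDist_shortEdge (M : IsHexChart L v a d) (i : Fin 3) {z : UpperHalfPlane}
    (h : |a i z| ≤ halfShort L) (h0 : 0 ≤ d i z) :
    Metric.infDist z (shortEdge v i) = d i z := by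
  obtain ⟨p, hp1, hp2⟩ := M.surj i (a i z) 0
  have hp : p ∈ shortEdge v i := (M.mem_shortEdge_iff i p).mpr ⟨hp2, by rwa [hp1]⟩
  apply le_antisymm
  · refine (Metric.infDist_le_dist_of_mem hp).trans ?_
    rw [M.dist_of_foot_eq i hp1.symm, hp2, sub_zero, abs_of_nonneg h0]
  · refine (Metric.le_infDist ⟨p, hp⟩).mpr fun q hq => ?_
    have := M.abs_sub_dist_le i z q
    rw [((M.mem_shortEdge_iff i q).mp hq).1, sub_zero] at this
    exact (le_abs_self _).trans this

/-- After Pythagoras and the addition formula, a right angle at `p` is the vanishing of a product of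
two `sinh` of differences of feet, one of which is nonzero for `q ≠ p`. -/
lemma perpendicular_iff (M : IsHexChart L v a d) (i : Fin 3) {z p : UpperHalfPlane}
    (hp : p ∈ shortEdge v i) :
    (z = p ∨ ∀ q ∈ shortEdge v i, q ≠ p → hypAngle p z q = Real.pi / 2) ↔ a i z = a i p := by
  have hl := halfShort_pos M.pos
  obtain ⟨hp1, hp2⟩ := (M.mem_shortEdge_iff i p).mp hp
  have key : ∀ q ∈ shortEdge v i, (hypAngle p z q = Real.pi / 2 ↔
      Real.sinh (a i z - a i p) * Real.sinh (a i p - a i q) = 0) := by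
    intro q hq
    obtain ⟨hq1, hq2⟩ := (M.mem_shortEdge_iff i q).mp hq
    rw [hypAngle_eq_iff, M.cosh_dist_of_dist_eq_zero i hq1, dist_comm p z,
      M.cosh_dist_of_dist_eq_zero i hp1, M.cosh_dist_of_dist_eq_zero i hq1, hp1, Real.cosh_zero,
      show a i z - a i q = (a i z - a i p) + (a i p - a i q) by ring, Real.cosh_add]
    have := Real.cosh_pos (d i z)
    constructor
    · intro h
      have h' : Real.cosh (d i z) *
          (Real.sinh (a i z - a i p) * Real.sinh (a i p - a i q)) = 0 := by linarith
      exact (mul_eq_zero.mp h').resolve_left this.ne'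
    · intro h
      rw [h]
      ring
  constructor
  · rintro (rfl | h)
    · rfl
    · obtain ⟨q, hq, hne⟩ : ∃ q ∈ shortEdge v i, q ≠ p := by
        have e1 : v (shortIdx i) ∈ shortEdge v i := by
          rw [M.mem_shortEdge_iff, (M.first i).1, (M.first i).2, abs_neg, abs_of_pos hl]
          exact ⟨rfl, le_rfl⟩
        have e2 : v (shortIdx i + 1) ∈ shortEdge v i := by
          rw [M.mem_shortEdge_iff, (M.second i).1, (M.second i).2, abs_of_pos hl]
          exact ⟨rfl, le_rfl⟩
        by_cases h1 : v (shortIdx i) = p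
        · refine ⟨_, e2, fun h2 => ?_⟩
          have h3 := (M.first i).1
          have h4 := (M.second i).1
          rw [h1] at h3
          rw [h2] at h4
          linarith
        · exact ⟨_, e1, h1⟩
      have h1 := (key q hq).mp (h q hq hne)
      have hq' := (M.mem_shortEdge_iff i q).mp hq
      rcases mul_eq_zero.mp h1 with h2 | h2
      · exact sub_eq_zero.mp (Real.sinh_eq_zero.mp h2)
      · exact absurd (M.ext_coords i (sub_eq_zero.mp (Real.sinh_eq_zero.mp h2)).symm
          (hq'.1.trans hp1.symm)) hne
  · intro h
    right
    intro q hq _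
    rw [key q hq, h, sub_self, Real.sinh_zero, zero_mul]

/-- The perpendicular bisector of a short edge is the equidistant locus of the other two: the sign
of the foot tells which of them is nearer. -/
lemma sinh_foot (M : IsHexChart L v a d) (i : Fin 3) (z : UpperHalfPlane) :
    2 * Real.cosh L * (Real.cosh (d i z) * Real.sinh (a i z)) =
      Real.sinh (d (i + 2) z) - Real.sinh (d (i + 1) z) := by
  rw [M.sinh_next, M.sinh_prev, Real.cosh_add, Real.cosh_sub, Real.sinh_two_mul]
  linear_combination (-4 * Real.cosh L * Real.cosh (d i z) * Real.sinh (a i z)) *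
    sinh_mul_sinh_halfShort M.pos

lemma foot_nonneg_iff (M : IsHexChart L v a d) (i : Fin 3) (z : UpperHalfPlane) :
    0 ≤ a i z ↔ d (i + 1) z ≤ d (i + 2) z := by
  have h := M.sinh_foot i z
  rw [← mul_assoc] at h
  rw [← Real.sinh_le_sinh (x := d (i + 1) z), ← sub_nonneg (b := Real.sinh (d (i + 1) z)), ← h,
    mul_sinh_nonneg_iff]
  have := Real.cosh_pos L
  have := Real.cosh_pos (d i z)
  positivity

lemma foot_nonpos_iff (M : IsHexChart L v a d) (i : Fin 3) (z : UpperHalfPlane) :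
    a i z ≤ 0 ↔ d (i + 2) z ≤ d (i + 1) z := by
  have h := M.sinh_foot i z
  rw [← mul_assoc] at h
  have hp : 0 < 2 * Real.cosh L * Real.cosh (d i z) := by
    have := Real.cosh_pos L
    have := Real.cosh_pos (d i z)
    positivity
  rw [← Real.sinh_le_sinh (x := d (i + 2) z), ← sub_nonpos (a := Real.sinh (d (i + 2) z)), ← h]
  have := mul_sinh_nonneg_iff (x := -a i z) hp
  rw [Real.sinh_neg] at this
  constructor
  · intro h1
    have := this.mpr (by linarith)
    linarith
  · intro h1
    have := this.mp (by linarith)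
    linarith

lemma sinh_next_sub (M : IsHexChart L v a d) (i : Fin 3) (z : UpperHalfPlane) :
    Real.sinh (d (i + 1) z) - Real.sinh (d i z) = 2 * Real.cosh L *
      (Real.sinh L * Real.cosh (d i z) * Real.cosh (halfShort L - a i z) -
        Real.cosh L * Real.sinh (d i z)) := by
  rw [M.sinh_next, Real.sinh_two_mul, Real.cosh_two_mul]
  linear_combination Real.sinh (d i z) * Real.cosh_sq L

lemma sinh_prev_sub (M : IsHexChart L v a d) (i : Fin 3) (z : UpperHalfPlane) :
    Real.sinh (d (i + 2) z) - Real.sinh (d i z) = 2 * Real.cosh L *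
      (Real.sinh L * Real.cosh (d i z) * Real.cosh (halfShort L + a i z) -
        Real.cosh L * Real.sinh (d i z)) := by
  rw [M.sinh_prev, Real.sinh_two_mul, Real.cosh_two_mul]
  linear_combination Real.sinh (d i z) * Real.cosh_sq L

lemma le_next_iff (M : IsHexChart L v a d) (i : Fin 3) (z : UpperHalfPlane) :
    d i z ≤ d (i + 1) z ↔ Real.cosh L * Real.sinh (d i z) ≤
      Real.sinh L * Real.cosh (d i z) * Real.cosh (halfShort L - a i z) := by
  rw [← Real.sinh_le_sinh, ← sub_nonneg, M.sinh_next_sub,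
    mul_nonneg_iff_of_pos_left (by have := Real.cosh_pos L; positivity), sub_nonneg]

lemma le_prev_iff (M : IsHexChart L v a d) (i : Fin 3) (z : UpperHalfPlane) :
    d i z ≤ d (i + 2) z ↔ Real.cosh L * Real.sinh (d i z) ≤
      Real.sinh L * Real.cosh (d i z) * Real.cosh (halfShort L + a i z) := by
  rw [← Real.sinh_le_sinh, ← sub_nonneg, M.sinh_prev_sub,
    mul_nonneg_iff_of_pos_left (by have := Real.cosh_pos L; positivity), sub_nonneg]

lemma eq_next_iff (M : IsHexChart L v a d) (i : Fin 3) (z : UpperHalfPlane) :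
    d (i + 1) z = d i z ↔ Real.cosh L * Real.sinh (d i z) =
      Real.sinh L * Real.cosh (d i z) * Real.cosh (halfShort L - a i z) := by
  rw [← Real.sinh_injective.eq_iff, ← sub_eq_zero, M.sinh_next_sub, mul_eq_zero,
    or_iff_right (by have := Real.cosh_pos L; positivity), sub_eq_zero, eq_comm]

lemma eq_prev_iff (M : IsHexChart L v a d) (i : Fin 3) (z : UpperHalfPlane) :
    d (i + 2) z = d i z ↔ Real.cosh L * Real.sinh (d i z) =
      Real.sinh L * Real.cosh (d i z) * Real.cosh (halfShort L + a i z) := by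
  rw [← Real.sinh_injective.eq_iff, ← sub_eq_zero, M.sinh_prev_sub, mul_eq_zero,
    or_iff_right (by have := Real.cosh_pos L; positivity), sub_eq_zero, eq_comm]

/-- The reflection that exchanges two short edges reverses the orientation of the feet; this sign is
why the sector map has to be even in `a`. -/
lemma foot_next_of_eq (M : IsHexChart L v a d) (i : Fin 3) {z : UpperHalfPlane}
    (h : d (i + 1) z = d i z) : a (i + 1) z = -a i z := by
  have h1 := M.sinh_foot i z
  have h2 := M.sinh_foot (i + 1) z
  rw [fin3_one_one, fin3_one_two, h] at h2
  rw [h] at h1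
  have hp : 2 * Real.cosh L * Real.cosh (d i z) ≠ 0 := by positivity
  apply Real.sinh_injective
  rw [Real.sinh_neg]
  apply mul_left_cancel₀ hp
  linarith

lemma foot_prev_of_eq (M : IsHexChart L v a d) (i : Fin 3) {z : UpperHalfPlane}
    (h : d (i + 2) z = d i z) : a (i + 2) z = -a i z := by
  have := M.foot_next_of_eq (i + 2) (z := z) (by rw [fin3_two_one, h])
  rw [fin3_two_one] at this
  linarith

/-- Of the two comparisons the stricter one is with the edge on the side of the foot, hence the
`|a|`. -/
lemma forall_le_iff (M : IsHexChart L v a d) (i : Fin 3) {z : UpperHalfPlane}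
    (ha : |a i z| ≤ halfShort L) : (∀ j, d i z ≤ d j z) ↔ BelowTop L (a i z) (d i z) := by
  have hl := halfShort_pos M.pos
  have hσ := Real.sinh_pos_iff.mpr M.pos
  have hc := Real.cosh_pos (d i z)
  have ha' := abs_le.mp ha
  have hsplit : (∀ j, d i z ≤ d j z) ↔ d i z ≤ d (i + 1) z ∧ d i z ≤ d (i + 2) z := by
    constructor
    · intro h
      exact ⟨h _, h _⟩
    · rintro ⟨h1, h2⟩ j
      rcases fin3_cases i j with rfl | rfl | rfl
      · exact le_rfl
      · exact h1
      · exact h2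
  rw [hsplit, M.le_next_iff, M.le_prev_iff, BelowTop]
  have hmono : ∀ {x y : ℝ}, |x| ≤ |y| → Real.sinh L * Real.cosh (d i z) * Real.cosh x ≤
      Real.sinh L * Real.cosh (d i z) * Real.cosh y := by
    intro x y hxy
    have := Real.cosh_le_cosh.mpr hxy
    gcongr
  rcases le_total 0 (a i z) with h0 | h0
  · rw [abs_of_nonneg h0]
    refine ⟨fun h => h.1, fun h => ⟨h, h.trans (hmono ?_)⟩⟩
    rw [abs_of_nonneg (by linarith), abs_of_nonneg (by linarith)]
    linarith
  · rw [abs_of_nonpos h0, sub_neg_eq_add]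
    refine ⟨fun h => h.2, fun h => ⟨h.trans (hmono ?_), h⟩⟩
    rw [abs_of_nonneg (by linarith), abs_of_nonneg (by linarith)]
    linarith

end IsHexChart

/-! ### The hexagon, its edges and its leaves in coordinates. -/

namespace IsHexModel

variable {L : ℝ} {v : Fin 6 → UpperHalfPlane} {a d : Fin 3 → UpperHalfPlane → ℝ}

lemma dist_nonneg' (M : IsHexModel L v a d) {z : UpperHalfPlane} (hz : z ∈ hexRegion v)
    (i : Fin 3) : 0 ≤ d i z := ((M.mem_hexRegion z).mp hz i).1

lemma abs_foot_le (M : IsHexModel L v a d) {z : UpperHalfPlane} (hz : z ∈ hexRegion v)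
    (i : Fin 3) : |a i z| ≤ halfShort L := ((M.mem_hexRegion z).mp hz i).2

/-- Being in the sector of edge `i` already implies the conditions in the other charts: `side`
transports one bound on the foot, and nearness to edge `i` fixes the sign of the foot, giving the
other bound. -/
lemma mem_of_forall_le (M : IsHexModel L v a d) {i : Fin 3} {z : UpperHalfPlane}
    (h0 : 0 ≤ d i z) (ha : |a i z| ≤ halfShort L) (h : ∀ j, d i z ≤ d j z) :
    z ∈ hexRegion v := by
  have hl := halfShort_pos M.pos
  have ha' := abs_le.mp ha
  rw [M.mem_hexRegion]
  intro j
  refine ⟨h0.trans (h j), ?_⟩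
  rcases fin3_cases i j with rfl | rfl | rfl
  · exact ha
  · have h1 := M.side i z
    have h2 : 0 ≤ Real.cosh (d i z) * Real.sinh (halfShort L - a i z) :=
      (mul_sinh_nonneg_iff (Real.cosh_pos _)).mpr (by linarith)
    rw [← h1, mul_sinh_nonneg_iff (Real.cosh_pos _)] at h2
    have h3 := (M.foot_nonpos_iff (i + 1) z).mpr (by
      rw [fin3_one_one, fin3_one_two]; exact h _)
    exact abs_le.mpr ⟨by linarith, by linarith⟩
  · have h1 := M.side (i + 2) z
    rw [fin3_two_one] at h1
    have h2 : 0 ≤ Real.cosh (d i z) * Real.sinh (halfShort L + a i z) :=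
      (mul_sinh_nonneg_iff (Real.cosh_pos _)).mpr (by linarith)
    rw [h1, mul_sinh_nonneg_iff (Real.cosh_pos _)] at h2
    have h3 := (M.foot_nonneg_iff (i + 2) z).mpr (by
      rw [fin3_two_one, fin3_two_two]; exact h _)
    exact abs_le.mpr ⟨by linarith, by linarith⟩

lemma mem_longSide_iff (M : IsHexModel L v a d) (i : Fin 3) (z : hexRegion v) :
    z ∈ longSide v i ↔ a i z = -halfShort L := by
  rw [longSide, Set.mem_ofPred_eq, M.mem_longEdge_iff]
  refine ⟨fun h => h.1, fun h => ⟨h, M.dist_nonneg' z.2 i, ?_⟩⟩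
  have h1 := M.dist_nonneg' z.2 (i + 2)
  rw [← Real.sinh_nonneg_iff, M.sinh_prev, h, add_neg_cancel, Real.cosh_zero, mul_one,
    ← Real.sinh_sub, Real.sinh_nonneg_iff] at h1
  linarith

lemma mem_shortSide_iff (M : IsHexModel L v a d) (i : Fin 3) (z : hexRegion v) :
    z ∈ shortSide v i ↔ d i z = 0 := by
  rw [shortSide, Set.mem_ofPred_eq, M.mem_shortEdge_iff]
  exact ⟨fun h => h.1, fun h => ⟨h, M.abs_foot_le z.2 i⟩⟩

lemma infDist_eq (M : IsHexModel L v a d) (i : Fin 3) (z : hexRegion v) :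
    Metric.infDist (z : UpperHalfPlane) (shortEdge v i) = d i z :=
  M.infDist_shortEdge i (M.abs_foot_le z.2 i) (M.dist_nonneg' z.2 i)

lemma mem_foliatedPart_iff (M : IsHexModel L v a d) (i : Fin 3) (z : hexRegion v) :
    z ∈ foliatedPart v i ↔ d i z ≤ L := by
  rw [foliatedPart, Set.mem_ofPred_eq, M.infDist_eq, M.halfLong_eq]

lemma mem_hypercycleLeaf_iff (M : IsHexModel L v a d) (i : Fin 3) (t : ℝ) (z : hexRegion v) :
    z ∈ hypercycleLeaf v i t ↔ d i z = t := by
  rw [hypercycleLeaf, Set.mem_ofPred_eq, M.infDist_eq]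

lemma mem_geodesicLeaf_iff (M : IsHexModel L v a d) (i : Fin 3) {p : UpperHalfPlane}
    (hp : p ∈ shortEdge v i) (z : hexRegion v) :
    z ∈ geodesicLeaf v i p ↔ d i z ≤ L ∧ a i z = a i p := by
  rw [geodesicLeaf, Set.mem_ofPred_eq, M.mem_foliatedPart_iff, M.perpendicular_iff i hp]

/-- For `d ≤ L` one has `tanh d ≤ tanh L`, and the top of the sector is never below that value. Thus
each foliated component lies inside its sector. -/
lemma forall_le_of_le (M : IsHexModel L v a d) {i : Fin 3} {z : UpperHalfPlane}
    (hz : z ∈ hexRegion v) (h : d i z ≤ L) (j : Fin 3) : d i z ≤ d j z := by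
  revert j
  rw [M.forall_le_iff i (M.abs_foot_le hz i), BelowTop]
  have h1 := Real.one_le_cosh (halfShort L - |a i z|)
  have hσ := Real.sinh_pos_iff.mpr M.pos
  have h2 : Real.cosh L * Real.sinh (d i z) ≤ Real.sinh L * Real.cosh (d i z) := by
    have : 0 ≤ Real.sinh (L - d i z) := Real.sinh_nonneg_iff.mpr (by linarith)
    rw [Real.sinh_sub] at this
    linarith
  refine h2.trans (le_mul_of_one_le_right ?_ h1)
  have := Real.cosh_pos (d i z)
  positivity

lemma exists_min (d : Fin 3 → UpperHalfPlane → ℝ) (z : UpperHalfPlane) :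
    ∃ i, ∀ j, d i z ≤ d j z := by
  obtain ⟨i, -, hi⟩ := Finset.exists_min_image Finset.univ (fun i => d i z) ⟨0, by simp⟩
  exact ⟨i, fun j => hi j (by simp)⟩

end IsHexModel

/-! ### Maps between hexagons that are given in Fermi coordinates -/

/-- The ratio of the lengths of the short edges. -/
def shortRatio (L L' : ℝ) : ℝ := halfShort L' / halfShort L

lemma shortRatio_pos {L L' : ℝ} (hL : 0 < L) (hL' : 0 < L') : 0 < shortRatio L L' :=
  div_pos (halfShort_pos hL') (halfShort_pos hL)

lemma shortRatio_mul_halfShort {L : ℝ} (hL : 0 < L) (L' : ℝ) :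
    shortRatio L L' * halfShort L = halfShort L' := by
  have := halfShort_pos hL
  rw [shortRatio]
  field_simp

lemma shortRatio_mul_cancel {L L' : ℝ} (hL : 0 < L) (hL' : 0 < L') (x : ℝ) :
    shortRatio L' L * (shortRatio L L' * x) = x := by
  have := halfShort_pos hL
  have := halfShort_pos hL'
  rw [shortRatio, shortRatio]
  field_simp

/-- `(a, d) ↦ (λ a, ψ a d)`, where `λ` is the ratio of the lengths of the short edges, maps the
points closest to a given short edge to such points, symmetrically, and is linear in `d` on the
foliated region. -/
structure IsSectorMap (L L' : ℝ) (ψ : ℝ → ℝ → ℝ) : Prop where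
  nonneg : ∀ {a d}, |a| ≤ halfShort L → 0 ≤ d → BelowTop L a d → 0 ≤ ψ a d
  below : ∀ {a d}, |a| ≤ halfShort L → 0 ≤ d → BelowTop L a d →
    BelowTop L' (shortRatio L L' * a) (ψ a d)
  top : ∀ {a d}, |a| ≤ halfShort L → 0 ≤ d → OnTop L a d →
    OnTop L' (shortRatio L L' * a) (ψ a d)
  even : ∀ a d, ψ (-a) d = ψ a d
  leaf : ∀ {a d}, 0 ≤ d → d ≤ L → ψ a d = L' / L * d

section Gluing

variable {L L' : ℝ} {v w : Fin 6 → UpperHalfPlane} {a d a' d' : Fin 3 → UpperHalfPlane → ℝ}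
  {ψ ψ' : ℝ → ℝ → ℝ}

/-- The image is built in the chart of one nearest edge. If another edge is equally near, the point
is on the top, so is its image, and the feet in both charts are opposite; evenness makes the second
prescription agree with the first. -/
lemma IsSectorMap.exists_image (S : IsSectorMap L L' ψ) (M : IsHexModel L v a d)
    (M' : IsHexModel L' w a' d') (z : hexRegion v) : ∃ z' : hexRegion w, ∀ i,
      (∀ j, d i z ≤ d j z) → (∀ j, d' i z' ≤ d' j z') ∧
        a' i z' = shortRatio L L' * a i z ∧ d' i z' = ψ (a i z) (d i z) := by
  obtain ⟨i, hi⟩ := IsHexModel.exists_min d z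
  have hr := shortRatio_pos M.pos M'.pos
  have h0 := M.dist_nonneg' z.2 i
  have ha := M.abs_foot_le z.2 i
  have hb := (M.forall_le_iff i ha).mp hi
  obtain ⟨z', hz1, hz2⟩ := M'.surj i (shortRatio L L' * a i z) (ψ (a i z) (d i z))
  have ha' : |a' i z'| ≤ halfShort L' := by
    rw [hz1, abs_mul, abs_of_pos hr, ← shortRatio_mul_halfShort M.pos]
    gcongr
  have h0' : 0 ≤ d' i z' := by rw [hz2]; exact S.nonneg ha h0 hb
  have hi' : ∀ j, d' i z' ≤ d' j z' := by
    rw [M'.forall_le_iff i ha', hz1, hz2]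
    exact S.below ha h0 hb
  refine ⟨⟨z', M'.mem_of_forall_le h0' ha' hi'⟩, fun j hj => ?_⟩
  rcases fin3_cases i j with rfl | rfl | rfl
  · exact ⟨hi', hz1, hz2⟩
  · have e : d (i + 1) z = d i z := le_antisymm (hj i) (hi _)
    have hpos : 0 ≤ a i z := (M.foot_nonneg_iff i z).mpr (hj _)
    have ht : OnTop L (a i z) (d i z) := by
      rw [OnTop, abs_of_nonneg hpos]
      exact (M.eq_next_iff i z).mp e
    have ht' := S.top ha h0 ht
    rw [OnTop, abs_of_nonneg (mul_nonneg hr.le hpos), ← hz1, ← hz2] at ht'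
    have e' := (M'.eq_next_iff i z').mpr ht'
    simp only
    rw [M.foot_next_of_eq i e, M'.foot_next_of_eq i e', e', e, hz1, hz2, S.even]
    exact ⟨fun j => by rw [← hz2]; exact hi' j, by ring, rfl⟩
  · have e : d (i + 2) z = d i z := le_antisymm (hj i) (hi _)
    have hneg : a i z ≤ 0 := (M.foot_nonpos_iff i z).mpr (hj _)
    have ht : OnTop L (a i z) (d i z) := by
      rw [OnTop, abs_of_nonpos hneg, sub_neg_eq_add]
      exact (M.eq_prev_iff i z).mp e
    have ht' := S.top ha h0 ht
    rw [OnTop, abs_of_nonpos (mul_nonpos_of_nonneg_of_nonpos hr.le hneg), ← hz1, ← hz2,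
      sub_neg_eq_add] at ht'
    have e' := (M'.eq_prev_iff i z').mpr ht'
    simp only
    rw [M.foot_prev_of_eq i e, M'.foot_prev_of_eq i e', e', e, hz1, hz2, S.even]
    exact ⟨fun j => by rw [← hz2]; exact hi' j, by ring, rfl⟩

/-- `F` is given by `(a, d) ↦ (λ a, ψ a d)` in Fermi coordinates with respect to a closest short
edge. -/
def IsGlued (L L' : ℝ) (a d a' d' : Fin 3 → UpperHalfPlane → ℝ) (ψ : ℝ → ℝ → ℝ)
    (F : hexRegion v → hexRegion w) : Prop :=
  ∀ (z : hexRegion v) (i : Fin 3), (∀ j, d i z ≤ d j z) → (∀ j, d' i (F z) ≤ d' j (F z)) ∧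
    a' i (F z) = shortRatio L L' * a i z ∧ d' i (F z) = ψ (a i z) (d i z)

lemma IsSectorMap.exists_isGlued (S : IsSectorMap L L' ψ) (M : IsHexModel L v a d)
    (M' : IsHexModel L' w a' d') :
    ∃ F : hexRegion v → hexRegion w, IsGlued L L' a d a' d' ψ F := by
  choose F hF using S.exists_image M M'
  exact ⟨F, hF⟩

lemma IsGlued.leftInverse {F : hexRegion v → hexRegion w} {G : hexRegion w → hexRegion v}
    (hF : IsGlued L L' a d a' d' ψ F) (hG : IsGlued L' L a' d' a d ψ' G)
    (M : IsHexModel L v a d) (hL' : 0 < L')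
    (hψ : ∀ {x y}, |x| ≤ halfShort L → 0 ≤ y → BelowTop L x y →
      ψ' (shortRatio L L' * x) (ψ x y) = y) : Function.LeftInverse G F := by
  intro z
  obtain ⟨i, hi⟩ := IsHexModel.exists_min d z
  obtain ⟨h1, h2, h3⟩ := hF z i hi
  obtain ⟨-, h5, h6⟩ := hG (F z) i h1
  apply Subtype.ext
  refine M.ext_coords i ?_ ?_
  · rw [h5, h2, shortRatio_mul_cancel M.pos hL']
  · rw [h6, h2, h3]
    exact hψ (M.abs_foot_le z.2 i) (M.dist_nonneg' z.2 i)
      ((M.forall_le_iff i (M.abs_foot_le z.2 i)).mp hi)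

/-! ### Images of edges, components and leaves under the glued map. -/

section Leaves

variable {F : hexRegion v → hexRegion w}

/-- A point of a long edge is nearest to one of the two short edges that it joins. In the chart of
the other one, `side` moves the boundary condition across. -/
lemma IsGlued.foot_eq_neg (hF : IsGlued L L' a d a' d' ψ F) (M : IsHexModel L v a d)
    (M' : IsHexModel L' w a' d') {i : Fin 3} {z : hexRegion v} (h : a i z = -halfShort L) :
    a' i (F z) = -halfShort L' := by
  have hl := halfShort_pos M.pos
  obtain ⟨j, hj⟩ := IsHexModel.exists_min d z
  obtain ⟨-, h2, -⟩ := hF z j hj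
  rcases fin3_cases i j with rfl | rfl | rfl
  · rw [h2, h, mul_neg, shortRatio_mul_halfShort M.pos]
  -- The opposite short edge cannot be nearest, since this would make the foot nonnegative.
  · have := (M.foot_nonneg_iff i z).mpr (hj _)
    linarith
  · have h3 := M.side (i + 2) z
    rw [fin3_two_one, h, add_neg_cancel, Real.sinh_zero, mul_zero, eq_comm, mul_eq_zero,
      or_iff_right (Real.cosh_pos _).ne', Real.sinh_eq_zero, sub_eq_zero] at h3
    rw [← h3, shortRatio_mul_halfShort M.pos] at h2
    have h4 := M'.side (i + 2) (F z)
    rw [fin3_two_one, h2, sub_self, Real.sinh_zero, mul_zero, mul_eq_zero,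
      or_iff_right (Real.cosh_pos _).ne', Real.sinh_eq_zero] at h4
    linarith

lemma IsGlued.coords_of_le (hF : IsGlued L L' a d a' d' ψ F) (S : IsSectorMap L L' ψ)
    (M : IsHexModel L v a d) {i : Fin 3} {z : hexRegion v} (h : d i z ≤ L) :
    a' i (F z) = shortRatio L L' * a i z ∧ d' i (F z) = L' / L * d i z := by
  obtain ⟨-, h2, h3⟩ := hF z i (M.forall_le_of_le z.2 h)
  exact ⟨h2, h3.trans (S.leaf (M.dist_nonneg' z.2 i) h)⟩

lemma div_mul_le_of_le {x : ℝ} (hL : 0 < L) (hL' : 0 < L') (h : x ≤ L) : L' / L * x ≤ L' := by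
  rw [div_mul_eq_mul_div, div_le_iff₀ hL]
  gcongr

variable {G : hexRegion w → hexRegion v}

lemma image_eq_of_mapsTo {X Y : Type*} {f : X → Y} {g : Y → X} {s : Set X} {t : Set Y}
    (hfg : Function.RightInverse g f) (h1 : ∀ x ∈ s, f x ∈ t) (h2 : ∀ y ∈ t, g y ∈ s) :
    f '' s = t := by
  ext y
  constructor
  · rintro ⟨x, hx, rfl⟩
    exact h1 x hx
  · exact fun hy => ⟨g y, h2 y hy, hfg y⟩

variable (hF : IsGlued L L' a d a' d' ψ F) (hG : IsGlued L' L a' d' a d ψ' G)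
  (S : IsSectorMap L L' ψ) (S' : IsSectorMap L' L ψ') (M : IsHexModel L v a d)
  (M' : IsHexModel L' w a' d') (hFG : Function.RightInverse G F)

include hF hG M M' hFG

lemma IsGlued.image_longSide (i : Fin 3) : F '' longSide v i = longSide w i :=
  image_eq_of_mapsTo hFG
    (fun z hz => (M'.mem_longSide_iff i _).mpr
      (hF.foot_eq_neg M M' ((M.mem_longSide_iff i z).mp hz)))
    (fun z hz => (M.mem_longSide_iff i _).mpr
      (hG.foot_eq_neg M' M ((M'.mem_longSide_iff i z).mp hz)))

include S S'

lemma IsGlued.image_hypercycleLeaf (i : Fin 3) {t : ℝ} (ht : t ≤ L) :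
    F '' hypercycleLeaf v i t = hypercycleLeaf w i (L' / L * t) := by
  have hL := M.pos
  have hL' := M'.pos
  refine image_eq_of_mapsTo hFG (fun z hz => ?_) (fun z hz => ?_)
  · rw [M.mem_hypercycleLeaf_iff] at hz
    rw [M'.mem_hypercycleLeaf_iff, (hF.coords_of_le S M (hz.trans_le ht)).2, hz]
  · rw [M'.mem_hypercycleLeaf_iff] at hz
    rw [M.mem_hypercycleLeaf_iff,
      (hG.coords_of_le S' M' (hz.trans_le (div_mul_le_of_le hL hL' ht))).2, hz]
    field_simp

lemma IsGlued.image_shortSide (i : Fin 3) : F '' shortSide v i = shortSide w i := by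
  have h := hF.image_hypercycleLeaf hG S S' M M' hFG i M.pos.le
  rw [mul_zero] at h
  have h1 : shortSide v i = hypercycleLeaf v i 0 := by
    ext z
    rw [M.mem_shortSide_iff, M.mem_hypercycleLeaf_iff]
  have h2 : shortSide w i = hypercycleLeaf w i 0 := by
    ext z
    rw [M'.mem_shortSide_iff, M'.mem_hypercycleLeaf_iff]
  rw [h1, h2, h]

lemma IsGlued.image_foliatedPart (i : Fin 3) : F '' foliatedPart v i = foliatedPart w i := by
  have hL := M.pos
  have hL' := M'.pos
  refine image_eq_of_mapsTo hFG (fun z hz => ?_) (fun z hz => ?_)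
  · rw [M.mem_foliatedPart_iff] at hz
    rw [M'.mem_foliatedPart_iff, (hF.coords_of_le S M hz).2]
    exact div_mul_le_of_le hL hL' hz
  · rw [M'.mem_foliatedPart_iff] at hz
    rw [M.mem_foliatedPart_iff, (hG.coords_of_le S' M' hz).2]
    exact div_mul_le_of_le hL' hL hz

lemma IsGlued.image_geodesicLeaf (i : Fin 3) {p p' : UpperHalfPlane} (hp : p ∈ shortEdge v i)
    (hp' : p' ∈ shortEdge w i) (h : a' i p' = shortRatio L L' * a i p) :
    F '' geodesicLeaf v i p = geodesicLeaf w i p' := by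
  have hL := M.pos
  have hL' := M'.pos
  refine image_eq_of_mapsTo hFG (fun z hz => ?_) (fun z hz => ?_)
  · rw [M.mem_geodesicLeaf_iff i hp] at hz
    obtain ⟨h1, h2⟩ := hF.coords_of_le S M hz.1
    rw [M'.mem_geodesicLeaf_iff i hp', h2, h1, h, hz.2]
    exact ⟨div_mul_le_of_le hL hL' hz.1, rfl⟩
  · rw [M'.mem_geodesicLeaf_iff i hp'] at hz
    obtain ⟨h1, h2⟩ := hG.coords_of_le S' M' hz.1
    rw [M.mem_geodesicLeaf_iff i hp, h2, h1, hz.2, h, shortRatio_mul_cancel hL hL']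
    exact ⟨div_mul_le_of_le hL' hL hz.1, rfl⟩

lemma IsGlued.preservesHypercycles : PreservesHypercycles v w F := by
  intro i t ht
  have hL := M.pos
  have hL' := M'.pos
  rw [M.halfLong_eq] at ht
  refine ⟨L' / L * t, ?_, hF.image_hypercycleLeaf hG S S' M M' hFG i ht.2⟩
  rw [M'.halfLong_eq]
  have := ht.1
  exact ⟨by positivity, div_mul_le_of_le hL hL' ht.2⟩

lemma IsGlued.preservesGeodesics : PreservesGeodesics v w F := by
  intro i p hp
  have hr := shortRatio_pos M.pos M'.pos
  obtain ⟨p', h1, h2⟩ := M'.surj i (shortRatio L L' * a i p) 0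
  have hp' : p' ∈ shortEdge w i := by
    rw [M'.mem_shortEdge_iff, h1, abs_mul, abs_of_pos hr, ← shortRatio_mul_halfShort M.pos]
    have := ((M.mem_shortEdge_iff i p).mp hp).2
    exact ⟨h2, by gcongr⟩
  exact ⟨p', hp', hF.image_geodesicLeaf hG S S' M M' hFG i hp hp' h1⟩

lemma IsGlued.isLeafwiseStretch {k : ℝ} (hk : L' = k * L) : IsLeafwiseStretch k v w F := by
  have hL := M.pos
  constructor
  · intro i z hz
    rw [M.mem_foliatedPart_iff] at hz
    rw [M'.infDist_eq, M.infDist_eq, (hF.coords_of_le S M hz).2, hk]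
    field_simp
  · intro i p p' hpp z hz
    have hl := halfShort_pos M.pos
    obtain ⟨e1, e2⟩ := (M.mem_shortEdge_iff i p).mp hpp.mem
    obtain ⟨e1', e2'⟩ := (M'.mem_shortEdge_iff i p').mp hpp.mem'
    have h := hpp.dist_eq
    rw [M.shortLength_eq, M'.shortLength_eq, M.dist_of_dist_eq_zero i (M.first i).2 e1,
      M'.dist_of_dist_eq_zero i (M'.first i).2 e1', (M.first i).1, (M'.first i).1,
      abs_of_nonpos (by linarith [(abs_le.mp e2').1]),
      abs_of_nonpos (by linarith [(abs_le.mp e2).1])] at h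
    have h' : a' i p' = shortRatio L L' * a i p := by
      rw [shortRatio]
      field_simp at h ⊢
      linarith
    rw [← hF.image_geodesicLeaf hG S S' M M' hFG i hpp.mem hpp.mem' h']
    exact ⟨z, hz, rfl⟩

end Leaves

end Gluing

/-! ### Elementary inequalities for hyperbolic functions -/

lemma nonneg_of_hasDerivAt {f f' : ℝ → ℝ} (h : ∀ x, HasDerivAt f (f' x) x)
    (h0 : 0 ≤ f 0) (hf' : ∀ x, 0 < x → 0 ≤ f' x) {x : ℝ} (hx : 0 ≤ x) : 0 ≤ f x := by
  have hm : MonotoneOn f (Set.Ici 0) := by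
    apply monotoneOn_of_deriv_nonneg (convex_Ici 0)
    · exact fun y _ => (h y).continuousAt.continuousWithinAt
    · exact fun y _ => (h y).differentiableAt.differentiableWithinAt
    · intro y hy
      rw [interior_Ici] at hy
      rw [(h y).deriv]
      exact hf' y hy
  exact h0.trans (hm Set.self_mem_Ici hx hx)

lemma self_le_sinh {x : ℝ} (hx : 0 ≤ x) : x ≤ Real.sinh x := Real.self_le_sinh_iff.mpr hx

lemma sinh_le_self_mul_cosh {x : ℝ} (hx : 0 ≤ x) : Real.sinh x ≤ x * Real.cosh x := by
  have h := nonneg_of_hasDerivAt (f := fun y => y * Real.cosh y - Real.sinh y)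
    (f' := fun y => y * Real.sinh y) (fun y => by
      have := ((hasDerivAt_id y).mul (Real.hasDerivAt_cosh y)).sub (Real.hasDerivAt_sinh y)
      exact this.congr_deriv (by simp)) (by simp) (fun y hy => mul_nonneg hy.le (Real.sinh_nonneg_iff.mpr hy.le)) hx
  linarith

lemma self_mul_cosh_le {x : ℝ} (hx : 0 ≤ x) :
    x * Real.cosh x ≤ (1 + x ^ 2 / 3) * Real.sinh x := by
  have h := nonneg_of_hasDerivAt
    (f := fun y => (1 + y ^ 2 / 3) * Real.sinh y - y * Real.cosh y)
    (f' := fun y => y / 3 * (y * Real.cosh y - Real.sinh y)) (fun y => by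
      have := ((((hasDerivAt_pow 2 y).div_const 3).const_add 1).mul
        (Real.hasDerivAt_sinh y)).sub ((hasDerivAt_id y).mul (Real.hasDerivAt_cosh y))
      exact this.congr_deriv (by simp; ring)) (by simp) (fun y hy => mul_nonneg (by positivity)
        (sub_nonneg.mpr (sinh_le_self_mul_cosh hy.le))) hx
  linarith

lemma one_add_sq_le_cosh (x : ℝ) : 1 + x ^ 2 / 2 ≤ Real.cosh x := by
  have h1 : Real.cosh x = 1 + 2 * Real.sinh (x / 2) ^ 2 := by
    have := Real.cosh_two_mul (x / 2)
    rw [show 2 * (x / 2) = x by ring] at this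
    rw [this, Real.cosh_sq]
    ring
  have h2 : (x / 2) ^ 2 ≤ Real.sinh (x / 2) ^ 2 := by
    rw [← sq_abs (x / 2), ← sq_abs (Real.sinh (x / 2)), Real.abs_sinh]
    have := self_le_sinh (abs_nonneg (x / 2))
    gcongr
  rw [h1]
  linarith

lemma add_cube_le_sinh {x : ℝ} (hx : 0 ≤ x) : x + x ^ 3 / 6 ≤ Real.sinh x := by
  have h := nonneg_of_hasDerivAt (f := fun y => Real.sinh y - (y + y ^ 3 / 6))
    (f' := fun y => Real.cosh y - (1 + y ^ 2 / 2)) (fun y => by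
      have := (Real.hasDerivAt_sinh y).sub
        ((hasDerivAt_id y).add ((hasDerivAt_pow 3 y).div_const 6))
      exact this.congr_deriv (by simp; ring)) (by simp) (fun y _ => sub_nonneg.mpr (one_add_sq_le_cosh y)) hx
  linarith

lemma self_mul_cosh_le_of_one_le {x : ℝ} (hx : 1 ≤ x) :
    x * Real.cosh x ≤ (x + 1 / 2) * Real.sinh x := by
  have h1 := Real.quadratic_le_exp_of_nonneg (x := 2 * x) (by linarith)
  have h2 : Real.exp (2 * x) = Real.exp x * Real.exp x := by rw [← Real.exp_add]; ring_nf
  have h3 : Real.exp x * Real.exp (-x) = 1 := by rw [← Real.exp_add]; simp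
  have h4 := Real.exp_pos (-x)
  rw [Real.cosh_eq, Real.sinh_eq]
  have h5 : 4 * x ≤ Real.exp x * Real.exp x - 1 := by rw [← h2]; nlinarith
  have h6 : 4 * x * Real.exp (-x) ≤ Real.exp x - Real.exp (-x) := by
    calc 4 * x * Real.exp (-x) ≤ (Real.exp x * Real.exp x - 1) * Real.exp (-x) := by gcongr
      _ = Real.exp x * (Real.exp x * Real.exp (-x)) - Real.exp (-x) := by ring
      _ = Real.exp x - Real.exp (-x) := by rw [h3, mul_one]
  linarith

lemma sinh_sq_mul_le {x y : ℝ} (hx : 0 ≤ x) (hxy : x ≤ y) :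
    Real.sinh x ^ 2 * (1 + 2 * (y - x)) ≤ Real.sinh y ^ 2 := by
  have h0 := Real.sinh_nonneg_iff.mpr hx
  have h1 : Real.sinh x * Real.exp (y - x) ≤ Real.sinh y := by
    have h2 : Real.sinh y = Real.sinh x * Real.cosh (y - x) + Real.cosh x * Real.sinh (y - x) := by
      rw [← Real.sinh_add]; ring_nf
    have h3 : 0 ≤ Real.sinh (y - x) := Real.sinh_nonneg_iff.mpr (by linarith)
    have h4 := (Real.sinh_lt_cosh x).le
    rw [h2, ← Real.cosh_add_sinh (y - x)]
    nlinarith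
  have h5 : 1 + 2 * (y - x) ≤ Real.exp (y - x) ^ 2 := by
    rw [← Real.exp_nat_mul]
    have := Real.add_one_le_exp (2 * (y - x))
    push_cast
    linarith
  calc Real.sinh x ^ 2 * (1 + 2 * (y - x)) ≤ Real.sinh x ^ 2 * Real.exp (y - x) ^ 2 := by gcongr
    _ = (Real.sinh x * Real.exp (y - x)) ^ 2 := by ring
    _ ≤ Real.sinh y ^ 2 := by gcongr

/-- The inequality behind the monotonicity of the vertical stretch, with
`q = (sinh x / (2 sinh l))²`. -/
lemma hexagon_inequality {x l : ℝ} (hx : 0 < x) (hxl : x ≤ l) {q : ℝ}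
    (hq : q * (4 * Real.sinh l ^ 2) = Real.sinh x ^ 2) :
    2 * (l * Real.cosh l / Real.sinh l) / (1 + 4 * Real.sinh l ^ 2) +
      2 * q / (1 - q) * (l * Real.cosh l / Real.sinh l - x * Real.cosh x / Real.sinh x) ≤
    x * Real.cosh x / Real.sinh x + x / (Real.sinh x * Real.cosh x) -
      1 / 6 * (1 - x / (Real.sinh x * Real.cosh x)) := by
  have hl : 0 < l := hx.trans_le hxl
  have hsx := Real.sinh_pos_iff.mpr hx
  have hsl := Real.sinh_pos_iff.mpr hl
  have hcx := Real.cosh_pos x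
  have hcx2 := Real.cosh_sq x
  have hsle : Real.sinh x ≤ Real.sinh l := Real.sinh_le_sinh.mpr hxl
  have hq0 : 0 ≤ q := by
    by_contra hneg
    have : q * (4 * Real.sinh l ^ 2) < 0 := mul_neg_of_neg_of_pos (not_le.mp hneg) (by positivity)
    nlinarith
  -- This is where `x ≤ l` keeps `1 - q` away from zero.
  have hq1 : q ≤ 1 / 4 := by
    have h1 : Real.sinh x ^ 2 ≤ Real.sinh l ^ 2 := by gcongr
    have h2 : 0 < Real.sinh l ^ 2 := by positivity
    by_contra hcon
    nlinarith [not_le.mp hcon]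
  have hq2 : 0 ≤ 2 * q / (1 - q) := div_nonneg (by linarith) (by linarith)
  have hq3 : 2 * q / (1 - q) ≤ 8 / 3 * q := by
    rw [div_le_iff₀ (by linarith)]
    nlinarith
  have hξ1 : 1 ≤ x * Real.cosh x / Real.sinh x := by
    rw [le_div_iff₀ hsx, one_mul]
    exact sinh_le_self_mul_cosh hx.le
  have hr0 : 0 < x / (Real.sinh x * Real.cosh x) := by positivity
  set η := l * Real.cosh l / Real.sinh l with hη
  set ξ := x * Real.cosh x / Real.sinh x with hξ
  set r := x / (Real.sinh x * Real.cosh x) with hr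
  have hη0 : 0 < η := by have := Real.cosh_pos l; positivity
  -- For `l ≤ 1` the common bound between the two sides is `2 - (7/6) l²`. For `l ≥ 1` it is `5/6`:
  -- the two terms on the left are at most `1/2` and `1/3`.
  rcases le_total l 1 with h1 | h1
  · have e1 : η ≤ 1 + l ^ 2 / 3 := by
      rw [hη, div_le_iff₀ hsl]
      exact self_mul_cosh_le hl.le
    have e2 : 1 - l ^ 2 ≤ r := by
      have hx2 : x ^ 2 ≤ l ^ 2 := by gcongr
      have h2 : 1 / Real.cosh x ^ 2 ≤ r := by
        rw [hr, div_le_div_iff₀ (by positivity) (by positivity)]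
        nlinarith [sinh_le_self_mul_cosh hx.le]
      have h3 : 1 - x ^ 2 ≤ 1 / Real.cosh x ^ 2 := by
        rw [le_div_iff₀ (by positivity)]
        have : Real.sinh x ^ 2 ≤ (x * Real.cosh x) ^ 2 := by
          have := sinh_le_self_mul_cosh hx.le
          gcongr
        nlinarith
      linarith
    have e3 : 2 * η / (1 + 4 * Real.sinh l ^ 2) ≤ 2 * (1 + l ^ 2 / 3) / (1 + 4 * l ^ 2) := by
      have := self_le_sinh hl.le
      gcongr
    have e4 : 2 * q / (1 - q) * (η - ξ) ≤ 2 / 3 * (l ^ 2 / 3) := by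
      have h2 : 2 * q / (1 - q) ≤ 2 / 3 := by linarith
      calc 2 * q / (1 - q) * (η - ξ) ≤ 2 * q / (1 - q) * (l ^ 2 / 3) := by
            gcongr; linarith
        _ ≤ 2 / 3 * (l ^ 2 / 3) := by gcongr
    have e5 : 2 * (1 + l ^ 2 / 3) / (1 + 4 * l ^ 2) ≤ 2 - 25 / 18 * l ^ 2 := by
      rw [div_le_iff₀ (by positivity)]
      have : l ^ 2 ≤ 1 := by nlinarith
      nlinarith [sq_nonneg l, mul_nonneg (sq_nonneg l) (sub_nonneg.mpr this)]
    linarith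
  · have e1 : η ≤ l + 1 / 2 := by
      rw [hη, div_le_iff₀ hsl]
      exact self_mul_cosh_le_of_one_le h1
    have e2 : x ≤ ξ := by
      rw [hξ, le_div_iff₀ hsx]
      have := (Real.sinh_lt_cosh x).le
      gcongr
    have e3 : 2 * η / (1 + 4 * Real.sinh l ^ 2) ≤ 1 / 2 := by
      rw [div_le_iff₀ (by positivity)]
      have h2 := add_cube_le_sinh hl.le
      have h3 : (l + l ^ 3 / 6) ^ 2 ≤ Real.sinh l ^ 2 := by gcongr
      have h4 : l ^ 2 + l ^ 4 / 3 ≤ Real.sinh l ^ 2 := by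
        nlinarith [sq_nonneg (l ^ 3)]
      have h5 : 1 ≤ l ^ 4 := one_le_pow₀ h1
      nlinarith
    have e4 : 2 * q / (1 - q) * (η - ξ) ≤ 1 / 3 := by
      have h2 := sinh_sq_mul_le hx.le hxl
      have h3 : q * (1 + 2 * (l - x)) ≤ 1 / 4 := by
        have h4 : 0 < 4 * Real.sinh l ^ 2 := by positivity
        rw [← mul_le_mul_iff_left₀ h4]
        nlinarith
      have h5 : 0 ≤ l + 1 / 2 - x := by linarith
      calc 2 * q / (1 - q) * (η - ξ) ≤ 2 * q / (1 - q) * (l + 1 / 2 - x) := by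
            gcongr
        _ ≤ 8 / 3 * q * (l + 1 / 2 - x) := by gcongr
        _ ≤ 1 / 3 := by linarith
    linarith

/-! ### Monotonicity of the vertical stretch -/

lemma mul_sinh_mul_cosh_le {c y : ℝ} (hc : 0 ≤ c) (hc1 : c ≤ 1) (hy : 0 ≤ y) :
    c * Real.sinh y * Real.cosh (c * y) ≤ Real.sinh (c * y) * Real.cosh y := by
  have h := nonneg_of_hasDerivAt
    (f := fun y => Real.sinh (c * y) * Real.cosh y - c * Real.sinh y * Real.cosh (c * y))
    (f' := fun y => (1 - c ^ 2) * (Real.sinh y * Real.sinh (c * y))) (fun y => by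
      have h1 : HasDerivAt (fun y => c * y) c y := by
        simpa using (hasDerivAt_id y).const_mul c
      have := (h1.sinh.mul (Real.hasDerivAt_cosh y)).sub
        (((Real.hasDerivAt_sinh y).const_mul c).mul h1.cosh)
      exact this.congr_deriv (by ring)) (by simp) (fun y hy => mul_nonneg (by nlinarith)
        (mul_nonneg (Real.sinh_nonneg_iff.mpr hy.le)
          (Real.sinh_nonneg_iff.mpr (mul_nonneg hc hy.le)))) hy
  linarith

/-- The sign of the derivative is `mul_sinh_mul_cosh_le`, which says that `tanh (c y) / (c y)`
dominates `tanh y / y`. -/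
lemma sinh_mul_div_antitone {c y z : ℝ} (hc : 0 ≤ c) (hc1 : c ≤ 1) (hy : 0 < y) (hyz : y ≤ z) :
    Real.sinh (c * z) / Real.sinh z ≤ Real.sinh (c * y) / Real.sinh y := by
  have hd : ∀ y : ℝ, 0 < y → HasDerivAt (fun y => Real.sinh (c * y) / Real.sinh y)
      ((c * Real.sinh y * Real.cosh (c * y) - Real.sinh (c * y) * Real.cosh y) /
        Real.sinh y ^ 2) y := fun y hy => by
    have h1 : HasDerivAt (fun y => c * y) c y := by
      simpa using (hasDerivAt_id y).const_mul c
    exact (h1.sinh.div (Real.hasDerivAt_sinh y) (Real.sinh_pos_iff.mpr hy).ne').congr_deriv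
      (by ring)
  have hm : AntitoneOn (fun y => Real.sinh (c * y) / Real.sinh y) (Set.Ioi 0) := by
    apply antitoneOn_of_deriv_nonpos (convex_Ioi 0)
    · exact fun y hy => (hd y hy).continuousAt.continuousWithinAt
    · intro y hy
      rw [interior_Ioi] at hy
      exact (hd y hy).differentiableAt.differentiableWithinAt
    · intro y hy
      rw [interior_Ioi] at hy
      rw [(hd y hy).deriv]
      exact div_nonpos_of_nonpos_of_nonneg
        (sub_nonpos.mpr (mul_sinh_mul_cosh_le hc hc1 (le_of_lt hy))) (sq_nonneg _)
  exact hm hy (hy.trans_le hyz) hyz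

lemma hasDerivAt_halfShort {L : ℝ} (hL : 0 < L) : HasDerivAt halfShort
    (-(Real.sinh (halfShort L) / Real.cosh (halfShort L) * (Real.cosh L / Real.sinh L))) L := by
  have hs := Real.sinh_pos_iff.mpr hL
  have h1 : HasDerivAt (fun L => 1 / (2 * Real.sinh L))
      (-(2 * Real.cosh L) / (2 * Real.sinh L) ^ 2) L :=
    ((hasDerivAt_const L (1 : ℝ)).div ((Real.hasDerivAt_sinh L).const_mul 2)
      (by positivity)).congr_deriv (by simp)
  have h2 := h1.arsinh
  refine h2.congr_deriv ?_
  have h3 : Real.sqrt (1 + (1 / (2 * Real.sinh L)) ^ 2) = Real.cosh (halfShort L) := by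
    rw [halfShort, Real.cosh_arsinh]
  have h4 : Real.sinh (halfShort L) = 1 / (2 * Real.sinh L) := by
    rw [halfShort, Real.sinh_arsinh]
  have := Real.cosh_pos (halfShort L)
  rw [h3, h4, smul_eq_mul]
  field_simp

lemma sinh_mul_sinh_le_half {L x : ℝ} (hL : 0 < L) (hx : x ≤ halfShort L) :
    Real.sinh L * Real.sinh x ≤ 1 / 2 := by
  have h1 := Real.sinh_pos_iff.mpr hL
  rw [← sinh_mul_sinh_halfShort hL]
  have := Real.sinh_le_sinh.mpr hx
  gcongr

/-- The logarithm of the function whose monotonicity controls the vertical stretch. -/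
def logRate (c L : ℝ) : ℝ :=
  Real.log (Real.sinh L) + Real.log (Real.cosh L) - Real.log L +
    2 * Real.log (Real.sinh (c * halfShort L)) - Real.log (Real.cosh (c * halfShort L)) -
    Real.log (1 - Real.sinh L ^ 2 * Real.sinh (c * halfShort L) ^ 2) +
    1 / 6 * (Real.log (Real.sinh (c * halfShort L)) - Real.log (Real.cosh (c * halfShort L)) -
      Real.log (c * halfShort L))

lemma one_sub_sinh_sq_pos {L x : ℝ} (hL : 0 < L) (hx : 0 ≤ x) (hxl : x ≤ halfShort L) :
    0 < 1 - Real.sinh L ^ 2 * Real.sinh x ^ 2 := by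
  have h1 := Real.sinh_pos_iff.mpr hL
  have h2 := Real.sinh_nonneg_iff.mpr hx
  have h3 := sinh_mul_sinh_le_half hL hxl
  nlinarith [mul_nonneg h1.le h2]

/-- Differentiating at fixed `x / l`, with `dl/dL = -tanh l * coth L`, and factoring out `coth L`,
one is left with `hexagon_inequality` multiplied by `tanh l / l`. The term `1/6` of that inequality
comes from the factor `tanh x / x` in the rate. -/
lemma logRate_deriv_nonpos {c L : ℝ} (hc : 0 < c) (hc1 : c ≤ 1) (hL : 0 < L) :
    ∃ D ≤ 0, HasDerivAt (logRate c) D L := by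
  have hl := halfShort_pos hL
  have hs := Real.sinh_pos_iff.mpr hL
  have hC := Real.cosh_pos L
  have hx : 0 < c * halfShort L := mul_pos hc hl
  have hxl : c * halfShort L ≤ halfShort L := by nlinarith
  have hsl := Real.sinh_pos_iff.mpr hl
  have hcl := Real.cosh_pos (halfShort L)
  have hsx := Real.sinh_pos_iff.mpr hx
  have hcx := Real.cosh_pos (c * halfShort L)
  have hq := one_sub_sinh_sq_pos hL hx.le hxl
  have dx : HasDerivAt (fun L => c * halfShort L) _ L := (hasDerivAt_halfShort hL).const_mul c
  have d1 := (Real.hasDerivAt_sinh L).log hs.ne'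
  have d2 := (Real.hasDerivAt_cosh L).log hC.ne'
  have d3 := Real.hasDerivAt_log hL.ne'
  have d4 := dx.sinh.log hsx.ne'
  have d5 := dx.cosh.log hcx.ne'
  have d6 := ((((Real.hasDerivAt_sinh L).pow 2).mul (dx.sinh.pow 2)).const_sub 1).log hq.ne'
  have d7 := dx.log hx.ne'
  have hd := (((((d1.add d2).sub d3).add (d4.const_mul 2)).sub d5).sub d6).add
    (((d4.sub d5).sub d7).const_mul (1 / 6))
  refine ⟨_, ?_, hd⟩
  have key := hexagon_inequality hx hxl (q := Real.sinh L ^ 2 * Real.sinh (c * halfShort L) ^ 2)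
    (by
      have := sinh_mul_sinh_halfShort hL
      calc _ = 4 * (Real.sinh L * Real.sinh (halfShort L)) ^ 2 *
            Real.sinh (c * halfShort L) ^ 2 := by ring
        _ = _ := by rw [this]; ring)
  -- Removes the term `1 / L`: it gives `1 + tanh² L - tanh L / L ≤ 2 tanh² L`, and `tanh² L` is
  -- then expressed through `sinh l`.
  have hLσ : 1 - (Real.sinh L / Real.cosh L) ^ 2 ≤ Real.sinh L / Real.cosh L / L := by
    have h1 : L ≤ Real.sinh L * Real.cosh L :=
      (self_le_sinh hL.le).trans (le_mul_of_one_le_right hs.le (Real.one_le_cosh L))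
    have h2 : 1 - (Real.sinh L / Real.cosh L) ^ 2 = 1 / Real.cosh L ^ 2 := by
      field_simp
      rw [Real.cosh_sq]; ring
    rw [h2, div_div, div_le_div_iff₀ (by positivity) (by positivity)]
    nlinarith
  have hτ : (Real.sinh L / Real.cosh L) ^ 2 = 1 / (1 + 4 * Real.sinh (halfShort L) ^ 2) := by
    rw [sinh_halfShort, div_pow, Real.cosh_sq]
    field_simp
    ring
  have hy : 0 < Real.sinh (halfShort L) / (halfShort L * Real.cosh (halfShort L)) := by positivity
  have hr : c * halfShort L / (Real.sinh (c * halfShort L) * Real.cosh (c * halfShort L)) =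
      c * halfShort L * Real.cosh (c * halfShort L) / Real.sinh (c * halfShort L) -
      c * halfShort L * Real.sinh (c * halfShort L) / Real.cosh (c * halfShort L) := by
    field_simp
    rw [Real.cosh_sq]; ring
  have key2 := mul_le_mul_of_nonneg_left key hy.le
  rw [hr] at key2
  have goal : Real.cosh L / Real.sinh L *
      (1 + (Real.sinh L / Real.cosh L) ^ 2 - Real.sinh L / Real.cosh L / L -
        Real.sinh (halfShort L) / (halfShort L * Real.cosh (halfShort L)) *
        (2 * (c * halfShort L * Real.cosh (c * halfShort L) / Real.sinh (c * halfShort L)) -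
        c * halfShort L * Real.sinh (c * halfShort L) / Real.cosh (c * halfShort L) +
        1 / 6 * (c * halfShort L * Real.cosh (c * halfShort L) / Real.sinh (c * halfShort L) -
        c * halfShort L * Real.sinh (c * halfShort L) / Real.cosh (c * halfShort L) - 1)) +
        2 * (Real.sinh L ^ 2 * Real.sinh (c * halfShort L) ^ 2) /
          (1 - Real.sinh L ^ 2 * Real.sinh (c * halfShort L) ^ 2) *
          (1 - Real.sinh (halfShort L) / (halfShort L * Real.cosh (halfShort L)) *
            (c * halfShort L * Real.cosh (c * halfShort L) / Real.sinh (c * halfShort L)))) ≤ 0 := by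
    apply mul_nonpos_of_nonneg_of_nonpos (by positivity)
    have e1 : Real.sinh (halfShort L) / (halfShort L * Real.cosh (halfShort L)) *
        (halfShort L * Real.cosh (halfShort L) / Real.sinh (halfShort L)) = 1 := by
      field_simp
    have e2 : (Real.sinh L / Real.cosh L) ^ 2 = Real.sinh (halfShort L) / (halfShort L *
        Real.cosh (halfShort L)) * ((halfShort L * Real.cosh (halfShort L) /
        Real.sinh (halfShort L)) / (1 + 4 * Real.sinh (halfShort L) ^ 2)) := by
      rw [hτ, ← mul_div_assoc, e1]
    generalize Real.sinh (halfShort L) / (halfShort L * Real.cosh (halfShort L)) = y at *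
    generalize halfShort L * Real.cosh (halfShort L) / Real.sinh (halfShort L) = η at *
    generalize 2 * (Real.sinh L ^ 2 * Real.sinh (c * halfShort L) ^ 2) /
          (1 - Real.sinh L ^ 2 * Real.sinh (c * halfShort L) ^ 2) = Q at *
    rw [mul_div_assoc] at key2
    have e3 : y * (Q * η) = Q := by rw [mul_left_comm, e1, mul_one]
    linarith
  refine le_of_eq_of_le ?_ goal
  simp only [Pi.pow_apply, Pi.mul_apply]
  push_cast
  generalize 1 - Real.sinh L ^ 2 * Real.sinh (c * halfShort L) ^ 2 = V at *
  field_simp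
  ring

/-! ### The quadratic form of the stretch -/

/-- The vertical stretch of the sector map from the hexagon of half long edge `L` to the one of half
long edge `L'`, at a point that is equidistant from two short edges, is the quotient of the values
of this function. -/
def stretchRate (L x : ℝ) : ℝ :=
  Real.sinh L * Real.cosh L * Real.sinh x ^ 2 /
    (L * Real.cosh x * (1 - Real.sinh L ^ 2 * Real.sinh x ^ 2))

lemma stretchRate_pos {L x : ℝ} (hL : 0 < L) (hx : 0 < x) (hxl : x ≤ halfShort L) :
    0 < stretchRate L x := by
  have := Real.sinh_pos_iff.mpr hL
  have := Real.sinh_pos_iff.mpr hx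
  have := one_sub_sinh_sq_pos hL hx.le hxl
  have := Real.cosh_pos L
  have := Real.cosh_pos x
  unfold stretchRate
  positivity

/-- Clears the exponent `1/6`, so that the monotone quantity is `stretchRate ^ 6 * tanh x / x`. -/
lemma six_mul_logRate {c L : ℝ} (hc : 0 < c) (hc1 : c ≤ 1) (hL : 0 < L) :
    6 * logRate c L = Real.log (stretchRate L (c * halfShort L) ^ 6 *
      (Real.sinh (c * halfShort L) / (Real.cosh (c * halfShort L) * (c * halfShort L)))) := by
  have hl := halfShort_pos hL
  have hs := Real.sinh_pos_iff.mpr hL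
  have hC := Real.cosh_pos L
  have hx : 0 < c * halfShort L := mul_pos hc hl
  have hxl : c * halfShort L ≤ halfShort L := by nlinarith
  have hsx := Real.sinh_pos_iff.mpr hx
  have hcx := Real.cosh_pos (c * halfShort L)
  have hq := one_sub_sinh_sq_pos hL hx.le hxl
  have hY := stretchRate_pos hL hx hxl
  rw [Real.log_mul (pow_pos hY 6).ne' (by positivity), Real.log_pow,
    Real.log_div hsx.ne' (by positivity), Real.log_mul hcx.ne' hx.ne', stretchRate,
    Real.log_div (by positivity) (by positivity), Real.log_mul (by positivity) (by positivity),
    Real.log_mul (by positivity) (by positivity), Real.log_mul (by positivity) hq.ne',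
    Real.log_mul hL.ne' hcx.ne', Real.log_pow, logRate]
  push_cast
  ring

lemma logRate_antitoneOn {c : ℝ} (hc : 0 < c) (hc1 : c ≤ 1) :
    AntitoneOn (logRate c) (Set.Ioi 0) := by
  apply antitoneOn_of_deriv_nonpos (convex_Ioi 0)
  · intro y hy
    obtain ⟨D, -, hD⟩ := logRate_deriv_nonpos hc hc1 hy
    exact hD.continuousAt.continuousWithinAt
  · intro y hy
    rw [interior_Ioi] at hy
    obtain ⟨D, -, hD⟩ := logRate_deriv_nonpos hc hc1 hy
    exact hD.differentiableAt.differentiableWithinAt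
  · intro y hy
    rw [interior_Ioi] at hy
    obtain ⟨D, h, hD⟩ := logRate_deriv_nonpos hc hc1 hy
    rwa [hD.deriv]

/-- Monotonicity in `L` along a fixed relative position `c = x / l`; the sector map preserves this
position. -/
lemma stretchRate_pow_mul_le {L L' x : ℝ} (hL : 0 < L) (hLL' : L ≤ L') (hx : 0 < x)
    (hxl : x ≤ halfShort L) :
    stretchRate L' (shortRatio L L' * x) ^ 6 * (Real.sinh (shortRatio L L' * x) /
      (Real.cosh (shortRatio L L' * x) * (shortRatio L L' * x))) ≤
    stretchRate L x ^ 6 * (Real.sinh x / (Real.cosh x * x)) := by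
  have hL' := hL.trans_le hLL'
  have hl := halfShort_pos hL
  have hl' := halfShort_pos hL'
  have hc : 0 < x / halfShort L := by positivity
  have hc1 : x / halfShort L ≤ 1 := (div_le_one hl).mpr hxl
  have h := logRate_antitoneOn hc hc1 (Set.mem_Ioi.mpr hL) (Set.mem_Ioi.mpr hL') hLL'
  have e1 : x / halfShort L * halfShort L = x := by field_simp
  have e2 : x / halfShort L * halfShort L' = shortRatio L L' * x := by
    rw [shortRatio]; ring
  have h6 := mul_le_mul_of_nonneg_left h (by norm_num : (0 : ℝ) ≤ 6)
  have hx' : 0 < shortRatio L L' * x := mul_pos (shortRatio_pos hL hL') hx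
  have hxl' : shortRatio L L' * x ≤ halfShort L' := by
    rw [← shortRatio_mul_halfShort hL]
    have := shortRatio_pos hL hL'
    gcongr
  rw [six_mul_logRate hc hc1 hL, six_mul_logRate hc hc1 hL', e1, e2] at h6
  have p1 := stretchRate_pos hL hx hxl
  have p2 := stretchRate_pos hL' hx' hxl'
  have := Real.sinh_pos_iff.mpr hx
  have := Real.sinh_pos_iff.mpr hx'
  have := Real.cosh_pos x
  have := Real.cosh_pos (shortRatio L L' * x)
  exact (Real.log_le_log_iff (by positivity) (by positivity)).mp h6

/-- A rational bound for the cube root `t^(-1/3)`: the difference `27 t (t + 1)³ - (4 t + 2)³` has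
the factor `t - 1` with a positive cofactor. -/
lemma le_of_pow_mul_le_one {b t : ℝ} (ht : 1 ≤ t) (h : b ^ 3 * t ≤ 1) :
    b * (4 * t + 2) ≤ 3 * (t + 1) := by
  by_contra hcon
  have h1 : (3 * (t + 1)) ^ 3 < (b * (4 * t + 2)) ^ 3 := by
    have := not_le.mp hcon
    gcongr
  have h2 : (b * (4 * t + 2)) ^ 3 * t ≤ (4 * t + 2) ^ 3 := by
    calc (b * (4 * t + 2)) ^ 3 * t = (b ^ 3 * t) * (4 * t + 2) ^ 3 := by ring
      _ ≤ 1 * (4 * t + 2) ^ 3 := by gcongr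
      _ = _ := one_mul _
  have h3 : (3 * (t + 1)) ^ 3 * t < (b * (4 * t + 2)) ^ 3 * t := by gcongr
  have h4 : 0 ≤ (t - 1) * (27 * t ^ 3 + 44 * t ^ 2 + 29 * t + 8) :=
    mul_nonneg (by linarith) (by positivity)
  nlinarith

/-- Here `a = A² / k²`, `b = B² / k²`, and the left side of the last inequality is `S² / k²`. The
hypothesis `b³ t ≤ 1` says more than `b ≤ 1` as soon as `t > 1`, and the shear, which vanishes at `t
= 1`, is absorbed by this surplus. -/
lemma shear_le {a b t κ : ℝ} (ha : 0 ≤ a) (ht : 1 ≤ t) (h : b ^ 3 * t ≤ 1)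
    (hab : a * t ^ 2 ≤ b) (hκ : κ ≤ 1 / 3) :
    b ≤ 1 ∧ a ≤ 1 ∧ a * κ * (t - 1) ^ 2 ≤ (1 - a) * (1 - b) := by
  have hb1 : b ≤ 1 := by
    by_contra hcon
    have h1 : (1 : ℝ) < b ^ 3 := one_lt_pow₀ (not_le.mp hcon) (by norm_num)
    nlinarith
  have ht2 : 1 ≤ t ^ 2 := one_le_pow₀ ht
  have ha1 : a ≤ 1 := by nlinarith
  refine ⟨hb1, ha1, ?_⟩
  have hg := le_of_pow_mul_le_one ht h
  have h1 : b * (t - 1) ≤ 3 * ((1 - b) * (t + 1)) := by linarith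
  have h2 : b * (t - 1) ^ 2 / 3 ≤ (1 - b) * (t ^ 2 - b) := by
    have h3 : b * (t - 1) * (t - 1) ≤ 3 * ((1 - b) * (t + 1)) * (t - 1) := by gcongr
    have h4 : (1 - b) * (t ^ 2 - 1) ≤ (1 - b) * (t ^ 2 - b) := by gcongr
    linarith
  have h3 : a * κ * (t - 1) ^ 2 ≤ a * (1 / 3) * (t - 1) ^ 2 := by gcongr
  have h4 : a * t ^ 2 * ((t - 1) ^ 2 / 3 + (1 - b)) ≤ b * ((t - 1) ^ 2 / 3 + (1 - b)) := by
    have : 0 ≤ (t - 1) ^ 2 / 3 + (1 - b) := by have := sq_nonneg (t - 1); linarith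
    gcongr
  have h5 : 0 ≤ t ^ 2 * ((1 - b) - a * ((t - 1) ^ 2 / 3 + (1 - b))) := by nlinarith
  have h6 := nonneg_of_mul_nonneg_right h5 (by positivity)
  linarith

/-- The hypotheses say that `K` times the identity minus the form has nonnegative determinant,
together with `B² ≤ K` and `A2 ≤ K`. If `B² = K`, the shear vanishes; otherwise one completes the
square in `β`. -/
lemma quadratic_le {A2 B S K α β : ℝ} (hK : 0 < K) (hA : A2 ≤ K) (hB : B ^ 2 ≤ K)
    (h : K * S ^ 2 ≤ (K - A2) * (K - B ^ 2)) :
    A2 * α ^ 2 + (S * α + B * β) ^ 2 ≤ K * (α ^ 2 + β ^ 2) := by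
  rcases hB.eq_or_lt with hB' | hB'
  · rw [hB', sub_self, mul_zero] at h
    have hS : S = 0 := by
      have : S ^ 2 ≤ 0 := by
        by_contra hc
        nlinarith [not_le.mp hc]
      exact pow_eq_zero_iff (two_ne_zero) |>.mp (le_antisymm this (sq_nonneg _))
    subst hS
    nlinarith [sq_nonneg α]
  · have h1 : 0 ≤ ((K - B ^ 2) * β - S * B * α) ^ 2 := sq_nonneg _
    have h2 : 0 ≤ ((K - A2) * (K - B ^ 2) - K * S ^ 2) * α ^ 2 :=
      mul_nonneg (by linarith) (sq_nonneg _)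
    have h3 : 0 ≤ (K - B ^ 2) * (K * (α ^ 2 + β ^ 2) - (A2 * α ^ 2 + (S * α + B * β) ^ 2)) := by
      linarith
    have := nonneg_of_mul_nonneg_right h3 (sub_pos.mpr hB')
    linarith

lemma halfShort_le_halfShort {L L' : ℝ} (hL : 0 < L) (h : L ≤ L') :
    halfShort L' ≤ halfShort L := by
  rw [← Real.sinh_le_sinh, sinh_halfShort, sinh_halfShort]
  have := Real.sinh_pos_iff.mpr hL
  have := Real.sinh_le_sinh.mpr h
  gcongr

lemma shortRatio_le_one {L L' : ℝ} (hL : 0 < L) (h : L ≤ L') : shortRatio L L' ≤ 1 :=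
  (div_le_one (halfShort_pos hL)).mpr (halfShort_le_halfShort hL h)

/-- Since `sinh L = 1 / (2 sinh l)`, the two sides are values of `sinh (c y) / sinh y` at `y = l`
and `y = l' ≤ l`, with `c = x / l`. -/
lemma sinh_mul_sinh_le_sinh_mul_sinh {L L' x : ℝ} (hL : 0 < L) (h : L ≤ L') (hx : 0 ≤ x)
    (hxl : x ≤ halfShort L) :
    Real.sinh L * Real.sinh x ≤ Real.sinh L' * Real.sinh (shortRatio L L' * x) := by
  have hl := halfShort_pos hL
  have hl' := halfShort_pos (hL.trans_le h)
  have h1 := sinh_mul_div_antitone (c := x / halfShort L) (by positivity)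
    ((div_le_one hl).mpr hxl) hl' (halfShort_le_halfShort hL h)
  have h2 := Real.sinh_pos_iff.mpr hL
  have h3 := Real.sinh_pos_iff.mpr (hL.trans_le h)
  rw [show x / halfShort L * halfShort L = x by field_simp,
    show x / halfShort L * halfShort L' = shortRatio L L' * x by rw [shortRatio]; ring,
    sinh_halfShort, sinh_halfShort, div_div_eq_mul_div, div_div_eq_mul_div, div_one, div_one] at h1
  linarith

/-- The estimate at the points that are equidistant from two short edges. -/
lemma stretch_top {L L' x : ℝ} (hL : 0 < L) (hLL' : L ≤ L') (hx : 0 < x)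
    (hxl : x ≤ halfShort L) {u m t W κ : ℝ}
    (hu : u = shortRatio L L' * (Real.cosh L' / Real.cosh L))
    (hm : m = Real.sinh L' * Real.sinh (shortRatio L L' * x) / (Real.sinh L * Real.sinh x))
    (ht : t = Real.sinh (shortRatio L L' * x) * Real.cosh x /
      (shortRatio L L' * Real.sinh x * Real.cosh (shortRatio L L' * x)))
    (hW : W = (1 - Real.sinh L ^ 2 * Real.sinh x ^ 2) /
      (1 - Real.sinh L' ^ 2 * Real.sinh (shortRatio L L' * x) ^ 2))
    (hκ : κ = Real.sinh L' ^ 2 * Real.sinh (shortRatio L L' * x) ^ 2 /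
      (1 - Real.sinh L' ^ 2 * Real.sinh (shortRatio L L' * x) ^ 2)) :
    u ≤ L' / L ∧ u ^ 2 * W ≤ (L' / L) ^ 2 ∧ (u * m * t * W) ^ 2 ≤ (L' / L) ^ 2 ∧
      (L' / L) ^ 2 * (u ^ 2 * W * κ * (t - 1) ^ 2) ≤
        ((L' / L) ^ 2 - u ^ 2 * W) * ((L' / L) ^ 2 - (u * m * t * W) ^ 2) := by
  have hL' := hL.trans_le hLL'
  have hr := shortRatio_pos hL hL'
  have hr1 := shortRatio_le_one hL hLL'
  have hx' : 0 < shortRatio L L' * x := mul_pos hr hx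
  have hxl' : shortRatio L L' * x ≤ halfShort L' := by
    rw [← shortRatio_mul_halfShort hL]
    gcongr
  have hrate := stretchRate_pow_mul_le hL hLL' hx hxl
  have hY := stretchRate_pos hL hx hxl
  have hth := mul_sinh_mul_cosh_le hr.le hr1 hx.le
  have hmm := sinh_mul_sinh_le_sinh_mul_sinh hL hLL' hx.le hxl
  have hX' := sinh_mul_sinh_le_half hL' hxl'
  have hq := one_sub_sinh_sq_pos hL hx.le hxl
  have hq' := one_sub_sinh_sq_pos hL' hx'.le hxl'
  have hs := Real.sinh_pos_iff.mpr hL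
  have hs' := Real.sinh_pos_iff.mpr hL'
  have hC := Real.cosh_pos L
  have hC' := Real.cosh_pos L'
  have hsx := Real.sinh_pos_iff.mpr hx
  have hsx' := Real.sinh_pos_iff.mpr hx'
  have hcx := Real.cosh_pos x
  have hcx' := Real.cosh_pos (shortRatio L L' * x)
  -- The vertical entry `B = u m t W` is `L' / L` times the quotient of the rates.
  have hYe : stretchRate L' (shortRatio L L' * x) * (L' / L) = stretchRate L x * (u * m * t * W) := by
    rw [stretchRate, stretchRate, hu, hm, ht, hW]
    field_simp
  have hte : Real.sinh (shortRatio L L' * x) /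
      (Real.cosh (shortRatio L L' * x) * (shortRatio L L' * x)) =
      t * (Real.sinh x / (Real.cosh x * x)) := by
    rw [ht]
    field_simp
  have hk : 0 < L' / L := by positivity
  have hu0 : 0 < u := by rw [hu]; positivity
  have hm1 : 1 ≤ m := by rw [hm, one_le_div (by positivity)]; exact hmm
  have ht1 : 1 ≤ t := by rw [ht, one_le_div (by positivity)]; exact hth
  have hW1 : 1 ≤ W := by
    rw [hW, one_le_div hq', ← mul_pow, ← mul_pow]
    gcongr
  have hκ1 : κ ≤ 1 / 3 := by
    rw [hκ, div_le_iff₀ hq', ← mul_pow]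
    have : (Real.sinh L' * Real.sinh (shortRatio L L' * x)) ^ 2 ≤ (1 / 2) ^ 2 := by gcongr
    linarith
  -- The `tanh x / x` factors contribute exactly one `t`, so monotonicity yields `(B / k)⁶ t ≤ 1`.
  have hBt : (u * m * t * W) ^ 6 * t ≤ (L' / L) ^ 6 := by
    rw [hte] at hrate
    have h1 : 0 < stretchRate L x ^ 6 * (Real.sinh x / (Real.cosh x * x)) := by positivity
    have h2 : (stretchRate L' (shortRatio L L' * x) * (L' / L)) ^ 6 *
        (t * (Real.sinh x / (Real.cosh x * x))) ≤
        stretchRate L x ^ 6 * (Real.sinh x / (Real.cosh x * x)) * (L' / L) ^ 6 := by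
      rw [mul_pow, mul_right_comm]
      gcongr
    rw [hYe] at h2
    refine le_of_mul_le_mul_left ?_ h1
    linarith
  generalize L' / L = k at *
  have hab : u ^ 2 * W / k ^ 2 * t ^ 2 ≤ (u * m * t * W) ^ 2 / k ^ 2 := by
    rw [div_mul_eq_mul_div]
    have h1 : 1 ≤ m ^ 2 * W := one_le_mul_of_one_le_of_one_le (one_le_pow₀ hm1) hW1
    have h2 : u ^ 2 * W * t ^ 2 * 1 ≤ u ^ 2 * W * t ^ 2 * (m ^ 2 * W) := by gcongr
    gcongr
    linarith
  obtain ⟨hb, ha, hS⟩ := shear_le (a := u ^ 2 * W / k ^ 2) (b := (u * m * t * W) ^ 2 / k ^ 2)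
    (t := t) (κ := κ) (by positivity) ht1 (by
      rw [div_pow, div_mul_eq_mul_div, div_le_one (by positivity)]
      calc _ = (u * m * t * W) ^ 6 * t := by ring
        _ ≤ k ^ 6 := hBt
        _ = _ := by ring) hab hκ1
  rw [div_le_one (by positivity)] at hb ha
  refine ⟨?_, ha, hb, ?_⟩
  · have h1 : u ^ 2 * 1 ≤ u ^ 2 * W := by gcongr
    exact (sq_le_sq₀ hu0.le hk.le).mp (by linarith)
  · have h1 := mul_le_mul_of_nonneg_left hS (by positivity : 0 ≤ k ^ 4)
    have e1 : k ^ 4 * (u ^ 2 * W / k ^ 2 * κ * (t - 1) ^ 2) =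
        k ^ 2 * (u ^ 2 * W * κ * (t - 1) ^ 2) := by field_simp
    have e2 : k ^ 4 * ((1 - u ^ 2 * W / k ^ 2) * (1 - (u * m * t * W) ^ 2 / k ^ 2)) =
        (k ^ 2 - u ^ 2 * W) * (k ^ 2 - (u * m * t * W) ^ 2) := by field_simp
    linarith

/-- The quantity `u` does not involve `x`, so any admissible `x` serves. -/
lemma horizontal_le {L L' : ℝ} (hL : 0 < L) (hLL' : L ≤ L') :
    shortRatio L L' * (Real.cosh L' / Real.cosh L) ≤ L' / L :=
  (stretch_top hL hLL' (halfShort_pos hL) le_rfl rfl rfl rfl rfl rfl).1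

/-- The estimate of the quadratic form of the stretch in terms of
`p = 1 - (cosh L / cosh d) ^ 2`. -/
lemma stretch_estimate {L L' x p : ℝ} (hL : 0 < L) (hLL' : L ≤ L') (hx : 0 < x)
    (hxl : x ≤ halfShort L) (hp : 0 ≤ p) (hpx : p ≤ Real.sinh L ^ 2 * Real.sinh x ^ 2) {μ p' θ : ℝ}
    (hμ : μ = (Real.sinh L' * Real.sinh (shortRatio L L' * x) / (Real.sinh L * Real.sinh x)) ^ 2)
    (hp' : p' = μ * p)
    (hθ : θ = Real.cosh x / Real.sinh x - shortRatio L L' *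
      Real.cosh (shortRatio L L' * x) / Real.sinh (shortRatio L L' * x)) :
    (shortRatio L L' * (Real.cosh L' / Real.cosh L)) ^ 2 * ((1 - p) / (1 - p')) ≤ (L' / L) ^ 2 ∧
    μ ^ 2 * (Real.cosh L' / Real.cosh L) ^ 2 * ((1 - p) / (1 - p')) ^ 2 *
      ((Real.sinh L ^ 2 + p) / (Real.sinh L' ^ 2 + p')) ≤ (L' / L) ^ 2 ∧
    (L' / L) ^ 2 * ((Real.cosh L' / Real.cosh L) ^ 2 * ((1 - p) / (1 - p')) * (p' / (1 - p')) *
      (p' / (Real.sinh L' ^ 2 + p')) * θ ^ 2) ≤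
    ((L' / L) ^ 2 - (shortRatio L L' * (Real.cosh L' / Real.cosh L)) ^ 2 * ((1 - p) / (1 - p'))) *
    ((L' / L) ^ 2 - μ ^ 2 * (Real.cosh L' / Real.cosh L) ^ 2 * ((1 - p) / (1 - p')) ^ 2 *
      ((Real.sinh L ^ 2 + p) / (Real.sinh L' ^ 2 + p'))) := by
  obtain ⟨-, hA, hB, hS⟩ := stretch_top hL hLL' hx hxl rfl rfl rfl rfl rfl
  have hL' := hL.trans_le hLL'
  have hr := shortRatio_pos hL hL'
  have hr1 := shortRatio_le_one hL hLL'
  have hx' : 0 < shortRatio L L' * x := mul_pos hr hx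
  have hxl' : shortRatio L L' * x ≤ halfShort L' := by
    rw [← shortRatio_mul_halfShort hL]
    gcongr
  have hmm := sinh_mul_sinh_le_sinh_mul_sinh hL hLL' hx.le hxl
  have hq := one_sub_sinh_sq_pos hL hx.le hxl
  have hq' := one_sub_sinh_sq_pos hL' hx'.le hxl'
  have hs := Real.sinh_pos_iff.mpr hL
  have hs' := Real.sinh_pos_iff.mpr hL'
  have hC := Real.cosh_pos L
  have hC' := Real.cosh_pos L'
  have hsx := Real.sinh_pos_iff.mpr hx
  have hsx' := Real.sinh_pos_iff.mpr hx'
  have hcx := Real.cosh_pos x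
  have hcx' := Real.cosh_pos (shortRatio L L' * x)
  have hsx'x : Real.sinh (shortRatio L L' * x) ≤ Real.sinh x := Real.sinh_le_sinh.mpr (by nlinarith)
  have c1 := Real.cosh_sq x
  have c2 := Real.cosh_sq (shortRatio L L' * x)
  generalize shortRatio L L' = r at *
  generalize Real.sinh (r * x) = b at *
  generalize Real.cosh (r * x) = cb at *
  generalize Real.sinh x = a at *
  generalize Real.cosh x = ca at *
  generalize Real.sinh L = σ at *
  generalize Real.sinh L' = σ' at *
  generalize Real.cosh L = C at *
  generalize Real.cosh L' = C' at *
  generalize L' / L = k at *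
  have hμ1 : 1 ≤ μ := by
    rw [hμ]
    exact one_le_pow₀ ((one_le_div (by positivity)).mpr hmm)
  have hμσ : μ * σ ^ 2 ≤ σ' ^ 2 := by
    rw [hμ, show (σ' * b / (σ * a)) ^ 2 * σ ^ 2 = σ' ^ 2 * (b / a) ^ 2 by field_simp]
    have : b / a ≤ 1 := (div_le_one hsx).mpr hsx'x
    exact mul_le_of_le_one_right (by positivity) (pow_le_one₀ (by positivity) this)
  have hμa : μ * (σ ^ 2 * a ^ 2) = σ' ^ 2 * b ^ 2 := by
    rw [hμ]; field_simp
  have hp0 : 0 ≤ p' := by rw [hp']; positivity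
  have hpx' : p' ≤ σ' ^ 2 * b ^ 2 := by rw [hp', ← hμa]; gcongr
  have hp1 : 0 < 1 - p := by linarith
  have hp1' : 0 < 1 - p' := by linarith
  -- Each of `m1` to `m4` bounds a factor by its value at the top, where `p` is the `topValue`. The
  -- directions follow from `1 ≤ μ` and `μ * sinh² L ≤ sinh² L'`.
  have m1 : (1 - p) / (1 - p') ≤ (1 - σ ^ 2 * a ^ 2) / (1 - σ' ^ 2 * b ^ 2) := by
    rw [div_le_div_iff₀ hp1' hq', ← hμa, hp']
    have := mul_nonneg (sub_nonneg.mpr hμ1) (sub_nonneg.mpr hpx)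
    linarith
  have m2 : (σ ^ 2 + p) / (σ' ^ 2 + p') ≤ (σ ^ 2 * ca ^ 2) / (σ' ^ 2 * cb ^ 2) := by
    rw [c1, c2, mul_add, mul_add, ← hμa, mul_one, mul_one, div_le_div_iff₀ (by positivity)
      (by positivity), hp']
    have := mul_nonneg (sub_nonneg.mpr hμσ) (sub_nonneg.mpr hpx)
    linarith
  have m3 : p' / (1 - p') ≤ σ' ^ 2 * b ^ 2 / (1 - σ' ^ 2 * b ^ 2) := by gcongr
  have m4 : p' / (σ' ^ 2 + p') ≤ b ^ 2 / cb ^ 2 := by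
    rw [c2, div_le_div_iff₀ (by positivity) (by positivity)]
    linarith
  have hA' : (r * (C' / C)) ^ 2 * ((1 - p) / (1 - p')) ≤
      (r * (C' / C)) ^ 2 * ((1 - σ ^ 2 * a ^ 2) / (1 - σ' ^ 2 * b ^ 2)) := by gcongr
  have hB' : μ ^ 2 * (C' / C) ^ 2 * ((1 - p) / (1 - p')) ^ 2 * ((σ ^ 2 + p) / (σ' ^ 2 + p')) ≤
      (r * (C' / C) * (σ' * b / (σ * a)) * (b * ca / (r * a * cb)) *
        ((1 - σ ^ 2 * a ^ 2) / (1 - σ' ^ 2 * b ^ 2))) ^ 2 := by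
    calc _ ≤ μ ^ 2 * (C' / C) ^ 2 * ((1 - σ ^ 2 * a ^ 2) / (1 - σ' ^ 2 * b ^ 2)) ^ 2 *
          ((σ ^ 2 * ca ^ 2) / (σ' ^ 2 * cb ^ 2)) := by gcongr
      _ = _ := by rw [hμ]; field_simp
  have hS' : (C' / C) ^ 2 * ((1 - p) / (1 - p')) * (p' / (1 - p')) * (p' / (σ' ^ 2 + p')) * θ ^ 2 ≤
      (r * (C' / C)) ^ 2 * ((1 - σ ^ 2 * a ^ 2) / (1 - σ' ^ 2 * b ^ 2)) *
        (σ' ^ 2 * b ^ 2 / (1 - σ' ^ 2 * b ^ 2)) * (b * ca / (r * a * cb) - 1) ^ 2 := by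
    calc _ ≤ (C' / C) ^ 2 * ((1 - σ ^ 2 * a ^ 2) / (1 - σ' ^ 2 * b ^ 2)) *
          (σ' ^ 2 * b ^ 2 / (1 - σ' ^ 2 * b ^ 2)) * (b ^ 2 / cb ^ 2) * θ ^ 2 := by gcongr
      _ = _ := by rw [hθ]; field_simp
  refine ⟨hA'.trans hA, hB'.trans hB, ?_⟩
  calc _ ≤ k ^ 2 * ((r * (C' / C)) ^ 2 * ((1 - σ ^ 2 * a ^ 2) / (1 - σ' ^ 2 * b ^ 2)) *
        (σ' ^ 2 * b ^ 2 / (1 - σ' ^ 2 * b ^ 2)) * (b * ca / (r * a * cb) - 1) ^ 2) := by gcongr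
    _ ≤ _ := hS
    _ ≤ _ := by
      apply mul_le_mul (by linarith) (by linarith) (by linarith) (by linarith)

/-! ### The sector map -/

/-- The square of `sinh L * sinh x`, the largest value of `1 - (cosh L / cosh d) ^ 2` on the
perpendicular at distance `x` from the long edge, within the part closest to a short edge. -/
def topValue (L x : ℝ) : ℝ := Real.sinh L ^ 2 * Real.sinh x ^ 2

/-- The height with `1 - (cosh L / cosh d) ^ 2 = s`. -/
def heightOf (L s : ℝ) : ℝ := Real.arsinh (Real.sqrt ((Real.sinh L ^ 2 + s) / (1 - s)))

/-- The height in a sector: linear in `d` on the foliated region, and scaling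
`1 - (cosh L / cosh d) ^ 2` by a factor that depends only on the foot beyond it. -/
def sectorHeight (L L' a d : ℝ) : ℝ :=
  if d ≤ L then L' / L * d else
    heightOf L' (topValue L' (shortRatio L L' * (halfShort L - |a|)) /
      topValue L (halfShort L - |a|) * (1 - (Real.cosh L / Real.cosh d) ^ 2))

lemma topValue_nonneg (L x : ℝ) : 0 ≤ topValue L x := by unfold topValue; positivity

lemma topValue_lt_one {L x : ℝ} (hL : 0 < L) (hx : 0 ≤ x) (hxl : x ≤ halfShort L) :
    topValue L x < 1 := by
  have := one_sub_sinh_sq_pos hL hx hxl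
  unfold topValue
  linarith

lemma topValue_le {L x : ℝ} (hL : 0 < L) (hx : 0 ≤ x) (hxl : x ≤ halfShort L) :
    topValue L x ≤ 1 / 4 := by
  have h1 := Real.sinh_pos_iff.mpr hL
  have h2 := Real.sinh_nonneg_iff.mpr hx
  have h3 := sinh_mul_sinh_le_half hL hxl
  calc topValue L x = (Real.sinh L * Real.sinh x) ^ 2 := by unfold topValue; ring
    _ ≤ (1 / 2) ^ 2 := by gcongr
    _ = 1 / 4 := by norm_num

lemma topValue_eq_zero {L x : ℝ} (hL : 0 < L) : topValue L x = 0 ↔ x = 0 := by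
  have h1 := Real.sinh_pos_iff.mpr hL
  simp [topValue, h1.ne']

lemma heightOf_nonneg (L s : ℝ) : 0 ≤ heightOf L s :=
  Real.arsinh_nonneg_iff.mpr (Real.sqrt_nonneg _)

lemma sinh_heightOf_sq {L s : ℝ} (hs : 0 ≤ s) (hs1 : s < 1) :
    Real.sinh (heightOf L s) ^ 2 = (Real.sinh L ^ 2 + s) / (1 - s) := by
  have : 0 < 1 - s := by linarith
  rw [heightOf, Real.sinh_arsinh, Real.sq_sqrt (by positivity)]

lemma cosh_heightOf_sq {L s : ℝ} (hs : 0 ≤ s) (hs1 : s < 1) :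
    Real.cosh (heightOf L s) ^ 2 = Real.cosh L ^ 2 / (1 - s) := by
  have : 0 < 1 - s := by linarith
  rw [Real.cosh_sq, sinh_heightOf_sq hs hs1, Real.cosh_sq]
  field_simp
  ring

lemma heightOf_param {L s : ℝ} (hs : 0 ≤ s) (hs1 : s < 1) :
    1 - (Real.cosh L / Real.cosh (heightOf L s)) ^ 2 = s := by
  have : 0 < 1 - s := by linarith
  have := Real.cosh_pos L
  rw [div_pow, cosh_heightOf_sq hs hs1]
  field_simp
  ring

lemma heightOf_eq {L d : ℝ} (hd : 0 ≤ d) :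
    heightOf L (1 - (Real.cosh L / Real.cosh d) ^ 2) = d := by
  have h1 := Real.cosh_pos L
  have h2 := Real.cosh_pos d
  have h3 : (Real.sinh L ^ 2 + (1 - (Real.cosh L / Real.cosh d) ^ 2)) /
      (1 - (1 - (Real.cosh L / Real.cosh d) ^ 2)) = Real.sinh d ^ 2 := by
    rw [Real.sinh_sq d, Real.sinh_sq L]
    field_simp
    ring
  rw [heightOf, h3, Real.sqrt_sq (Real.sinh_nonneg_iff.mpr hd), Real.arsinh_sinh]

lemma heightOf_zero {L : ℝ} (hL : 0 ≤ L) : heightOf L 0 = L := by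
  have := heightOf_eq (L := L) hL
  rwa [div_self (Real.cosh_pos L).ne', one_pow, sub_self] at this

lemma param_nonneg {L d : ℝ} (hL : 0 ≤ L) (hd : L ≤ d) :
    0 ≤ 1 - (Real.cosh L / Real.cosh d) ^ 2 := by
  have h1 := Real.cosh_pos L
  have h2 := Real.cosh_pos d
  have h3 : Real.cosh L ≤ Real.cosh d := by
    rw [Real.cosh_le_cosh, abs_of_nonneg hL, abs_of_nonneg (hL.trans hd)]; exact hd
  have : (Real.cosh L / Real.cosh d) ^ 2 ≤ 1 :=
    pow_le_one₀ (by positivity) ((div_le_one h2).mpr h3)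
  linarith

lemma le_of_param_nonneg {L d : ℝ} (hd : 0 ≤ d)
    (h : 0 ≤ 1 - (Real.cosh L / Real.cosh d) ^ 2) : L ≤ d := by
  have h1 := Real.cosh_pos L
  have h2 := Real.cosh_pos d
  have h3 : Real.cosh L / Real.cosh d ≤ 1 := (sq_le_one_iff₀ (by positivity)).mp (by linarith)
  rw [div_le_one h2, Real.cosh_le_cosh, abs_of_nonneg hd] at h3
  exact (le_abs_self L).trans h3

lemma param_sub {L d x : ℝ} :
    Real.cosh d ^ 2 * (topValue L x - (1 - (Real.cosh L / Real.cosh d) ^ 2)) =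
      (Real.sinh L * Real.cosh d * Real.cosh x) ^ 2 - (Real.cosh L * Real.sinh d) ^ 2 := by
  have h2 := Real.cosh_pos d
  rw [topValue, div_pow, mul_sub, mul_sub, mul_div_cancel₀ _ (by positivity), mul_pow, mul_pow,
    mul_pow, Real.cosh_sq x, Real.cosh_sq d, Real.cosh_sq L]
  ring

/-- In the parameter `p = 1 - (cosh L / cosh d)²` the sector is `p ≤ topValue`: squaring the
defining inequality and dividing by `cosh² d` gives this form by `param_sub`. -/
lemma belowTop_iff {L a d : ℝ} (hL : 0 ≤ L) (hd : 0 ≤ d) :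
    BelowTop L a d ↔ 1 - (Real.cosh L / Real.cosh d) ^ 2 ≤ topValue L (halfShort L - |a|) := by
  have h1 := Real.cosh_pos L
  have h2 := Real.cosh_pos d
  have h3 := Real.sinh_nonneg_iff.mpr hL
  have h4 := Real.sinh_nonneg_iff.mpr hd
  have h5 := Real.cosh_pos (halfShort L - |a|)
  rw [BelowTop, ← sub_nonneg (b := 1 - _), ← mul_nonneg_iff_of_pos_left (pow_pos h2 2), param_sub,
    sub_nonneg, sq_le_sq₀ (by positivity) (by positivity)]

lemma onTop_iff {L a d : ℝ} (hL : 0 ≤ L) (hd : 0 ≤ d) :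
    OnTop L a d ↔ 1 - (Real.cosh L / Real.cosh d) ^ 2 = topValue L (halfShort L - |a|) := by
  have h1 := Real.cosh_pos L
  have h2 := Real.cosh_pos d
  have h3 := Real.sinh_nonneg_iff.mpr hL
  have h4 := Real.sinh_nonneg_iff.mpr hd
  have h5 := Real.cosh_pos (halfShort L - |a|)
  rw [OnTop, eq_comm (a := 1 - _), ← sub_eq_zero (b := 1 - _),
    ← mul_eq_zero_iff_left (pow_pos h2 2).ne', mul_comm, param_sub,
    sub_eq_zero, sq_eq_sq₀ (by positivity) (by positivity), eq_comm, mul_comm (Real.sinh d)]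

lemma sectorHeight_of_le {L L' a d : ℝ} (h : d ≤ L) : sectorHeight L L' a d = L' / L * d :=
  if_pos h

/-- The two branches agree on `d = L`, where `p = 0` and `heightOf L' 0 = L'`. -/
lemma sectorHeight_of_ge {L L' a d : ℝ} (hL : 0 < L) (hL' : 0 < L') (h : L ≤ d) :
    sectorHeight L L' a d =
    heightOf L' (topValue L' (shortRatio L L' * (halfShort L - |a|)) /
      topValue L (halfShort L - |a|) * (1 - (Real.cosh L / Real.cosh d) ^ 2)) := by
  rcases h.eq_or_lt with rfl | h
  · rw [sectorHeight_of_le le_rfl, div_self (Real.cosh_pos L).ne', one_pow, sub_self, mul_zero,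
      heightOf_zero hL'.le]
    field_simp
  · exact if_neg (not_le.mpr h)

lemma halfShort_sub_abs_mul {L L' : ℝ} (hL : 0 < L) (hL' : 0 < L') (a : ℝ) :
    halfShort L' - |shortRatio L L' * a| = shortRatio L L' * (halfShort L - |a|) := by
  rw [abs_mul, abs_of_pos (shortRatio_pos hL hL'), mul_sub, shortRatio_mul_halfShort hL]

section

variable {L L' a d : ℝ} (hL : 0 < L) (hL' : 0 < L') (ha : |a| ≤ halfShort L) (hd : L ≤ d)
  (hb : BelowTop L a d)

include hL hd hb

lemma scaled_param_nonneg_and_le :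
    0 ≤ topValue L' (shortRatio L L' * (halfShort L - |a|)) /
      topValue L (halfShort L - |a|) * (1 - (Real.cosh L / Real.cosh d) ^ 2) ∧
    topValue L' (shortRatio L L' * (halfShort L - |a|)) /
      topValue L (halfShort L - |a|) * (1 - (Real.cosh L / Real.cosh d) ^ 2) ≤
      topValue L' (shortRatio L L' * (halfShort L - |a|)) := by
  rw [belowTop_iff hL.le (hL.le.trans hd)] at hb
  have h0 := param_nonneg hL.le hd
  have h1 := topValue_nonneg L (halfShort L - |a|)
  have h2 := topValue_nonneg L' (shortRatio L L' * (halfShort L - |a|))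
  refine ⟨by positivity, ?_⟩
  rw [div_mul_eq_mul_div, mul_div_assoc]
  exact mul_le_of_le_one_right h2 (div_le_one_of_le₀ hb h1)

include hL' ha

lemma sectorHeight_param :
    1 - (Real.cosh L' / Real.cosh (sectorHeight L L' a d)) ^ 2 =
    topValue L' (shortRatio L L' * (halfShort L - |a|)) /
      topValue L (halfShort L - |a|) * (1 - (Real.cosh L / Real.cosh d) ^ 2) := by
  obtain ⟨h1, h2⟩ := scaled_param_nonneg_and_le (L' := L') hL hd hb
  have hr := shortRatio_pos hL hL'
  have h3 := topValue_lt_one hL' (x := shortRatio L L' * (halfShort L - |a|))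
    (mul_nonneg hr.le (by linarith)) (by
      rw [← shortRatio_mul_halfShort hL L']
      have := abs_nonneg a
      gcongr
      linarith)
  rw [sectorHeight_of_ge hL hL' hd, heightOf_param h1 (h2.trans_lt h3)]

lemma le_sectorHeight : L' ≤ sectorHeight L L' a d := by
  have h := scaled_param_nonneg_and_le (L' := L') hL hd hb
  rw [← sectorHeight_param hL hL' ha hd hb] at h
  refine le_of_param_nonneg ?_ h.1
  rw [sectorHeight_of_ge hL hL' hd]
  exact heightOf_nonneg _ _

end

lemma belowTop_of_le {L a d : ℝ} (hL : 0 ≤ L) (hd : 0 ≤ d) (h : d ≤ L) : BelowTop L a d := by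
  rw [belowTop_iff hL hd]
  refine le_trans ?_ (topValue_nonneg _ _)
  have h2 := Real.cosh_pos d
  have h3 : Real.cosh d ≤ Real.cosh L := by
    rwa [Real.cosh_le_cosh, abs_of_nonneg hL, abs_of_nonneg hd]
  have : 1 ≤ (Real.cosh L / Real.cosh d) ^ 2 := one_le_pow₀ ((one_le_div h2).mpr h3)
  linarith

lemma isSectorMap_sectorHeight {L L' : ℝ} (hL : 0 < L) (hL' : 0 < L') :
    IsSectorMap L L' (sectorHeight L L') := by
  have hnonneg : ∀ {a d}, |a| ≤ halfShort L → 0 ≤ d → BelowTop L a d →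
      0 ≤ sectorHeight L L' a d := fun {a d} ha hd hb => by
    rcases le_total d L with h | h
    · rw [sectorHeight_of_le h]
      positivity
    · exact hL'.le.trans (le_sectorHeight hL hL' ha h hb)
  refine ⟨hnonneg, ?_, ?_, ?_, fun _ h => sectorHeight_of_le h⟩
  · intro a d ha hd hb
    rcases le_total d L with h | h
    · refine belowTop_of_le hL'.le (hnonneg ha hd hb) ?_
      rw [sectorHeight_of_le h]
      exact div_mul_le_of_le hL hL' h
    · rw [belowTop_iff hL'.le (hnonneg ha hd hb), halfShort_sub_abs_mul hL hL',
        sectorHeight_param hL hL' ha h hb]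
      exact (scaled_param_nonneg_and_le (L' := L') hL h hb).2
  · intro a d ha hd hb
    have hb' : BelowTop L a d := le_of_eq hb
    rw [onTop_iff hL.le hd] at hb
    have h : L ≤ d := le_of_param_nonneg hd (hb ▸ topValue_nonneg _ _)
    rw [onTop_iff hL'.le (hnonneg ha hd hb'), halfShort_sub_abs_mul hL hL',
        sectorHeight_param hL hL' ha h hb', hb]
    -- At the ends of the edge the factor is `0 / 0`, which is `0` in Lean; both tops vanish there,
    -- so the conclusion still holds.
    rcases eq_or_ne (halfShort L - |a|) 0 with h0 | h0
    · rw [h0, mul_zero, (topValue_eq_zero hL).mpr rfl, mul_zero, (topValue_eq_zero hL').mpr rfl]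
    · exact div_mul_cancel₀ _ (mt (topValue_eq_zero hL).mp h0)
  · intro a d
    simp only [sectorHeight, abs_neg]

/-- The inverse factor on `p` cancels the first one. At the ends of the edge, where the factors
degenerate, the point lies on `d = L`, so that `p = 0`. -/
lemma sectorHeight_sectorHeight {L L' a d : ℝ} (hL : 0 < L) (hL' : 0 < L')
    (ha : |a| ≤ halfShort L) (hd : 0 ≤ d) (hb : BelowTop L a d) :
    sectorHeight L' L (shortRatio L L' * a) (sectorHeight L L' a d) = d := by
  rcases le_total d L with h | h
  · rw [sectorHeight_of_le h, sectorHeight_of_le (div_mul_le_of_le hL hL' h)]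
    field_simp
  · rw [sectorHeight_of_ge hL' hL (le_sectorHeight hL hL' ha h hb),
      sectorHeight_param hL hL' ha h hb, halfShort_sub_abs_mul hL hL', shortRatio_mul_cancel hL hL']
    have h1 : topValue L (halfShort L - |a|) /
        topValue L' (shortRatio L L' * (halfShort L - |a|)) *
        (topValue L' (shortRatio L L' * (halfShort L - |a|)) / topValue L (halfShort L - |a|) *
        (1 - (Real.cosh L / Real.cosh d) ^ 2)) = 1 - (Real.cosh L / Real.cosh d) ^ 2 := by
      rcases eq_or_ne (halfShort L - |a|) 0 with h0 | h0
      · rw [belowTop_iff hL.le hd, h0, (topValue_eq_zero hL).mpr rfl] at hb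
        rw [le_antisymm hb (param_nonneg hL.le h), mul_zero, mul_zero]
      · have e1 := mt (topValue_eq_zero hL).mp h0
        have e2 := mt (topValue_eq_zero (x := shortRatio L L' * (halfShort L - |a|)) hL').mp
          (mul_ne_zero (shortRatio_pos hL hL').ne' h0)
        rw [← mul_assoc, div_mul_div_cancel₀ e2, div_self e1, one_mul]
    rw [h1, heightOf_eq hd]

/-! ### First-order expansion of the sector map -/

lemma hasDerivAt_heightOf {L s : ℝ} (hL : 0 < L) (hs : 0 ≤ s) (hs1 : s < 1) :
    HasDerivAt (heightOf L)
      (Real.cosh (heightOf L s) / (2 * (1 - s) * Real.sinh (heightOf L s))) s := by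
  have h1 : 0 < 1 - s := by linarith
  have h2 := Real.sinh_pos_iff.mpr hL
  have h3 : 0 < (Real.sinh L ^ 2 + s) / (1 - s) := by positivity
  have h4 : HasDerivAt (fun s => (Real.sinh L ^ 2 + s) / (1 - s)) (Real.cosh L ^ 2 / (1 - s) ^ 2) s :=
    (((hasDerivAt_id s).const_add (Real.sinh L ^ 2)).div ((hasDerivAt_id s).const_sub 1)
      h1.ne').congr_deriv (by rw [Real.cosh_sq]; simp; ring)
  have h5 := (h4.sqrt h3.ne').arsinh
  refine h5.congr_deriv ?_
  have e1 : Real.sqrt ((Real.sinh L ^ 2 + s) / (1 - s)) = Real.sinh (heightOf L s) := by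
    rw [heightOf, Real.sinh_arsinh]
  have e2 := Real.cosh_pos (heightOf L s)
  have e3 : 0 < Real.sinh (heightOf L s) := by rw [← e1]; exact Real.sqrt_pos.mpr h3
  have e4 := cosh_heightOf_sq (L := L) hs hs1
  have e5 : Real.cosh L ^ 2 = Real.cosh (heightOf L s) ^ 2 * (1 - s) := by
    rw [e4]; field_simp
  rw [e1, add_comm, ← Real.cosh_sq, Real.sqrt_sq e2.le, smul_eq_mul, e5]
  field_simp

lemma hasDerivAt_param (L d : ℝ) :
    HasDerivAt (fun d => 1 - (Real.cosh L / Real.cosh d) ^ 2)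
      (2 * Real.cosh L ^ 2 * Real.sinh d / Real.cosh d ^ 3) d := by
  have h := Real.cosh_pos d
  have := ((((hasDerivAt_const d (Real.cosh L)).div (Real.hasDerivAt_cosh d) h.ne').pow 2).const_sub
    1)
  refine this.congr_deriv ?_
  simp
  field_simp

lemma hasDerivAt_topValue (L x : ℝ) :
    HasDerivAt (topValue L) (2 * Real.sinh L ^ 2 * Real.sinh x * Real.cosh x) x :=
  (((Real.hasDerivAt_sinh x).pow 2).const_mul (Real.sinh L ^ 2)).congr_deriv (by push_cast; ring)

lemma hasDerivAt_topValue_ratio {L L' x : ℝ} (hL : 0 < L) (hL' : 0 < L') (hx : 0 < x) :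
    HasDerivAt (fun x => topValue L' (shortRatio L L' * x) / topValue L x)
      (-(2 * (topValue L' (shortRatio L L' * x) / topValue L x) *
        (Real.cosh x / Real.sinh x - shortRatio L L' *
          Real.cosh (shortRatio L L' * x) / Real.sinh (shortRatio L L' * x)))) x := by
  have h1 : HasDerivAt (fun x => shortRatio L L' * x) (shortRatio L L') x := by
    simpa using (hasDerivAt_id x).const_mul (shortRatio L L')
  have h2 := ((hasDerivAt_topValue L' (shortRatio L L' * x)).comp x h1).div
    (hasDerivAt_topValue L x) (mt (topValue_eq_zero hL).mp hx.ne')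
  refine h2.congr_deriv ?_
  have := Real.sinh_pos_iff.mpr hL
  have := Real.sinh_pos_iff.mpr hx
  have := Real.sinh_pos_iff.mpr (mul_pos (shortRatio_pos hL hL') hx)
  simp only [topValue, Function.comp]
  field_simp
  ring

/-- Near `(a₀, d₀)`, on the set `s`, the sector map stretches by at most any `K > L' / L`. -/
def StretchBoundedAt (L L' : ℝ) (s : Set (ℝ × ℝ)) (a₀ d₀ : ℝ) : Prop :=
  ∀ K > L' / L, ∃ δ > 0, ∀ a d, (a, d) ∈ s → |a - a₀| ≤ δ → |d - d₀| ≤ δ →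
    (sectorHeight L L' a d - sectorHeight L L' a₀ d₀) ^ 2 +
      (Real.cosh (sectorHeight L L' a₀ d₀) * (shortRatio L L' * (a - a₀))) ^ 2 ≤
    K ^ 2 * ((d - d₀) ^ 2 + (Real.cosh d₀ * (a - a₀)) ^ 2)

lemma StretchBoundedAt.union {L L' a₀ d₀ : ℝ} {s t : Set (ℝ × ℝ)}
    (hs : StretchBoundedAt L L' s a₀ d₀) (ht : StretchBoundedAt L L' t a₀ d₀) :
    StretchBoundedAt L L' (s ∪ t) a₀ d₀ := by
  intro K hK
  obtain ⟨δ, hδ, h1⟩ := hs K hK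
  obtain ⟨ε, hε, h2⟩ := ht K hK
  refine ⟨min δ ε, lt_min hδ hε, fun a d had ha hd => ?_⟩
  rcases had with had | had
  · exact h1 a d had (ha.trans (min_le_left _ _)) (hd.trans (min_le_left _ _))
  · exact h2 a d had (ha.trans (min_le_right _ _)) (hd.trans (min_le_right _ _))

lemma StretchBoundedAt.mono {L L' a₀ d₀ : ℝ} {s t : Set (ℝ × ℝ)}
    (hs : StretchBoundedAt L L' s a₀ d₀) (h : t ⊆ s) : StretchBoundedAt L L' t a₀ d₀ := by
  intro K hK
  obtain ⟨δ, hδ, h1⟩ := hs K hK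
  exact ⟨δ, hδ, fun a d had => h1 a d (h had)⟩

/-- A first-order error of relative size `ε` changes the squared length by a multiple of `ε E`, by
Young's inequality. -/
lemma perturbed_sq_le {k ε u T E r : ℝ} (hε : 0 ≤ ε) (hε1 : ε ≤ 1) (hT : T ^ 2 ≤ 2 * E)
    (hr : |r| ≤ ε * T) (hu : u ^ 2 ≤ k ^ 2 * E) :
    (u + r) ^ 2 ≤ u ^ 2 + ε * (k ^ 2 + 4) * E := by
  have h1 : r ^ 2 ≤ (ε * T) ^ 2 := by
    rw [← sq_abs r]
    gcongr
  have h2 : u * r ≤ |u| * (ε * T) := by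
    calc u * r ≤ |u * r| := le_abs_self _
      _ = |u| * |r| := abs_mul _ _
      _ ≤ _ := by gcongr
  have h3 : 2 * (|u| * T) ≤ u ^ 2 + T ^ 2 := by
    have := two_mul_le_add_sq |u| T
    rw [sq_abs] at this
    linarith
  have h4 : ε ^ 2 * T ^ 2 ≤ ε * T ^ 2 := by
    have := mul_le_mul_of_nonneg_left hε1 hε
    have hT0 := sq_nonneg T
    nlinarith
  have h5 : ε * (2 * (|u| * T)) ≤ ε * (u ^ 2 + T ^ 2) := by gcongr
  have h6 : ε * (u ^ 2 + T ^ 2 + T ^ 2) ≤ ε * ((k ^ 2 + 4) * E) := by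
    apply mul_le_mul_of_nonneg_left _ hε
    linarith
  linarith

/-- The expansion is taken in `|a|`, as the height need not be differentiable at `a = 0`. This is
harmless: `| |a| - |a₀| | ≤ |a - a₀|`, and `A² ≤ k²` gives the surplus horizontal displacement the
required coefficient. -/
lemma stretchBoundedAt_of_expansion {L L' a₀ d₀ S B : ℝ} {s : Set (ℝ × ℝ)} (hk : 0 ≤ L' / L)
    (hQ : ∀ α β, (Real.cosh (sectorHeight L L' a₀ d₀) * shortRatio L L' / Real.cosh d₀) ^ 2 * α ^ 2 +
      (S * α + B * β) ^ 2 ≤ (L' / L) ^ 2 * (α ^ 2 + β ^ 2))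
    (hR : ∀ ε > 0, ∃ δ > 0, ∀ a d, (a, d) ∈ s → |a - a₀| ≤ δ → |d - d₀| ≤ δ →
      |sectorHeight L L' a d - sectorHeight L L' a₀ d₀ -
        (S * (Real.cosh d₀ * (|a| - |a₀|)) + B * (d - d₀))| ≤ ε * (|a - a₀| + |d - d₀|)) :
    StretchBoundedAt L L' s a₀ d₀ := by
  intro K hK
  generalize L' / L = k at *
  have hg : 0 < K ^ 2 - k ^ 2 := by nlinarith
  -- Chosen so that the error `ε (k² + 4) E` fits into the gap between `k²` and `K²`.
  set ε := min 1 ((K ^ 2 - k ^ 2) / (k ^ 2 + 4)) with hεdef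
  have hε : 0 < ε := lt_min one_pos (by positivity)
  have hε2 : ε * (k ^ 2 + 4) ≤ K ^ 2 - k ^ 2 :=
    (le_div_iff₀ (by positivity)).mp (min_le_right _ _)
  obtain ⟨δ, hδ, h⟩ := hR ε hε
  refine ⟨δ, hδ, fun a d had ha hd => ?_⟩
  have hr := h a d had ha hd
  have hc := Real.one_le_cosh d₀
  have hy : (|a| - |a₀|) ^ 2 ≤ (a - a₀) ^ 2 := by
    rw [← sq_abs, ← sq_abs (a - a₀)]
    have := abs_abs_sub_abs_le_abs_sub a a₀
    gcongr
  have hcc : (a - a₀) ^ 2 ≤ (Real.cosh d₀ * (a - a₀)) ^ 2 := by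
    rw [mul_pow]
    exact le_mul_of_one_le_left (sq_nonneg _) (one_le_pow₀ hc)
  have hT : (|a - a₀| + |d - d₀|) ^ 2 ≤ 2 * ((d - d₀) ^ 2 + (Real.cosh d₀ * (a - a₀)) ^ 2) := by
    have := two_mul_le_add_sq |a - a₀| |d - d₀|
    rw [sq_abs, sq_abs] at this
    have e : (|a - a₀| + |d - d₀|) ^ 2 =
        (a - a₀) ^ 2 + 2 * |a - a₀| * |d - d₀| + (d - d₀) ^ 2 := by
      rw [add_sq, sq_abs, sq_abs]
    linarith
  have hq := hQ (Real.cosh d₀ * (|a| - |a₀|)) (d - d₀)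
  have hA := hQ 1 0
  set A2 := (Real.cosh (sectorHeight L L' a₀ d₀) * shortRatio L L' / Real.cosh d₀) ^ 2 with hA2
  have hA' : A2 ≤ k ^ 2 := by nlinarith [sq_nonneg S]
  have e1 : (Real.cosh (sectorHeight L L' a₀ d₀) * (shortRatio L L' * (a - a₀))) ^ 2 =
      A2 * (Real.cosh d₀ * (a - a₀)) ^ 2 := by
    rw [hA2]; field_simp
  have hlin : A2 * (Real.cosh d₀ * (a - a₀)) ^ 2 +
      (S * (Real.cosh d₀ * (|a| - |a₀|)) + B * (d - d₀)) ^ 2 ≤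
      k ^ 2 * ((d - d₀) ^ 2 + (Real.cosh d₀ * (a - a₀)) ^ 2) := by
    have h1 : (k ^ 2 - A2) * (Real.cosh d₀ * (|a| - |a₀|)) ^ 2 ≤
        (k ^ 2 - A2) * (Real.cosh d₀ * (a - a₀)) ^ 2 := by
      rw [mul_pow, mul_pow (Real.cosh d₀) (a - a₀)]
      have : 0 ≤ k ^ 2 - A2 := by linarith
      gcongr
    linarith
  have hp := perturbed_sq_le (u := S * (Real.cosh d₀ * (|a| - |a₀|)) + B * (d - d₀)) hε.le
    (min_le_left _ _) hT hr (k := k) (by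
    have : 0 ≤ A2 * (Real.cosh d₀ * (a - a₀)) ^ 2 := by positivity
    linarith)
  rw [add_sub_cancel] at hp
  have hE : 0 ≤ (d - d₀) ^ 2 + (Real.cosh d₀ * (a - a₀)) ^ 2 := by positivity
  have := mul_le_mul_of_nonneg_right hε2 hE
  rw [e1]
  linarith

/-- Product-to-sum formulas reduce it to `k d + L ≤ k L + d` and `|k d - L| ≤ k L - d`. Hence `cosh
(k d) / cosh d` is largest at `d = L`. -/
lemma cosh_mul_cosh_le {L L' d : ℝ} (hL : 0 < L) (hLL' : L ≤ L') (hd : 0 ≤ d) (hdL : d ≤ L) :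
    Real.cosh (L' / L * d) * Real.cosh L ≤ Real.cosh L' * Real.cosh d := by
  have h1 : ∀ x y : ℝ, Real.cosh x * Real.cosh y = (Real.cosh (x + y) + Real.cosh (x - y)) / 2 :=
    fun x y => by rw [Real.cosh_add, Real.cosh_sub]; ring
  have hk : 1 ≤ L' / L := (one_le_div hL).mpr hLL'
  have hk' : L' = L' / L * L := by field_simp
  rw [h1, h1]
  generalize L' / L = k at *
  subst hk'
  have hkd : 0 ≤ k * d := by positivity
  have hkL : 0 ≤ k * L := by positivity
  have a1 : Real.cosh (k * d + L) ≤ Real.cosh (k * L + d) := by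
    rw [Real.cosh_le_cosh, abs_of_nonneg (by linarith), abs_of_nonneg (by linarith)]
    nlinarith
  have a2 : Real.cosh (k * d - L) ≤ Real.cosh (k * L - d) := by
    rw [Real.cosh_le_cosh, abs_of_nonneg (a := k * L - d) (by nlinarith), abs_le]
    constructor <;> nlinarith
  linarith

lemma stretchBoundedAt_foliated {L L' a₀ d₀ : ℝ} (hL : 0 < L) (hLL' : L ≤ L') (hd : 0 ≤ d₀)
    (hdL : d₀ ≤ L) : StretchBoundedAt L L' {q | q.2 ≤ L} a₀ d₀ := by
  have hL' := hL.trans_le hLL'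
  apply stretchBoundedAt_of_expansion (S := 0) (B := L' / L) (by positivity)
  · intro α β
    have h1 := horizontal_le hL hLL'
    have h2 := cosh_mul_cosh_le hL hLL' hd hdL
    have hr := shortRatio_pos hL hL'
    have hC := Real.cosh_pos L
    have hc := Real.cosh_pos d₀
    have h3 : Real.cosh (L' / L * d₀) * shortRatio L L' / Real.cosh d₀ ≤ L' / L := by
      refine le_trans ?_ h1
      have h4 : Real.cosh (L' / L * d₀) ≤ Real.cosh L' / Real.cosh L * Real.cosh d₀ := by
        rwa [div_mul_eq_mul_div (Real.cosh L'), le_div_iff₀ hC]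
      rw [div_le_iff₀ hc, mul_assoc, mul_comm]
      gcongr
    rw [sectorHeight_of_le hdL]
    have h4 : (Real.cosh (L' / L * d₀) * shortRatio L L' / Real.cosh d₀) ^ 2 ≤ (L' / L) ^ 2 := by
      gcongr
    nlinarith [mul_le_mul_of_nonneg_right h4 (sq_nonneg α)]
  · refine fun ε hε => ⟨1, one_pos, fun a d had _ _ => ?_⟩
    rw [sectorHeight_of_le hdL, sectorHeight_of_le had]
    have : L' / L * d - L' / L * d₀ - (0 * (Real.cosh d₀ * (|a| - |a₀|)) + L' / L * (d - d₀)) = 0 := by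
      ring
    rw [this, abs_zero]
    positivity


lemma cosh_sub_one_le {x l : ℝ} (hx : 0 ≤ x) (hxl : x ≤ l) :
    Real.cosh x - 1 ≤ Real.cosh l ^ 2 * x ^ 2 := by
  have h1 : Real.cosh x - 1 = 2 * Real.sinh (x / 2) ^ 2 := by
    have := Real.cosh_two_mul (x / 2)
    rw [show 2 * (x / 2) = x by ring] at this
    rw [this, Real.cosh_sq]
    ring
  have h2 : Real.sinh (x / 2) ≤ x / 2 * Real.cosh l := by
    refine (sinh_le_self_mul_cosh (by positivity)).trans ?_
    have : Real.cosh (x / 2) ≤ Real.cosh l := by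
      rw [Real.cosh_le_cosh, abs_of_nonneg (by positivity), abs_of_nonneg (hx.trans hxl)]
      linarith
    gcongr
  have h3 : 0 ≤ Real.sinh (x / 2) := Real.sinh_nonneg_iff.mpr (by positivity)
  have h4 : Real.sinh (x / 2) ^ 2 ≤ (x / 2 * Real.cosh l) ^ 2 := by gcongr
  have h5 : 0 ≤ Real.cosh l ^ 2 * x ^ 2 := by positivity
  rw [h1]
  linarith

/-- The points `(a, d)` in Fermi coordinates that are closest to the given short edge. -/
def sectorSet (L : ℝ) : Set (ℝ × ℝ) :=
  {q | |q.1| ≤ halfShort L ∧ 0 ≤ q.2 ∧ BelowTop L q.1 q.2}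

lemma cosh_le_of_belowTop {L a d : ℝ} (hL : 0 < L) (ha : |a| ≤ halfShort L) (hd : 0 ≤ d)
    (hb : BelowTop L a d) : Real.cosh d ≤ 2 * Real.cosh L := by
  rw [belowTop_iff hL.le hd] at hb
  have h1 := topValue_le hL (x := halfShort L - |a|) (by linarith) (by
    have := abs_nonneg a
    linarith)
  have h2 := Real.cosh_pos d
  have h3 := Real.cosh_pos L
  have h4 : (1 / 2) ^ 2 ≤ (Real.cosh L / Real.cosh d) ^ 2 := by linarith
  have h5 := (sq_le_sq₀ (by norm_num) (by positivity)).mp h4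
  rw [le_div_iff₀ h2] at h5
  linarith

/-- Near an end of the short edge the sector above `d = L` is a cusp: `sinh (d - L)` is bounded by a
multiple of `cosh x - 1`, hence quadratic in `x = l - |a|`. -/
lemma sub_le_of_belowTop {L a d : ℝ} (hL : 0 < L) (ha : |a| ≤ halfShort L) (hd : L ≤ d)
    (hb : BelowTop L a d) :
    d - L ≤ 2 * Real.sinh L * Real.cosh L * Real.cosh (halfShort L) ^ 2 * (halfShort L - |a|) ^ 2 := by
  have h1 := cosh_le_of_belowTop hL ha (hL.le.trans hd) hb
  have h2 := cosh_sub_one_le (x := halfShort L - |a|) (l := halfShort L) (by linarith) (by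
    have := abs_nonneg a
    linarith)
  have h3 := Real.sinh_pos_iff.mpr hL
  have h4 := Real.one_le_cosh (halfShort L - |a|)
  have h5 := Real.cosh_pos L
  calc d - L ≤ Real.sinh (d - L) := self_le_sinh (by linarith)
    _ = Real.cosh L * Real.sinh d - Real.sinh L * Real.cosh d := by rw [Real.sinh_sub]; ring
    _ ≤ Real.sinh L * Real.cosh d * (Real.cosh (halfShort L - |a|) - 1) := by
      rw [BelowTop] at hb; linarith
    _ ≤ Real.sinh L * (2 * Real.cosh L) *
        (Real.cosh (halfShort L) ^ 2 * (halfShort L - |a|) ^ 2) := by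
      gcongr
    _ = _ := by ring

/-- At the tip the rescaling factor is undefined, but the image also lies in a quadratic cusp. The
change of height is therefore `o(|a - a₀|)`, and the zero linear part suffices. -/
lemma stretchBoundedAt_cusp {L L' a₀ : ℝ} (hL : 0 < L) (hLL' : L ≤ L')
    (ha : |a₀| = halfShort L) :
    StretchBoundedAt L L' (sectorSet L ∩ {q | L ≤ q.2}) a₀ L := by
  have hL' := hL.trans_le hLL'
  have hr := shortRatio_pos hL hL'
  have hr1 := shortRatio_le_one hL hLL'
  have hS := isSectorMap_sectorHeight hL hL'
  have e0 : sectorHeight L L' a₀ L = L' := by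
    rw [sectorHeight_of_le le_rfl]; field_simp
  apply stretchBoundedAt_of_expansion (S := 0) (B := 0) (by positivity)
  · intro α β
    have h1 := horizontal_le hL hLL'
    have h2 := Real.cosh_pos L
    have h3 := Real.cosh_pos L'
    rw [e0, mul_comm (Real.cosh L'), mul_div_assoc]
    have h4 : (shortRatio L L' * (Real.cosh L' / Real.cosh L)) ^ 2 ≤ (L' / L) ^ 2 := by gcongr
    nlinarith [mul_le_mul_of_nonneg_right h4 (sq_nonneg α), sq_nonneg (L' / L * β)]
  · intro ε hε
    have hs := Real.sinh_pos_iff.mpr hL'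
    have hc := Real.cosh_pos L'
    have hc' := Real.cosh_pos (halfShort L')
    set M := 2 * Real.sinh L' * Real.cosh L' * Real.cosh (halfShort L') ^ 2 with hM
    have hM0 : 0 < M := by positivity
    refine ⟨ε / M, by positivity, fun a d had hda _ => ?_⟩
    obtain ⟨⟨h1, h2, h3⟩, h4⟩ :
      (|a| ≤ halfShort L ∧ 0 ≤ d ∧ BelowTop L a d) ∧ L ≤ d := had
    have h5 := le_sectorHeight hL hL' h1 h4 h3
    have h6 := hS.below h1 h2 h3
    have h7 : |shortRatio L L' * a| ≤ halfShort L' := by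
      rw [abs_mul, abs_of_pos hr, ← shortRatio_mul_halfShort hL L']
      gcongr
    have h8 := sub_le_of_belowTop hL' h7 h5 h6
    rw [halfShort_sub_abs_mul hL hL', ← hM] at h8
    have h9 : halfShort L - |a| ≤ |a - a₀| := by
      rw [← ha, abs_sub_comm]
      exact abs_sub_abs_le_abs_sub _ _
    have h10 : shortRatio L L' * (halfShort L - |a|) ≤ |a - a₀| := by nlinarith
    have h11 : 0 ≤ shortRatio L L' * (halfShort L - |a|) := mul_nonneg hr.le (by linarith)
    rw [e0, zero_mul, zero_mul, add_zero, sub_zero, abs_of_nonneg (by linarith)]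
    rw [le_div_iff₀ hM0] at hda
    calc _ ≤ M * (shortRatio L L' * (halfShort L - |a|)) ^ 2 := h8
      _ ≤ M * |a - a₀| ^ 2 := by gcongr
      _ = |a - a₀| * M * |a - a₀| := by ring
      _ ≤ ε * |a - a₀| := by gcongr
      _ ≤ _ := by
        have := abs_nonneg (d - L)
        gcongr
        linarith

lemma horizontal_sq_eq {cH cd r C C' p s : ℝ} (h1 : cH ^ 2 = C' ^ 2 / (1 - s))
    (h3 : cd ^ 2 = C ^ 2 / (1 - p)) :
    (cH * r / cd) ^ 2 = (r * (C' / C)) ^ 2 * ((1 - p) / (1 - s)) := by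
  rw [div_pow, mul_pow, h1, h3]
  field_simp

lemma shear_sq_eq {cH sH cd θ C C' T p s : ℝ} (h1 : cH ^ 2 = C' ^ 2 / (1 - s))
    (h2 : sH ^ 2 = T / (1 - s)) (h3 : cd ^ 2 = C ^ 2 / (1 - p)) (hs : 0 < 1 - s) :
    (cH * s * θ / ((1 - s) * sH * cd)) ^ 2 =
      (C' / C) ^ 2 * ((1 - p) / (1 - s)) * (s / (1 - s)) * (s / T) * θ ^ 2 := by
  rw [div_pow, mul_pow, mul_pow, mul_pow, mul_pow, h1, h2, h3]
  field_simp

lemma vertical_sq_eq {cH sH cd sd C C' T U μ p s : ℝ} (h1 : cH ^ 2 = C' ^ 2 / (1 - s))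
    (h2 : sH ^ 2 = T / (1 - s)) (h3 : cd ^ 2 = C ^ 2 / (1 - p)) (h4 : sd ^ 2 = U / (1 - p))
    (hs : 0 < 1 - s) (hp : 0 < 1 - p) (hC : 0 < C) :
    (cH / (2 * (1 - s) * sH) * (μ * (2 * C ^ 2 * sd / cd ^ 3))) ^ 2 =
      μ ^ 2 * (C' / C) ^ 2 * ((1 - p) / (1 - s)) ^ 2 * (U / T) := by
  have e : (cH / (2 * (1 - s) * sH) * (μ * (2 * C ^ 2 * sd / cd ^ 3))) ^ 2 =
      cH ^ 2 / ((1 - s) ^ 2 * sH ^ 2) * (μ ^ 2 * (C ^ 4 * sd ^ 2 / (cd ^ 2) ^ 3)) := by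
    field_simp
  rw [e, h1, h2, h3, h4]
  field_simp

/-- Away from the tip the height is a differentiable function of `(x, d)` with `x = l - |a|`, and
its partial derivatives are the shear and the vertical entry estimated in `stretch_estimate`. -/
lemma stretchBoundedAt_upper {L L' a₀ d₀ : ℝ} (hL : 0 < L) (hLL' : L ≤ L')
    (ha : |a₀| < halfShort L) (hd : L ≤ d₀) (hb : BelowTop L a₀ d₀) :
    StretchBoundedAt L L' {q | L ≤ q.2} a₀ d₀ := by
  have hL' := hL.trans_le hLL'
  have hr := shortRatio_pos hL hL'
  have hx : 0 < halfShort L - |a₀| := sub_pos.mpr ha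
  have hxl : halfShort L - |a₀| ≤ halfShort L := by
    have := abs_nonneg a₀
    linarith
  have hx' : 0 < shortRatio L L' * (halfShort L - |a₀|) := mul_pos hr hx
  have hxl' : shortRatio L L' * (halfShort L - |a₀|) ≤ halfShort L' := by
    rw [← shortRatio_mul_halfShort hL L']
    gcongr
  have hp := param_nonneg hL.le hd
  have hpx := (belowTop_iff hL.le (hL.le.trans hd)).mp hb
  obtain ⟨hp0', hpx'⟩ := scaled_param_nonneg_and_le (L' := L') hL hd hb
  have hp1 := hpx.trans_lt (topValue_lt_one hL hx.le hxl)
  have hp1' := hpx'.trans_lt (topValue_lt_one hL' hx'.le hxl')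
  obtain ⟨hA, hB, hS⟩ := stretch_estimate hL hLL' hx hxl hp hpx rfl rfl rfl
  have hψ := sectorHeight_of_ge (a := a₀) hL hL' hd
  have hψ0 := le_sectorHeight hL hL' ha.le hd hb
  have c1 := cosh_heightOf_sq (L := L') hp0' hp1'
  have c2 := sinh_heightOf_sq (L := L') hp0' hp1'
  have c3 := cosh_heightOf_sq (L := L) hp hp1
  have c4 := sinh_heightOf_sq (L := L) hp hp1
  rw [heightOf_eq (hL.le.trans hd)] at c3 c4
  have D1 := hasDerivAt_topValue_ratio hL hL' hx
  have D2 := hasDerivAt_param L d₀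
  have D3 := hasDerivAt_heightOf hL' hp0' hp1'
  have hμ : topValue L' (shortRatio L L' * (halfShort L - |a₀|)) / topValue L (halfShort L - |a₀|) =
      (Real.sinh L' * Real.sinh (shortRatio L L' * (halfShort L - |a₀|)) /
        (Real.sinh L * Real.sinh (halfShort L - |a₀|))) ^ 2 := by
    rw [topValue, topValue, ← mul_pow, ← mul_pow, div_pow]
  rw [← hμ] at hA hB hS
  have F1 := D1.comp_hasFDerivAt (halfShort L - |a₀|, d₀)
    (hasFDerivAt_fst (𝕜 := ℝ) (p := (halfShort L - |a₀|, d₀)))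
  have F2 := D2.comp_hasFDerivAt (halfShort L - |a₀|, d₀)
    (hasFDerivAt_snd (𝕜 := ℝ) (p := (halfShort L - |a₀|, d₀)))
  have F3 := D3.comp_hasFDerivAt (halfShort L - |a₀|, d₀) (F1.mul F2)
  set x := halfShort L - |a₀| with hxdef
  set p := 1 - (Real.cosh L / Real.cosh d₀) ^ 2 with hpdef
  set μ := topValue L' (shortRatio L L' * x) / topValue L x with hμdef
  set θ := Real.cosh x / Real.sinh x - shortRatio L L' * Real.cosh (shortRatio L L' * x) /
    Real.sinh (shortRatio L L' * x) with hθ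
  have hs1 : 0 < 1 - μ * p := sub_pos.mpr hp1'
  have hC := Real.cosh_pos L
  have hcd := Real.cosh_pos d₀
  have hk : 0 < L' / L := by positivity
  apply stretchBoundedAt_of_expansion hk.le
    (S := Real.cosh (heightOf L' (μ * p)) * (μ * p) * θ /
      ((1 - μ * p) * Real.sinh (heightOf L' (μ * p)) * Real.cosh d₀))
    (B := Real.cosh (heightOf L' (μ * p)) / (2 * (1 - μ * p) * Real.sinh (heightOf L' (μ * p))) *
      (μ * (2 * Real.cosh L ^ 2 * Real.sinh d₀ / Real.cosh d₀ ^ 3)))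
  · intro α β
    rw [hψ]
    apply quadratic_le (by positivity)
    · rw [horizontal_sq_eq c1 c3]
      exact hA
    · rw [vertical_sq_eq c1 c2 c3 c4 hs1 (by linarith) hC]
      exact hB
    · rw [horizontal_sq_eq c1 c3, vertical_sq_eq c1 c2 c3 c4 hs1 (by linarith) hC,
        shear_sq_eq c1 c2 c3 hs1]
      exact hS
  · intro ε hε
    obtain ⟨δ, hδ, h⟩ := Metric.eventually_nhds_iff.mp (F3.isLittleO.def hε)
    refine ⟨δ / 2, by positivity, fun a d had hda hdd => ?_⟩
    have hy := abs_abs_sub_abs_le_abs_sub a a₀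
    have hxx : halfShort L - |a| - x = -(|a| - |a₀|) := by rw [hxdef]; ring
    have h1 := h (y := (halfShort L - |a|, d)) (by
      rw [Prod.dist_eq, Real.dist_eq, Real.dist_eq, hxx, abs_neg]
      exact max_lt (by linarith) (by linarith))
    have h2 : ‖((halfShort L - |a|, d) : ℝ × ℝ) - (x, d₀)‖ ≤ |a - a₀| + |d - d₀| := by
      rw [Prod.mk_sub_mk, Prod.norm_mk, Real.norm_eq_abs, Real.norm_eq_abs, hxx, abs_neg]
      exact max_le (by linarith [abs_nonneg (d - d₀)]) (by linarith [abs_nonneg (a - a₀)])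
    have h3 := h1.trans (mul_le_mul_of_nonneg_left h2 hε.le)
    rw [sectorHeight_of_ge hL hL' had, hψ]
    refine le_of_eq_of_le ?_ h3
    rw [Real.norm_eq_abs]
    congr 1
    simp only [Function.comp, Pi.mul_apply, Prod.mk_sub_mk, _root_.smul_apply,
      _root_.add_apply, ContinuousLinearMap.coe_fst', ContinuousLinearMap.coe_snd',
      smul_eq_mul, hxx, ← hμdef, ← hpdef]
    have hsH : Real.sinh (heightOf L' (μ * p)) ≠ 0 := by
      rw [← hψ]
      exact (Real.sinh_pos_iff.mpr (hL'.trans_le hψ0)).ne'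
    field_simp
    ring

/-- On `d₀ = L` the lower and the upper estimates are joined; elsewhere a small neighbourhood sees
only one of them. -/
lemma stretchBoundedAt_sectorSet {L L' a₀ d₀ : ℝ} (hL : 0 < L) (hLL' : L ≤ L')
    (h : (a₀, d₀) ∈ sectorSet L) : StretchBoundedAt L L' (sectorSet L) a₀ d₀ := by
  obtain ⟨h1, h2, h3⟩ : |a₀| ≤ halfShort L ∧ 0 ≤ d₀ ∧ BelowTop L a₀ d₀ := h
  have hlow : d₀ ≤ L → StretchBoundedAt L L' {q | q.2 ≤ L} a₀ d₀ :=
    stretchBoundedAt_foliated hL hLL' h2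
  have hup : L ≤ d₀ → StretchBoundedAt L L' (sectorSet L ∩ {q | L ≤ q.2}) a₀ d₀ := by
    intro hd
    rcases h1.lt_or_eq with ha | ha
    · exact (stretchBoundedAt_upper hL hLL' ha hd h3).mono Set.inter_subset_right
    · have h4 := sub_le_of_belowTop hL h1 hd h3
      rw [ha, sub_self, zero_pow two_ne_zero, mul_zero] at h4
      obtain rfl : d₀ = L := by linarith
      exact stretchBoundedAt_cusp hL hLL' ha
  rcases lt_trichotomy d₀ L with hd | hd | hd
  · intro K hK
    obtain ⟨δ, hδ, h4⟩ := hlow hd.le K hK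
    refine ⟨min δ (L - d₀), lt_min hδ (by linarith), fun a d had ha hdd => ?_⟩
    refine h4 a d ?_ (ha.trans (min_le_left _ _)) (hdd.trans (min_le_left _ _))
    have := (abs_le.mp (hdd.trans (min_le_right _ _))).2
    exact (by linarith : d ≤ L)
  · refine ((hlow hd.le).union (hup hd.ge)).mono fun q hq => ?_
    rcases le_total q.2 L with h | h
    · exact Or.inl h
    · exact Or.inr ⟨hq, h⟩
  · intro K hK
    obtain ⟨δ, hδ, h4⟩ := hup hd.le K hK
    refine ⟨min δ (d₀ - L), lt_min hδ (by linarith), fun a d had ha hdd => ?_⟩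
    refine h4 a d ⟨had, ?_⟩ (ha.trans (min_le_left _ _)) (hdd.trans (min_le_left _ _))
    have := (abs_le.mp (hdd.trans (min_le_right _ _))).1
    exact (by linarith : L ≤ d)

/-! ### From local to global Lipschitz bounds -/

lemma sq_le_two_mul_cosh_sub_one (t : ℝ) : t ^ 2 ≤ 2 * (Real.cosh t - 1) := by
  linarith [one_add_sq_le_cosh t]

lemma two_mul_cosh_sub_one_le (t : ℝ) : 2 * (Real.cosh t - 1) ≤ Real.cosh t ^ 2 * t ^ 2 := by
  have h1 : Real.cosh t - 1 = 2 * Real.sinh (|t| / 2) ^ 2 := by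
    have := Real.cosh_two_mul (|t| / 2)
    rw [show 2 * (|t| / 2) = |t| by ring, Real.cosh_abs] at this
    rw [this, Real.cosh_sq]
    ring
  have h2 : Real.sinh (|t| / 2) ≤ |t| / 2 * Real.cosh t := by
    refine (sinh_le_self_mul_cosh (by positivity)).trans ?_
    have : Real.cosh (|t| / 2) ≤ Real.cosh t := by
      rw [Real.cosh_le_cosh, abs_of_nonneg (by positivity)]
      linarith [abs_nonneg t]
    gcongr
  have h3 : 0 ≤ Real.sinh (|t| / 2) := Real.sinh_nonneg_iff.mpr (by positivity)
  have h4 : Real.sinh (|t| / 2) ^ 2 ≤ (|t| / 2 * Real.cosh t) ^ 2 := by gcongr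
  rw [mul_pow, div_pow, sq_abs] at h4
  rw [h1]
  linarith

lemma cosh_le_exp_mul_cosh (x y : ℝ) :
    Real.cosh x ≤ Real.exp |x - y| * Real.cosh y := by
  have h1 : x = y + (x - y) := by ring
  have h2 : Real.sinh y * Real.sinh (x - y) ≤ Real.cosh y * Real.sinh |x - y| := by
    calc _ ≤ |Real.sinh y * Real.sinh (x - y)| := le_abs_self _
      _ = |Real.sinh y| * Real.sinh |x - y| := by rw [abs_mul, Real.abs_sinh (x - y)]
      _ ≤ _ := by
        have : |Real.sinh y| ≤ Real.cosh y := by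
          rw [Real.abs_sinh, ← Real.cosh_abs]
          exact (Real.sinh_lt_cosh _).le
        have := Real.sinh_nonneg_iff.mpr (abs_nonneg (x - y))
        gcongr
  calc Real.cosh x = Real.cosh y * Real.cosh (x - y) + Real.sinh y * Real.sinh (x - y) := by
        rw [← Real.cosh_add, ← h1]
    _ ≤ Real.cosh y * Real.cosh |x - y| + Real.cosh y * Real.sinh |x - y| := by
        rw [Real.cosh_abs]; linarith
    _ = _ := by rw [← Real.cosh_add_sinh]; ring

lemma cosh_le_exp_abs (x : ℝ) : Real.cosh x ≤ Real.exp |x| := by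
  simpa using cosh_le_exp_mul_cosh x 0

/-! ### The distance compared with its quadratic form in Fermi coordinates. -/

section

variable {L : ℝ} {v : Fin 6 → UpperHalfPlane} {a d : Fin 3 → UpperHalfPlane → ℝ}

lemma IsHexChart.dist_sq_le (M : IsHexChart L v a d) (i : Fin 3) {z w : UpperHalfPlane} {δ : ℝ}
    (hd : |d i w - d i z| ≤ δ) (ha : |a i w - a i z| ≤ δ) :
    dist z w ^ 2 ≤ Real.exp (3 * δ) *
      ((d i w - d i z) ^ 2 + (Real.cosh (d i z) * (a i w - a i z)) ^ 2) := by
  have e := M.cosh_dist' i z w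
  have b := sq_le_two_mul_cosh_sub_one (dist z w)
  have b1 := two_mul_cosh_sub_one_le (d i z - d i w)
  have b2 := two_mul_cosh_sub_one_le (a i z - a i w)
  have c2 := Real.one_le_cosh (a i z - a i w)
  have c3 := Real.cosh_pos (d i z)
  have c4 := Real.cosh_pos (d i w)
  have he : Real.exp (3 * δ) = Real.exp δ ^ 3 := by rw [← Real.exp_nat_mul]; norm_num
  have hη : 1 ≤ Real.exp δ := Real.one_le_exp ((abs_nonneg _).trans hd)
  have h3 := cosh_le_exp_mul_cosh (d i w) (d i z)
  have h1 : Real.cosh (d i z - d i w) ≤ Real.exp δ := by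
    rw [abs_sub_comm] at hd
    exact (cosh_le_exp_abs _).trans (Real.exp_le_exp.mpr hd)
  have h2 : Real.cosh (a i z - a i w) ≤ Real.exp δ := by
    rw [abs_sub_comm] at ha
    exact (cosh_le_exp_abs _).trans (Real.exp_le_exp.mpr ha)
  have h4 : Real.cosh (d i w) ≤ Real.exp δ * Real.cosh (d i z) :=
    h3.trans (by gcongr)
  rw [he]
  generalize Real.exp δ = η at *
  have hη3 : η ^ 2 ≤ η ^ 3 := pow_le_pow_right₀ hη (by norm_num)
  have p1 : 2 * (Real.cosh (d i z - d i w) - 1) ≤ η ^ 3 * (d i z - d i w) ^ 2 := by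
    refine b1.trans ?_
    have : Real.cosh (d i z - d i w) ^ 2 ≤ η ^ 2 := by gcongr
    have := this.trans hη3
    gcongr
  have p2 : 2 * (Real.cosh (a i z - a i w) - 1) ≤ η ^ 2 * (a i z - a i w) ^ 2 := by
    refine b2.trans ?_
    gcongr
  calc dist z w ^ 2 ≤ 2 * (Real.cosh (d i z - d i w) - 1) +
        Real.cosh (d i z) * Real.cosh (d i w) * (2 * (Real.cosh (a i z - a i w) - 1)) := by
        rw [e] at b; linarith
    _ ≤ η ^ 3 * (d i z - d i w) ^ 2 +
        Real.cosh (d i z) * (η * Real.cosh (d i z)) * (η ^ 2 * (a i z - a i w) ^ 2) :=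
      add_le_add p1 (mul_le_mul (by gcongr) p2 (by linarith) (by positivity))
    _ = _ := by ring

lemma IsHexChart.sq_le_dist_sq (M : IsHexChart L v a d) (i : Fin 3) {z w : UpperHalfPlane} {δ : ℝ}
    (h : dist z w ≤ δ) :
    (d i w - d i z) ^ 2 + (Real.cosh (d i z) * (a i w - a i z)) ^ 2 ≤
      Real.exp (3 * δ) * dist z w ^ 2 := by
  have e := M.cosh_dist' i z w
  have b := two_mul_cosh_sub_one_le (dist z w)
  have b1 := sq_le_two_mul_cosh_sub_one (d i z - d i w)
  have b2 := sq_le_two_mul_cosh_sub_one (a i z - a i w)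
  have c1 := Real.one_le_cosh (d i z - d i w)
  have c3 := Real.cosh_pos (d i z)
  have c4 := Real.cosh_pos (d i w)
  have he : Real.exp (3 * δ) = Real.exp δ ^ 3 := by rw [← Real.exp_nat_mul]; norm_num
  have hη : 1 ≤ Real.exp δ := Real.one_le_exp (dist_nonneg.trans h)
  have h1 : Real.cosh (dist z w) ≤ Real.exp δ := by
    refine (cosh_le_exp_abs _).trans (Real.exp_le_exp.mpr ?_)
    rwa [abs_of_nonneg dist_nonneg]
  have h4 : Real.cosh (d i z) ≤ Real.exp δ * Real.cosh (d i w) := by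
    have := (M.abs_sub_dist_le i z w).trans h
    exact (cosh_le_exp_mul_cosh (d i z) (d i w)).trans (by gcongr)
  rw [he]
  generalize Real.exp δ = η at *
  have p1 : (d i z - d i w) ^ 2 ≤ η * (2 * (Real.cosh (d i z - d i w) - 1)) :=
    b1.trans (le_mul_of_one_le_left (by linarith) hη)
  calc (d i w - d i z) ^ 2 + (Real.cosh (d i z) * (a i w - a i z)) ^ 2 =
        (d i z - d i w) ^ 2 + Real.cosh (d i z) * Real.cosh (d i z) * (a i z - a i w) ^ 2 := by ring
    _ ≤ η * (2 * (Real.cosh (d i z - d i w) - 1)) + Real.cosh (d i z) * (η * Real.cosh (d i w)) *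
        (2 * (Real.cosh (a i z - a i w) - 1)) :=
      add_le_add p1 (mul_le_mul (by gcongr) b2 (sq_nonneg _) (by positivity))
    _ = η * (2 * (Real.cosh (dist z w) - 1)) := by rw [e]; ring
    _ ≤ η * (Real.cosh (dist z w) ^ 2 * dist z w ^ 2) := by
      exact mul_le_mul_of_nonneg_left b (by linarith)
    _ ≤ η * (η ^ 2 * dist z w ^ 2) := by gcongr
    _ = _ := by ring

end

/-- The function `t ↦ dist (g 0) (g t)` has upper right slopes at most `K`, so it stays below `K *
t`. A local constant `K'` for every `K' > K` suffices, with no uniformity in the point. -/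
lemma dist_le_mul_of_local {X : Type*} [PseudoMetricSpace X] {g : ℝ → X} {D K : ℝ} (hD : 0 ≤ D)
    (h : ∀ s ∈ Set.Icc 0 D, ∀ K' > K, ∃ δ > 0, ∀ t ∈ Set.Icc 0 D, |s - t| < δ →
      dist (g s) (g t) ≤ K' * |s - t|) : dist (g 0) (g D) ≤ K * D := by
  have habs (s t : ℝ) : |dist (g 0) (g t) - dist (g 0) (g s)| ≤ dist (g s) (g t) := by
    rw [dist_comm (g 0) (g t), dist_comm (g 0) (g s), dist_comm (g s) (g t)]
    exact abs_dist_sub_le _ _ _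
  have key := image_le_of_liminf_slope_right_le_deriv_boundary
    (f := fun t => dist (g 0) (g t)) (a := 0) (b := D) (B := fun t => K * t) (B' := fun _ => K)
    (fun s hs => ?_) (by simp) (Continuous.continuousOn (by fun_prop)) (fun s _ => by
      simpa using ((hasDerivAt_id s).const_mul K).hasDerivWithinAt) (fun s hs r hr => ?_)
  · exact key ⟨hD, le_rfl⟩
  · rw [Metric.continuousWithinAt_iff]
    intro ε hε
    have hK : 0 < |K| + 1 := by positivity
    obtain ⟨δ, hδ, h1⟩ := h s hs (|K| + 1) (by linarith [le_abs_self K])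
    refine ⟨min δ (ε / (|K| + 1)), lt_min hδ (by positivity), fun t ht hts => ?_⟩
    rw [dist_comm, Real.dist_eq] at hts
    rw [Real.dist_eq]
    refine ((habs s t).trans (h1 t ht (hts.trans_le (min_le_left _ _)))).trans_lt ?_
    have := hts.trans_le (min_le_right _ _)
    rw [lt_div_iff₀ hK] at this
    linarith
  · obtain ⟨K', hK, hKr⟩ := exists_between hr
    obtain ⟨δ, hδ, h1⟩ := h s ⟨hs.1, hs.2.le⟩ K' hK
    refine Filter.Eventually.frequently ?_
    filter_upwards [Ioo_mem_nhdsGT (lt_min hs.2 (lt_add_of_pos_right s hδ))] with t ht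
    have ht1 : t < D := ht.2.trans_le (min_le_left _ _)
    have ht2 : t < s + δ := ht.2.trans_le (min_le_right _ _)
    have hst : 0 < t - s := sub_pos.mpr ht.1
    have h2 := h1 t ⟨hs.1.trans ht.1.le, ht1.le⟩ (by
      rw [abs_sub_comm, abs_of_pos hst]; linarith)
    rw [abs_sub_comm, abs_of_pos hst] at h2
    rw [slope_def_field, div_lt_iff₀ hst]
    have h3 := (le_abs_self _).trans (habs s t)
    have : K' * (t - s) < r * (t - s) := by gcongr
    linarith

/-! ### The Lipschitz bound for the glued map. -/

section

variable {L L' : ℝ} {v w : Fin 6 → UpperHalfPlane} {a d a' d' : Fin 3 → UpperHalfPlane → ℝ}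
  {F : hexRegion v → hexRegion w}

lemma IsGlued.eventually_dist_le (hF : IsGlued L L' a d a' d' (sectorHeight L L') F)
    (M : IsHexModel L v a d) (M' : IsHexModel L' w a' d') (hLL' : L ≤ L') (z : hexRegion v)
    (i : Fin 3) {K : ℝ} (hK : L' / L < K) :
    ∀ᶠ y : hexRegion v in nhds z, (∀ j, d i y ≤ d j y) → dist (F z) (F y) ≤ K * dist z y := by
  by_cases hz : ∀ j, d i z ≤ d j z
  · have hk : 0 < L' / L := div_pos M'.pos M.pos
    have hr := shortRatio_pos M.pos M'.pos
    have hr1 := shortRatio_le_one M.pos hLL'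
    obtain ⟨K₁, hK₁, hK₁K⟩ := exists_between hK
    have hK₁0 := hk.trans hK₁
    have hK0 := hK₁0.trans hK₁K
    have hmem : ∀ y : hexRegion v, (∀ j, d i y ≤ d j y) → (a i y, d i y) ∈ sectorSet L :=
      fun y hy => ⟨M.abs_foot_le y.2 i, M.dist_nonneg' y.2 i,
        (M.forall_le_iff i (M.abs_foot_le y.2 i)).mp hy⟩
    obtain ⟨δ, hδ, h⟩ := stretchBoundedAt_sectorSet M.pos hLL' (hmem z hz) K₁ hK₁
    obtain ⟨-, f1, f2⟩ := hF z i hz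
    -- Passing from distance to quadratic form and back costs `exp (3 ρ)` each time in the squares;
    -- this choice makes the total exactly `K²`.
    set ρ := (Real.log K - Real.log K₁) / 3 with hρdef
    have hρ : 0 < ρ := by
      have := Real.log_lt_log hK₁0 hK₁K
      rw [hρdef]
      linarith
    have hρe : Real.exp (3 * ρ) * K₁ = K := by
      rw [hρdef, mul_div_cancel₀ _ (by norm_num), Real.exp_sub, Real.exp_log hK0,
        Real.exp_log hK₁0]
      field_simp
    have hρ1 : 1 ≤ Real.exp (3 * ρ) := Real.one_le_exp (by linarith)
    filter_upwards [Metric.closedBall_mem_nhds z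
      (lt_min hδ (lt_min hρ (div_pos hρ hK0)))] with y hy hyi
    rw [Metric.mem_closedBall, dist_comm, Subtype.dist_eq] at hy
    have hy1 := hy.trans (min_le_left _ _)
    have hy2 := hy.trans ((min_le_right _ _).trans (min_le_left _ _))
    have hy3 := hy.trans ((min_le_right _ _).trans (min_le_right _ _))
    rw [le_div_iff₀ hK0] at hy3
    obtain ⟨-, g1, g2⟩ := hF y i hyi
    have ha := M.abs_sub_foot_le i z y
    have hd := M.abs_sub_dist_le i z y
    rw [abs_sub_comm] at ha hd
    have h1 := h _ _ (hmem y hyi) (ha.trans hy1) (hd.trans hy1)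
    rw [← f2, ← g2, mul_sub, ← f1, ← g1] at h1
    have h2 := M.sq_le_dist_sq i hy2
    have h3 : (d' i (F y) - d' i (F z)) ^ 2 +
        (Real.cosh (d' i (F z)) * (a' i (F y) - a' i (F z))) ^ 2 ≤
        K₁ ^ 2 * (Real.exp (3 * ρ) * dist (z : UpperHalfPlane) y ^ 2) :=
      h1.trans (by gcongr)
    have h4 : |d' i (F y) - d' i (F z)| ≤ K * dist (z : UpperHalfPlane) y := by
      apply abs_le_of_sq_le_sq _ (by positivity)
      calc _ ≤ K₁ ^ 2 * (Real.exp (3 * ρ) * dist (z : UpperHalfPlane) y ^ 2) :=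
            (le_add_of_nonneg_right (sq_nonneg _)).trans h3
        _ ≤ K₁ ^ 2 * (Real.exp (3 * ρ) ^ 2 * dist (z : UpperHalfPlane) y ^ 2) := by
            gcongr
            exact le_self_pow₀ hρ1 two_ne_zero
        _ = _ := by rw [← hρe]; ring
    have h5 : |a' i (F y) - a' i (F z)| ≤ ρ := by
      rw [f1, g1, ← mul_sub, abs_mul, abs_of_pos hr]
      exact (mul_le_of_le_one_left (abs_nonneg _) hr1).trans (ha.trans hy2)
    have h6 := M'.dist_sq_le i (h4.trans (by linarith)) h5
    rw [Subtype.dist_eq, Subtype.dist_eq]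
    refine (sq_le_sq₀ dist_nonneg (by positivity)).mp (h6.trans ?_)
    calc _ ≤ Real.exp (3 * ρ) *
          (K₁ ^ 2 * (Real.exp (3 * ρ) * dist (z : UpperHalfPlane) y ^ 2)) := by gcongr
      _ = _ := by rw [← hρe]; ring
  -- If `z` is outside the sector of edge `i`, the sector being closed, no nearby point belongs to
  -- it.
  · push Not at hz
    obtain ⟨j, hj⟩ := hz
    filter_upwards [Metric.ball_mem_nhds z (show 0 < (d i z - d j z) / 2 by linarith)] with y hy hyi
    rw [Metric.mem_ball, dist_comm, Subtype.dist_eq] at hy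
    have h1 := abs_le.mp (M.abs_sub_dist_le i z y)
    have h2 := abs_le.mp (M.abs_sub_dist_le j z y)
    have h3 := hyi j
    linarith [h1.2, h2.1]

lemma IsGlued.dist_le (hF : IsGlued L L' a d a' d' (sectorHeight L L') F)
    (M : IsHexModel L v a d) (M' : IsHexModel L' w a' d') (hLL' : L ≤ L') (z y : hexRegion v) :
    dist (F z) (F y) ≤ L' / L * dist z y := by
  obtain ⟨γ, h0, h1, h⟩ := hexRegion_geodesic z.2 y.2
  have hex : ∀ t, ∃ g : hexRegion v,
      t ∈ Set.Icc 0 (dist (z : UpperHalfPlane) y) → (g : UpperHalfPlane) = γ t := fun t => by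
    by_cases ht : t ∈ Set.Icc 0 (dist (z : UpperHalfPlane) y)
    · exact ⟨⟨γ t, (h t ht).1⟩, fun _ => rfl⟩
    · exact ⟨z, fun h => absurd h ht⟩
  choose g hg using hex
  have e0 : g 0 = z := Subtype.ext ((hg 0 ⟨le_rfl, dist_nonneg⟩).trans h0)
  have e1 : g (dist (z : UpperHalfPlane) y) = y :=
    Subtype.ext ((hg _ ⟨dist_nonneg, le_rfl⟩).trans h1)
  have key := dist_le_mul_of_local (g := fun t => F (g t)) (K := L' / L)
    (dist_nonneg (x := (z : UpperHalfPlane)) (y := y)) (fun s hs K hK => by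
      have h2 := Filter.eventually_all.mpr
        (fun i => hF.eventually_dist_le M M' hLL' (g s) i hK)
      obtain ⟨δ, hδ, h3⟩ := Metric.eventually_nhds_iff.mp h2
      refine ⟨δ, hδ, fun t ht hst => ?_⟩
      have h4 : dist (g s) (g t) = |s - t| := by
        rw [Subtype.dist_eq, hg s hs, hg t ht]
        exact (h s hs).2 t ht
      -- The local bound holds for all three edges at once, so the sector is chosen according to the
      -- moving point `g t`, and crossings of sector boundaries need no attention.
      obtain ⟨i, hi⟩ := IsHexModel.exists_min d (g t)
      rw [← h4]
      exact h3 (by rwa [dist_comm, h4]) i hi)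
  simp only [e0, e1] at key
  exact key

end

/-! ### The stretch homeomorphism -/

/-- The defining inequalities are closed, and in each sector both coordinates are bounded: `cosh d ≤
2 cosh L`. -/
lemma IsHexModel.isCompact {L : ℝ} {v : Fin 6 → UpperHalfPlane}
    {a d : Fin 3 → UpperHalfPlane → ℝ} (M : IsHexModel L v a d) : IsCompact (hexRegion v) := by
  have ca : ∀ i, Continuous (a i) := fun i =>
    (LipschitzWith.mk_one fun x y => M.abs_sub_foot_le i x y).continuous
  have cd : ∀ i, Continuous (d i) := fun i =>
    (LipschitzWith.mk_one fun x y => M.abs_sub_dist_le i x y).continuous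
  have hclosed : IsClosed (hexRegion v) := by
    have e : hexRegion v = ⋂ i, ({z | 0 ≤ d i z} ∩ {z | |a i z| ≤ halfShort L}) := by
      ext z
      simp only [Set.mem_iInter, M.mem_hexRegion]
      rfl
    rw [e]
    exact isClosed_iInter fun i => (isClosed_le continuous_const (cd i)).inter
      (isClosed_le (ca i).abs continuous_const)
  refine Metric.isCompact_of_isClosed_isBounded hclosed ?_
  refine (Bornology.isBounded_iUnion.mpr fun i : Fin 3 => Metric.isBounded_closedBall
    (x := v (shortIdx i)) (r := 2 * Real.cosh L * Real.cosh (2 * halfShort L))).subset ?_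
  intro z hz
  obtain ⟨i, hi⟩ := IsHexModel.exists_min d z
  have h1 := M.abs_foot_le hz i
  have h2 := M.dist_nonneg' hz i
  have h3 := cosh_le_of_belowTop M.pos h1 h2 ((M.forall_le_iff i h1).mp hi)
  have hl := halfShort_pos M.pos
  refine Set.mem_iUnion.mpr ⟨i, ?_⟩
  rw [Metric.mem_closedBall]
  calc dist z (v (shortIdx i)) ≤ Real.sinh (dist z (v (shortIdx i))) := self_le_sinh dist_nonneg
    _ ≤ Real.cosh (dist z (v (shortIdx i))) := (Real.sinh_lt_cosh _).le
    _ = Real.cosh (d i z) * Real.cosh (a i z + halfShort L) := by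
      rw [M.cosh_dist_of_dist_eq_zero i (M.first i).2, (M.first i).1, sub_neg_eq_add]
    _ ≤ _ := by
      have h4 : Real.cosh (a i z + halfShort L) ≤ Real.cosh (2 * halfShort L) := by
        obtain ⟨h5, h6⟩ := abs_le.mp h1
        rw [Real.cosh_le_cosh, abs_of_nonneg (by linarith), abs_of_nonneg (by linarith)]
        linarith
      have := Real.cosh_pos L
      have := Real.cosh_pos (a i z + halfShort L)
      gcongr

/-- Only the forward map is shown to be continuous; a continuous bijection from a compact space to a
Hausdorff space is a homeomorphism. -/
lemma IsHexModel.exists_homeomorph {L L' : ℝ} {v w : Fin 6 → UpperHalfPlane}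
    {a d a' d' : Fin 3 → UpperHalfPlane → ℝ} (M : IsHexModel L v a d) (M' : IsHexModel L' w a' d')
    (hLL' : L ≤ L') :
    ∃ h : hexRegion v ≃ₜ hexRegion w,
      IsGlued L L' a d a' d' (sectorHeight L L') h ∧
      IsGlued L' L a' d' a d (sectorHeight L' L) h.symm := by
  have hL := M.pos
  have hL' := M'.pos
  obtain ⟨F, hF⟩ := (isSectorMap_sectorHeight hL hL').exists_isGlued M M'
  obtain ⟨G, hG⟩ := (isSectorMap_sectorHeight hL' hL).exists_isGlued M' M
  have hGF := hF.leftInverse hG M hL' (sectorHeight_sectorHeight hL hL')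
  have hFG := hG.leftInverse hF M' hL (sectorHeight_sectorHeight hL' hL)
  have hcont : Continuous F :=
    (LipschitzWith.of_dist_le_mul (K := (L' / L).toNNReal) fun x y => by
      rw [Real.coe_toNNReal _ (by positivity)]
      exact hF.dist_le M M' hLL' x y).continuous
  have : CompactSpace (hexRegion v) := isCompact_iff_compactSpace.mp M.isCompact
  let e : hexRegion v ≃ hexRegion w := ⟨F, G, hGF, hFG⟩
  exact ⟨Continuous.homeoOfEquivCompactToT2 (f := e) hcont, hF, hG⟩

/-! ### Lipschitz constants -/

lemma ofReal_le_lipConst {X Y : Type*} [MetricSpace X] [MetricSpace Y] {f : X → Y} {k r : ℝ}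
    {x y : X} (hne : f x ≠ f y) (hxy : dist x y ≤ r) (hf : k * r ≤ dist (f x) (f y)) :
    ENNReal.ofReal k ≤ lipConst f := by
  have hxy' : x ≠ y := fun h => hne (by rw [h])
  have h1 : edist (f x) (f y) / edist x y ≤ lipConst f :=
    le_iSup₂_of_le x y (le_iSup_of_le hxy' le_rfl)
  refine le_trans ?_ h1
  rcases le_total k 0 with hk | hk
  · rw [ENNReal.ofReal_of_nonpos hk]
    exact zero_le
  rw [ENNReal.le_div_iff_mul_le (Or.inl (edist_pos.mpr hxy').ne') (Or.inl (edist_ne_top _ _)),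
    edist_dist, edist_dist, ← ENNReal.ofReal_mul hk]
  exact ENNReal.ofReal_le_ofReal ((mul_le_mul_of_nonneg_left hxy hk).trans hf)

lemma lipConst_le {X Y : Type*} [MetricSpace X] [MetricSpace Y] {f : X → Y} {k : ℝ}
    (hf : LipschitzWith k.toNNReal f) : lipConst f ≤ ENNReal.ofReal k := by
  refine iSup₂_le fun x y => iSup_le fun _ => ?_
  exact ENNReal.div_le_of_le_mul (hf x y)

lemma vertex_mem_hexRegion {v : Fin 6 → UpperHalfPlane} (hv : IsSymmetricHexagon v) (j : Fin 6) :
    v j ∈ hexRegion v := by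
  intro i
  by_cases h1 : j = i
  · subst h1
    simp [hypSide, diskCoord]
  by_cases h2 : j = i + 1
  · subst h2
    rw [hypSide, mul_comm, Complex.mul_conj, Complex.ofReal_im]
  exact (hv.convex i j h1 h2).le

/-- The endpoints of a long edge of the target, at distance `2kL`, have preimages on a single long
edge of the source, hence at distance at most `2L`. Neither continuity nor injectivity of the map
plays a role. -/
lemma SendsLongToLong.le_lipConst {v w : Fin 6 → UpperHalfPlane} (hv : IsSymmetricHexagon v)
    {k : ℝ} (hk : 0 < k) (hw : IsStretchedHexagon k v w) {f : hexRegion v → hexRegion w}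
    (hf : SendsLongToLong v w f) : ENNReal.ofReal k ≤ lipConst f := by
  obtain ⟨a, d, M⟩ := hv.exists_isHexModel
  obtain ⟨a', d', M'⟩ := hw.symmetric.exists_isHexModel
  obtain ⟨j, hj⟩ := hf 0
  let p : hexRegion w := ⟨w (longIdx j), vertex_mem_hexRegion hw.symmetric _⟩
  let q : hexRegion w := ⟨w (longIdx j + 1), vertex_mem_hexRegion hw.symmetric _⟩
  have hp : p ∈ longSide w j := by
    change dist (w (longIdx j)) (w (longIdx j)) + _ = _
    rw [dist_self, zero_add]
  have hq : q ∈ longSide w j := by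
    change _ + dist (w (longIdx j + 1)) (w (longIdx j + 1)) = _
    rw [dist_self, add_zero]
  rw [← hj] at hp hq
  obtain ⟨x, hx, hxp⟩ := hp
  obtain ⟨y, hy, hyq⟩ := hq
  obtain ⟨x1, x2, x3⟩ := (M.mem_longEdge_iff 0 x).mp hx
  obtain ⟨y1, y2, y3⟩ := (M.mem_longEdge_iff 0 y).mp hy
  have hxy : dist x y ≤ 2 * halfLong v := by
    rw [Subtype.dist_eq, M.dist_of_foot_eq 0 (x1.trans y1.symm), abs_le]
    constructor <;> linarith
  have hpq : dist p q = k * (2 * halfLong v) := by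
    have : dist p q = 2 * halfLong w := M'.dist_long j
    rw [this, halfLong, halfLong, hw.long_eq]
    ring
  have hL := M.pos
  have hpos : 0 < dist p q := by rw [hpq]; positivity
  refine ofReal_le_lipConst (x := x) (y := y) (r := 2 * halfLong v) ?_ hxy ?_
  · rw [hxp, hyq]
    exact dist_pos.mp hpos
  · rw [hxp, hyq, hpq]

end

theorem mainTheorem1 (v : Fin 6 → UpperHalfPlane) (hv : IsSymmetricHexagon v)
    (k : ℝ) (hk : 1 ≤ k) :
    (∃ w : Fin 6 → UpperHalfPlane, IsStretchedHexagon k v w) ∧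
    ∀ w : Fin 6 → UpperHalfPlane, IsStretchedHexagon k v w →
      (∃ h : hexRegion v ≃ₜ hexRegion w,
        (∀ i, h '' longSide v i = longSide w i) ∧
        (∀ i, h '' shortSide v i = shortSide w i) ∧
        (∀ i, h '' foliatedPart v i = foliatedPart w i) ∧
        IsLeafwiseStretch k v w h ∧
        PreservesHypercycles v w h ∧
        PreservesGeodesics v w h ∧
        LipschitzWith k.toNNReal h ∧
        lipConst h = ENNReal.ofReal k) ∧
      ∀ f : hexRegion v → hexRegion w, SendsLongToLong v w f →
        ENNReal.ofReal k ≤ lipConst f := by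
  have hk0 : 0 < k := by linarith
  obtain ⟨a, d, M⟩ := hv.exists_isHexModel
  refine ⟨?_, fun w hw => ⟨?_, fun f hf => hf.le_lipConst hv hk0 hw⟩⟩
  · obtain ⟨w, hw, hd⟩ := exists_isSymmetricHexagon (mul_pos hk0 M.pos)
    refine ⟨w, hw, ?_⟩
    rw [hd, halfLong]
    ring
  obtain ⟨a', d', M'⟩ := hw.symmetric.exists_isHexModel
  have hLw : halfLong w = k * halfLong v := by
    rw [halfLong, halfLong, hw.long_eq]
    ring
  have hL := M.pos
  obtain ⟨h, hh, hg⟩ := M.exists_homeomorph M' (by rw [hLw]; nlinarith)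
  have S := isSectorMap_sectorHeight M.pos M'.pos
  have S' := isSectorMap_sectorHeight M'.pos M.pos
  have hlong := hh.image_longSide hg M M' h.apply_symm_apply
  have hlip : LipschitzWith k.toNNReal h := LipschitzWith.of_dist_le_mul fun x y => by
    rw [Real.coe_toNNReal _ hk0.le]
    have := hh.dist_le M M' (by rw [hLw]; nlinarith) x y
    rwa [hLw, mul_div_cancel_right₀ _ hL.ne'] at this
  refine ⟨h, hlong, hh.image_shortSide hg S S' M M' h.apply_symm_apply,
    hh.image_foliatedPart hg S S' M M' h.apply_symm_apply,
    hh.isLeafwiseStretch hg S S' M M' h.apply_symm_apply hLw,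
    hh.preservesHypercycles hg S S' M M' h.apply_symm_apply,
    hh.preservesGeodesics hg S S' M M' h.apply_symm_apply, hlip,
    le_antisymm (lipConst_le hlip) ?_⟩
  exact SendsLongToLong.le_lipConst hv hk0 hw fun i => ⟨i, hlong i⟩
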